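/- Fix an integer $m>1$ and real numbers $M$, $N$, $K$. There is a constant $C$, depending only on $m,M,N,K$, such that the following holds. Let $\eta>0$ and $\delta>0$ satisfy $\delta\eta\le 1/32$ and $\delta\le 1/32$. For all sufficiently large $n$, let $X^{(n)}_1,\dots,X^{(n)}_m$ be independent random $n\times n$ complex matrices, all of whose entries are i.i.d. copies of $\xi_n/\sqrt n$, where $\xi_n$ is a complex random variable with $\mathbb{E}\xi_n=0$, $\mathbb{E}|\xi_n|^2=1$ and $|\xi_n|\le K n^{\delta}$ almost surely (the law of $\xi_n$ may depend on $n$, all variables are defined on one probability space, and nothing is assumed about the joint law for different $n$). Let $Y=Y^{(n)}$ be the $mn\times mn$ matrix of $n\times n$ blocks $Y_{a,a+1}=X^{(n)}_a$ for $1\le a<m$, $Y_{m,1}=X^{(n)}_m$, and all other blocks zero. For $z\in\mathbb{C}$ let $\nu_n(\cdot,z)$ be the empirical spectral distribution of the Hermitian matrix $(Y-zI)^*(Y-zI)$, that is, the uniform probability measure on its $mn$ eigenvalues counted with multiplicity, and for $\operatorname{Im}\alpha>0$ let $$\Delta_n(\alpha,z)=\int\frac{\nu_n(dx,z)}{x-\alpha}$$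 be its Stieltjes transform. Put $y_n=n^{-\eta\delta}$, $\delta_n=n^{-1/4}y_n^{-5}n^{\delta}$ and $$r_n(\alpha,z)=\Delta_n^3(\alpha,z)+2\Delta_n^2(\alpha,z)+\frac{\alpha+1-|z|^2}{\alpha}\Delta_n(\alpha,z)+\frac1\alpha .$$ Then, almost surely, for all sufficiently large $n$, $$\sup\bigl\{|r_n(\alpha,z)| : |z|\le M,\ |\operatorname{Re}\alpha|\le N,\ \operatorname{Im}\alpha\ge y_n\bigr\}\le C\,\delta_n .$$ -/

import Mathlib

open MeasureTheory ProbabilityTheory Filter Matrix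
open scoped ENNReal

noncomputable section

/-- The `mn × mn` block matrix whose `(a, a+1)` block is `X a`, where block indices are cyclic
(so that the `(m, 1)` block is `X m`), and whose other blocks vanish. -/
def blockCyclic {m n : ℕ} (X : Fin m → Matrix (Fin n) (Fin n) ℂ) :
    Matrix (Fin m × Fin n) (Fin m × Fin n) ℂ :=
  Matrix.of fun p q => if q.1 = finRotate m p.1 then X p.1 p.2 q.2 else 0

/-- The empirical spectral distribution of a Hermitian matrix, as a measure on `ℝ`. -/
def hermitianESD {ι : Type*} [Fintype ι] [DecidableEq ι] {A : Matrix ι ι ℂ}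
    (hA : A.IsHermitian) : Measure ℝ :=
  (Fintype.card ι : ℝ≥0∞)⁻¹ • ∑ i, Measure.dirac (hA.eigenvalues i)

/-- The Stieltjes transform of a measure on `ℝ`. -/
def stieltjes (μ : Measure ℝ) (α : ℂ) : ℂ :=
  ∫ x, 1 / ((x : ℂ) - α) ∂μ

/-- The Stieltjes transform at `α` of the empirical spectral distribution of
`(Y - z I)ᴴ (Y - z I)`. -/
def shiftedStieltjes {ι : Type*} [Fintype ι] [DecidableEq ι] (Y : Matrix ι ι ℂ) (α z : ℂ) : ℂ :=
  stieltjes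
    (hermitianESD (Matrix.isHermitian_conjTranspose_mul_self (Y - z • (1 : Matrix ι ι ℂ)))) α

/-- The random matrices `X 1, …, X m` of order `n` have jointly independent entries (so they are
independent, with independent entries), every entry is a copy of `ξ / √n`, the variable `ξ` has
mean `0` and variance `1`, and `|ξ| ≤ b` almost surely. -/
structure IsBoundedEnsemble {Ω : Type*} [MeasurableSpace Ω] (P : Measure Ω) {m n : ℕ}
    (X : Fin m → Ω → Matrix (Fin n) (Fin n) ℂ) (ξ : Ω → ℂ) (b : ℝ) : Prop where
  indep : iIndepFun (fun (p : Fin m × Fin n × Fin n) (ω : Ω) => X p.1 ω p.2.1 p.2.2) P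
  identDistrib : ∀ k i j,
    IdentDistrib (fun ω => X k ω i j) (fun ω => ξ ω / ((Real.sqrt (n : ℝ) : ℝ) : ℂ)) P P
  mean_zero : ∫ ω, ξ ω ∂P = 0
  variance_one : ∫ ω, ‖ξ ω‖ ^ 2 ∂P = 1
  bounded : ∀ᵐ ω ∂P, ‖ξ ω‖ ≤ b

/-- `y_n = n ^ (-η δ)`. -/
def cutoff (η δ : ℝ) (n : ℕ) : ℝ := (n : ℝ) ^ (-(η * δ))

/-- `δ_n = n ^ (-1/4) y_n ^ (-5) n ^ δ`. -/
def errorRate (η δ : ℝ) (n : ℕ) : ℝ :=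
  (n : ℝ) ^ (-(1 / 4) : ℝ) * cutoff η δ n ^ (-5 : ℤ) * (n : ℝ) ^ δ

end

/-!
Write `A = Y - z`. Removing one row of `A` changes its Gram matrix by a rank-one matrix, and the
diagonal entries of the resolvent are rational functions of the quadratic form of the resolvent of
the remaining rows at the removed row. A row of `A` has a single deterministic entry `-z`, and its
random entries lie in one block and are independent of the other rows, so this quadratic form
concentrates around a value that the cyclic symmetry of the blocks expresses through the mean `g` of
the Stieltjes transform. The resulting pair of equations, one for `Aᴴ A` and one for `A Aᴴ`, is
closed, and eliminating the diagonal entry yields the cubic equation for `g`.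

Replacing one row of `A` moves the Stieltjes transform by `O(1 / (n y))`, so McDiarmid's inequality
gives Gaussian concentration around the mean at scale `n ^ (-1/4)`. The transform is Lipschitz with
a polynomial constant and small for large `α`, so a union bound over a grid of polynomial size makes
this uniform in `(α, z)`, and the probabilities are summable in `n`.
-/

section SesquilinearForm

variable {κ ι : Type*} [Fintype ι]

theorem star_dotProduct_self_eq_sum_norm_sq (u : ι → ℂ) :
    star u ⬝ᵥ u = ((∑ i, ‖u i‖ ^ 2 : ℝ) : ℂ) := by
  simp [dotProduct, ← Complex.conj_mul']

theorem star_dotProduct_sub_conjTranspose_mulVec (R : Matrix ι ι ℂ) (v : ι → ℂ) :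
    star v ⬝ᵥ ((R - Rᴴ) *ᵥ v) = 2 * (star v ⬝ᵥ (R *ᵥ v)).im * Complex.I := by
  have : star v ⬝ᵥ (Rᴴ *ᵥ v) = star (star v ⬝ᵥ (R *ᵥ v)) := by
    rw [star_dotProduct, star_mulVec, conjTranspose_conjTranspose, ← dotProduct_mulVec]
  rw [sub_mulVec, dotProduct_sub, this]
  apply Complex.ext <;> simp; ring

theorem mul_mul_conjTranspose_apply_self (A : Matrix κ ι ℂ) (B : Matrix ι ι ℂ) (p : κ) :
    (A * B * Aᴴ) p p = A p ⬝ᵥ (B *ᵥ star (A p)) := by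
  rw [Matrix.mul_assoc]
  rfl

end SesquilinearForm

section Resolvent

variable {κ ι : Type*} [Fintype κ] [Fintype ι] [DecidableEq ι] {α : ℂ}

/-- The resolvent `(Aᴴ A - α)⁻¹` of the Gram matrix of `A`. It is only used for `α` in the open
upper half plane, where the matrix being inverted is invertible. -/
noncomputable def gramResolvent (A : Matrix κ ι ℂ) (α : ℂ) : Matrix ι ι ℂ :=
  (Aᴴ * A - α • (1 : Matrix ι ι ℂ))⁻¹

theorem ne_zero_of_im_pos (hα : 0 < α.im) : α ≠ 0 := by
  rintro rfl
  simp at hα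

theorem ofReal_sub_ne_zero_of_im_pos (hα : 0 < α.im) (x : ℝ) : (x : ℂ) - α ≠ 0 := by
  intro h
  simpa [hα.ne'] using congrArg Complex.im h

theorem sub_smul_one_eq_of_isHermitian {H : Matrix ι ι ℂ} (hH : H.IsHermitian) (α : ℂ) :
    H - α • (1 : Matrix ι ι ℂ) = (hH.eigenvectorUnitary : Matrix ι ι ℂ) *
      diagonal (fun i => (hH.eigenvalues i : ℂ) - α) *
        star (hH.eigenvectorUnitary : Matrix ι ι ℂ) := by
  have hspec := hH.spectral_theorem
  rw [Unitary.conjStarAlgAut_apply] at hspec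
  have hdiag : diagonal (fun i => (hH.eigenvalues i : ℂ) - α)
      = diagonal (RCLike.ofReal ∘ hH.eigenvalues) - α • (1 : Matrix ι ι ℂ) := by
    rw [smul_one_eq_diagonal, diagonal_sub]
    rfl
  rw [hdiag, mul_sub, sub_mul, ← hspec]
  simp

theorem sub_smul_one_mul_of_isHermitian {H : Matrix ι ι ℂ} (hH : H.IsHermitian) (hα : 0 < α.im) :
    (H - α • (1 : Matrix ι ι ℂ)) * ((hH.eigenvectorUnitary : Matrix ι ι ℂ) *
      diagonal (fun i => ((hH.eigenvalues i : ℂ) - α)⁻¹) *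
        star (hH.eigenvectorUnitary : Matrix ι ι ℂ)) = 1 := by
  rw [sub_smul_one_eq_of_isHermitian hH]
  set U := (hH.eigenvectorUnitary : Matrix ι ι ℂ)
  set D := diagonal (fun i => (hH.eigenvalues i : ℂ) - α)
  set D' := diagonal (fun i => ((hH.eigenvalues i : ℂ) - α)⁻¹)
  have hU : star U * U = 1 := Unitary.coe_star_mul_self _
  have hU' : U * star U = 1 := Unitary.coe_mul_star_self _
  have hD : D * D' = 1 := by
    simp [D, D', mul_inv_cancel₀ (ofReal_sub_ne_zero_of_im_pos hα _)]
  calc U * D * star U * (U * D' * star U) = U * D * (star U * U) * D' * star U := by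
        simp only [mul_assoc]
    _ = 1 := by rw [hU, mul_one, mul_assoc U, hD, mul_one, hU']

theorem gram_sub_mul_gramResolvent (A : Matrix κ ι ℂ) (hα : 0 < α.im) :
    (Aᴴ * A - α • (1 : Matrix ι ι ℂ)) * gramResolvent A α = 1 := by
  have h := sub_smul_one_mul_of_isHermitian (isHermitian_conjTranspose_mul_self A) hα
  rw [gramResolvent, inv_eq_right_inv h, h]

theorem gramResolvent_mul_gram_sub (A : Matrix κ ι ℂ) (hα : 0 < α.im) :
    gramResolvent A α * (Aᴴ * A - α • (1 : Matrix ι ι ℂ)) = 1 :=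
  mul_eq_one_comm.mp (gram_sub_mul_gramResolvent A hα)

theorem trace_gramResolvent (A : Matrix κ ι ℂ) (hα : 0 < α.im) :
    (gramResolvent A α).trace =
      ∑ i, ((((isHermitian_conjTranspose_mul_self A).eigenvalues i : ℝ) : ℂ) - α)⁻¹ := by
  have hH := isHermitian_conjTranspose_mul_self A
  have hU : star (hH.eigenvectorUnitary : Matrix ι ι ℂ) * hH.eigenvectorUnitary = 1 :=
    Unitary.coe_star_mul_self _
  rw [gramResolvent, inv_eq_right_inv (sub_smul_one_mul_of_isHermitian hH hα), trace_mul_cycle, hU,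
    one_mul, trace_diagonal]

theorem shiftedStieltjes_eq_trace (Y : Matrix ι ι ℂ) (z : ℂ) (hα : 0 < α.im) :
    shiftedStieltjes Y α z = (Fintype.card ι : ℂ)⁻¹ *
      (gramResolvent (Y - z • (1 : Matrix ι ι ℂ)) α).trace := by
  rw [trace_gramResolvent _ hα, shiftedStieltjes, stieltjes, hermitianESD, integral_smul_measure,
    integral_finsetSum_measure]
  · simp [integral_dirac]
  · intro i _
    exact integrable_dirac (by simp)

theorem gramResolvent_sub_conjTranspose (A : Matrix κ ι ℂ) (hα : 0 < α.im) :
    gramResolvent A α - (gramResolvent A α)ᴴ =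
      (2 * α.im * Complex.I) • ((gramResolvent A α)ᴴ * gramResolvent A α) := by
  set R := gramResolvent A α
  have hR : (Aᴴ * A - α • (1 : Matrix ι ι ℂ)) * R = 1 := gram_sub_mul_gramResolvent A hα
  have hRstar : Rᴴ * (Aᴴ * A - (star α) • (1 : Matrix ι ι ℂ)) = 1 := by
    simpa [conjTranspose_mul, conjTranspose_sub] using congrArg conjTranspose hR
  have hα_sub : (2 * α.im * Complex.I) = α - star α := by
    apply Complex.ext <;> simp; ring
  calc R - Rᴴ = Rᴴ * (Aᴴ * A - (star α) • (1 : Matrix ι ι ℂ)) * R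
        - Rᴴ * ((Aᴴ * A - α • (1 : Matrix ι ι ℂ)) * R) := by rw [hRstar, hR, one_mul, mul_one]
    _ = _ := by
      rw [hα_sub, sub_smul]
      simp only [mul_sub, sub_mul, mul_assoc, mul_smul_comm, smul_mul_assoc, mul_one, one_mul]
      abel

theorem gramResolvent_conjTranspose_mul_comm (A : Matrix κ ι ℂ) (α : ℂ) :
    (gramResolvent A α)ᴴ * gramResolvent A α = gramResolvent A α * (gramResolvent A α)ᴴ := by
  have hcomm : Commute ((Aᴴ * A - α • (1 : Matrix ι ι ℂ))ᴴ) (Aᴴ * A - α • (1 : Matrix ι ι ℂ)) := by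
    rw [conjTranspose_sub, (isHermitian_conjTranspose_mul_self A).eq, conjTranspose_smul,
      conjTranspose_one]
    exact ((Commute.refl _).sub_right ((Commute.one_right _).smul_right α)).sub_left
      ((Commute.one_left _).smul_left _)
  rw [gramResolvent, conjTranspose_nonsing_inv, nonsing_inv_eq_ringInverse,
    nonsing_inv_eq_ringInverse]
  exact hcomm.ringInverse_ringInverse

theorem im_star_dotProduct_gramResolvent_mulVec (A : Matrix κ ι ℂ) (hα : 0 < α.im) (v : ι → ℂ) :
    (star v ⬝ᵥ (gramResolvent A α *ᵥ v)).im
      = α.im * ∑ i, ‖(gramResolvent A α *ᵥ v) i‖ ^ 2 := by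
  have h := star_dotProduct_sub_conjTranspose_mulVec (gramResolvent A α) v
  rw [gramResolvent_sub_conjTranspose A hα, smul_mulVec, dotProduct_smul, ← mulVec_mulVec,
    dotProduct_mulVec, ← star_mulVec, star_dotProduct_self_eq_sum_norm_sq] at h
  have him := congrArg Complex.im h
  simp only [smul_eq_mul, Complex.mul_im, Complex.mul_re, Complex.ofReal_im, Complex.ofReal_re,
    Complex.I_re, Complex.I_im, Complex.re_ofNat, Complex.im_ofNat] at him
  linarith

theorem sum_norm_sq_vecMul_gramResolvent (A : Matrix κ ι ℂ) (α : ℂ) (v : ι → ℂ) :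
    ∑ i, ‖(star v ᵥ* gramResolvent A α) i‖ ^ 2 = ∑ i, ‖(gramResolvent A α *ᵥ v) i‖ ^ 2 := by
  set R := gramResolvent A α
  have hstar : Rᴴ *ᵥ v = star (star v ᵥ* R) := by rw [star_vecMul, star_star]
  have h : star v ⬝ᵥ ((Rᴴ * R) *ᵥ v) = star v ⬝ᵥ ((R * Rᴴ) *ᵥ v) := by
    rw [gramResolvent_conjTranspose_mul_comm]
  rw [← mulVec_mulVec, ← mulVec_mulVec, dotProduct_mulVec, ← star_mulVec,
    dotProduct_mulVec (star v) R, hstar, dotProduct_comm (star v ᵥ* R),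
    star_dotProduct_self_eq_sum_norm_sq, star_dotProduct_self_eq_sum_norm_sq] at h
  exact_mod_cast h.symm

theorem im_gramResolvent_apply_self (A : Matrix κ ι ℂ) (hα : 0 < α.im) (p : ι) :
    (gramResolvent A α p p).im = α.im * ∑ i, ‖gramResolvent A α i p‖ ^ 2 := by
  simpa using im_star_dotProduct_gramResolvent_mulVec A hα (Pi.single p 1)

theorem sum_norm_sq_gramResolvent_row_eq_col (A : Matrix κ ι ℂ) (α : ℂ) (p : ι) :
    ∑ i, ‖gramResolvent A α p i‖ ^ 2 = ∑ i, ‖gramResolvent A α i p‖ ^ 2 := by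
  have h := sum_norm_sq_vecMul_gramResolvent A α (Pi.single p 1)
  rw [← Pi.single_star, star_one] at h
  simpa using h

theorem sum_norm_sq_gramResolvent_col_le (A : Matrix κ ι ℂ) (hα : 0 < α.im) (p : ι) :
    ∑ i, ‖gramResolvent A α i p‖ ^ 2 ≤ (1 / α.im) ^ 2 := by
  have hS : 0 ≤ ∑ i, ‖gramResolvent A α i p‖ ^ 2 := Finset.sum_nonneg fun i _ => sq_nonneg _
  have hdiag : ‖gramResolvent A α p p‖ ^ 2 ≤ ∑ i, ‖gramResolvent A α i p‖ ^ 2 :=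
    Finset.single_le_sum (f := fun i => ‖gramResolvent A α i p‖ ^ 2) (fun i _ => sq_nonneg _)
      (Finset.mem_univ p)
  have him : α.im * ∑ i, ‖gramResolvent A α i p‖ ^ 2 ≤ ‖gramResolvent A α p p‖ := by
    rw [← im_gramResolvent_apply_self A hα p]
    exact Complex.im_le_norm _
  generalize ∑ i, ‖gramResolvent A α i p‖ ^ 2 = S at hS hdiag him ⊢
  have hquad : (α.im * S) ^ 2 ≤ S :=
    (pow_le_pow_left₀ (mul_nonneg hα.le hS) him 2).trans hdiag
  rcases hS.eq_or_lt with rfl | hpos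
  · positivity
  · rw [div_pow, one_pow, le_div_iff₀ (by positivity)]
    exact le_of_mul_le_mul_right (by linarith [mul_pow α.im S 2]) hpos

theorem sum_norm_sq_gramResolvent_row_le (A : Matrix κ ι ℂ) (hα : 0 < α.im) (p : ι) :
    ∑ i, ‖gramResolvent A α p i‖ ^ 2 ≤ (1 / α.im) ^ 2 :=
  (sum_norm_sq_gramResolvent_row_eq_col A α p).trans_le (sum_norm_sq_gramResolvent_col_le A hα p)

theorem norm_gramResolvent_apply_le (A : Matrix κ ι ℂ) (hα : 0 < α.im) (i j : ι) :
    ‖gramResolvent A α i j‖ ≤ 1 / α.im := by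
  have hentry : ‖gramResolvent A α i j‖ ^ 2 ≤ ∑ i, ‖gramResolvent A α i j‖ ^ 2 :=
    Finset.single_le_sum (f := fun i => ‖gramResolvent A α i j‖ ^ 2) (fun i _ => sq_nonneg _)
      (Finset.mem_univ i)
  exact le_of_sq_le_sq (hentry.trans (sum_norm_sq_gramResolvent_col_le A hα j)) (by positivity)

section Conjugate

variable [DecidableEq κ]

theorem mul_gramResolvent (A : Matrix κ ι ℂ) (hα : 0 < α.im) :
    A * gramResolvent A α = gramResolvent Aᴴ α * A := by
  have hR := gram_sub_mul_gramResolvent A hα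
  have hR' := gramResolvent_mul_gram_sub Aᴴ hα
  rw [conjTranspose_conjTranspose] at hR'
  calc A * gramResolvent A α
      = gramResolvent Aᴴ α * (A * Aᴴ - α • (1 : Matrix κ κ ℂ)) * (A * gramResolvent A α) := by
        rw [hR', Matrix.one_mul]
    _ = gramResolvent Aᴴ α * A * ((Aᴴ * A - α • (1 : Matrix ι ι ℂ)) * gramResolvent A α) := by
        simp only [Matrix.mul_sub, Matrix.sub_mul, Matrix.mul_assoc, Matrix.mul_smul,
          Matrix.smul_mul, Matrix.mul_one, Matrix.one_mul]
    _ = _ := by rw [hR, Matrix.mul_one]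

theorem mul_gramResolvent_mul_conjTranspose (A : Matrix κ ι ℂ) (hα : 0 < α.im) :
    A * gramResolvent A α * Aᴴ = 1 + α • gramResolvent Aᴴ α := by
  have h := gramResolvent_mul_gram_sub Aᴴ hα
  rw [conjTranspose_conjTranspose, mul_sub, mul_smul_comm, mul_one, sub_eq_iff_eq_add] at h
  rw [mul_gramResolvent A hα, Matrix.mul_assoc, h]

end Conjugate

theorem im_mul_gramResolvent_apply_self_nonneg (A : Matrix κ ι ℂ) (hα : 0 < α.im) (p : ι) :
    0 ≤ (α * gramResolvent A α p p).im := by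
  classical
  have h := congrFun₂ (mul_gramResolvent_mul_conjTranspose Aᴴ hα) p p
  rw [mul_mul_conjTranspose_apply_self, conjTranspose_conjTranspose] at h
  have hquad := im_star_dotProduct_gramResolvent_mulVec Aᴴ hα (star (Aᴴ p))
  rw [star_star, h, Matrix.add_apply, Matrix.smul_apply, one_apply_eq, smul_eq_mul,
    Complex.add_im, Complex.one_im, zero_add] at hquad
  rw [hquad]
  positivity

theorem trace_gramResolvent_conjTranspose (A : Matrix ι ι ℂ) (hα : 0 < α.im) :
    (gramResolvent Aᴴ α).trace = (gramResolvent A α).trace := by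
  have hconj := congrArg trace (mul_gramResolvent_mul_conjTranspose A hα)
  have hinv := congrArg trace (gramResolvent_mul_gram_sub A hα)
  rw [trace_mul_cycle, trace_add, trace_smul, trace_mul_comm] at hconj
  rw [mul_sub, trace_sub, hconj, mul_smul_comm, mul_one, trace_smul] at hinv
  simp only [smul_eq_mul] at hinv
  refine mul_left_cancel₀ (ne_zero_of_im_pos hα) ?_
  linear_combination hinv

end Resolvent

section RowRemoval

theorem norm_sum_mul_mul_le {ι 𝕜 : Type*} [Fintype ι] [SeminormedRing 𝕜] {d u v : ι → 𝕜}
    (hd : ∀ i, ‖d i‖ ≤ 1) {s : ℝ} (hu : ∑ i, ‖u i‖ ^ 2 ≤ s) (hv : ∑ i, ‖v i‖ ^ 2 ≤ s) :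
    ‖∑ i, d i * (u i * v i)‖ ≤ s := by
  have hterm : ∀ i, ‖d i * (u i * v i)‖ ≤ (‖u i‖ ^ 2 + ‖v i‖ ^ 2) / 2 := fun i =>
    calc ‖d i * (u i * v i)‖ ≤ ‖d i‖ * ‖u i * v i‖ := norm_mul_le _ _
      _ ≤ ‖u i * v i‖ := mul_le_of_le_one_left (norm_nonneg _) (hd i)
      _ ≤ ‖u i‖ * ‖v i‖ := norm_mul_le _ _
      _ ≤ (‖u i‖ ^ 2 + ‖v i‖ ^ 2) / 2 := by linarith [two_mul_le_add_sq ‖u i‖ ‖v i‖]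
  calc ‖∑ i, d i * (u i * v i)‖ ≤ ∑ i, (‖u i‖ ^ 2 + ‖v i‖ ^ 2) / 2 :=
        norm_sum_le_of_le _ fun i _ => hterm i
    _ = (∑ i, ‖u i‖ ^ 2 + ∑ i, ‖v i‖ ^ 2) / 2 := by
        rw [← Finset.sum_div, Finset.sum_add_distrib]
    _ ≤ s := by linarith

variable {κ ι : Type*} [DecidableEq κ]

theorem updateRow_zero_mul_conjTranspose_apply [Fintype ι] (A : Matrix κ ι ℂ) (p k l : κ) :
    (A.updateRow p 0 * (A.updateRow p 0)ᴴ) k l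
      = if k = p ∨ l = p then 0 else (A * Aᴴ) k l := by
  simp only [mul_apply, conjTranspose_apply]
  split_ifs with h
  · rcases h with rfl | rfl <;> simp
  · rw [not_or] at h
    simp [updateRow_ne h.1, updateRow_ne h.2]

variable [Fintype κ]

theorem conjTranspose_mul_self_eq_updateRow_zero_add (A : Matrix κ ι ℂ) (p : κ) :
    Aᴴ * A = (A.updateRow p 0)ᴴ * A.updateRow p 0 + vecMulVec (star (A p)) (A p) := by
  ext j k
  simp only [mul_apply, Matrix.add_apply, conjTranspose_apply, vecMulVec_apply, Pi.star_apply]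
  rw [← Finset.add_sum_erase _ _ (Finset.mem_univ p),
    ← Finset.add_sum_erase (a := p) _ (fun i => star (A.updateRow p 0 i j) * A.updateRow p 0 i k)
      (Finset.mem_univ p), add_comm]
  simp only [updateRow_self, Pi.zero_apply, mul_zero, zero_add]
  congr 1
  refine Finset.sum_congr rfl fun i hi => ?_
  rw [updateRow_ne (Finset.ne_of_mem_erase hi)]

variable [Fintype ι] {α : ℂ}

section RowForm

variable [DecidableEq ι]

/-- The quadratic form of the row `p` of `A` in the resolvent of `A` with this row replaced by
zero. -/
noncomputable def rowForm (A : Matrix κ ι ℂ) (α : ℂ) (p : κ) : ℂ :=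
  A p ⬝ᵥ (gramResolvent (A.updateRow p 0) α *ᵥ star (A p))

theorem gramResolvent_updateRow_sub (A : Matrix κ ι ℂ) (hα : 0 < α.im) (p : κ) :
    gramResolvent (A.updateRow p 0) α - gramResolvent A α =
      vecMulVec (gramResolvent A α *ᵥ star (A p)) (A p ᵥ* gramResolvent (A.updateRow p 0) α) := by
  have hR := gramResolvent_mul_gram_sub A hα
  have hR' := gram_sub_mul_gramResolvent (A.updateRow p 0) hα
  have hrank : vecMulVec (star (A p)) (A p) = (Aᴴ * A - α • (1 : Matrix ι ι ℂ)) -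
      ((A.updateRow p 0)ᴴ * A.updateRow p 0 - α • (1 : Matrix ι ι ℂ)) := by
    rw [conjTranspose_mul_self_eq_updateRow_zero_add A p]
    abel
  rw [← mul_vecMulVec, ← vecMulVec_mul, hrank, sub_mul, mul_sub, hR', ← mul_assoc, hR, one_mul,
    mul_one]

theorem gramResolvent_updateRow_mulVec_star (A : Matrix κ ι ℂ) (hα : 0 < α.im) (p : κ) :
    gramResolvent (A.updateRow p 0) α *ᵥ star (A p)
      = (1 + rowForm A α p) • (gramResolvent A α *ᵥ star (A p)) := by
  have h := congrArg (· *ᵥ star (A p)) (gramResolvent_updateRow_sub A hα p)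
  simp only [sub_mulVec, vecMulVec_mulVec] at h
  rw [sub_eq_iff_eq_add] at h
  rw [h, add_smul, one_smul, add_comm, rowForm, dotProduct_mulVec]
  congr 1
  ext i
  simp [mul_comm]

theorem mul_gramResolvent_conjTranspose_mul_one_add_rowForm (A : Matrix κ ι ℂ) (hα : 0 < α.im)
    (p : κ) : α * gramResolvent Aᴴ α p p * (1 + rowForm A α p) = -1 := by
  have hdiag := congrFun₂ (mul_gramResolvent_mul_conjTranspose A hα) p p
  rw [mul_mul_conjTranspose_apply_self, Matrix.add_apply, Matrix.smul_apply, one_apply_eq,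
    smul_eq_mul] at hdiag
  have hform := congrArg (A p ⬝ᵥ ·) (gramResolvent_updateRow_mulVec_star A hα p)
  simp only [dotProduct_smul, smul_eq_mul] at hform
  rw [← rowForm, hdiag] at hform
  linear_combination -hform

theorem one_add_rowForm_ne_zero (A : Matrix κ ι ℂ) (hα : 0 < α.im) (p : κ) :
    1 + rowForm A α p ≠ 0 := fun h => by
  simpa [h] using mul_gramResolvent_conjTranspose_mul_one_add_rowForm A hα p

theorem im_rowForm (A : Matrix κ ι ℂ) (hα : 0 < α.im) (p : κ) :
    (rowForm A α p).im
      = α.im * ∑ i, ‖(gramResolvent (A.updateRow p 0) α *ᵥ star (A p)) i‖ ^ 2 := by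
  rw [← im_star_dotProduct_gramResolvent_mulVec _ hα, star_star, rowForm]

theorem gramResolvent_updateRow_sub_apply_self (A : Matrix κ ι ℂ) (hα : 0 < α.im) (p : κ) (i : ι) :
    gramResolvent (A.updateRow p 0) α i i - gramResolvent A α i i =
      (1 + rowForm A α p)⁻¹ * ((gramResolvent (A.updateRow p 0) α *ᵥ star (A p)) i *
        (A p ᵥ* gramResolvent (A.updateRow p 0) α) i) := by
  have h := congrFun₂ (gramResolvent_updateRow_sub A hα p) i i
  rw [Matrix.sub_apply, vecMulVec_apply] at h
  rw [h, gramResolvent_updateRow_mulVec_star A hα p, Pi.smul_apply, smul_eq_mul, mul_assoc,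
    inv_mul_cancel_left₀ (one_add_rowForm_ne_zero A hα p)]

theorem norm_sum_mul_gramResolvent_updateRow_sub_le (A : Matrix κ ι ℂ) (hα : 0 < α.im) (p : κ)
    {d : ι → ℂ} (hd : ∀ i, ‖d i‖ ≤ 1) :
    ‖∑ i, d i * (gramResolvent (A.updateRow p 0) α i i - gramResolvent A α i i)‖ ≤ 1 / α.im := by
  set R' := gramResolvent (A.updateRow p 0) α
  set q := rowForm A α p
  have hcol : ∑ i, ‖(R' *ᵥ star (A p)) i‖ ^ 2 = q.im / α.im :=
    eq_div_of_mul_eq hα.ne' ((mul_comm _ _).trans (im_rowForm A hα p).symm)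
  have hrow : ∑ i, ‖(A p ᵥ* R') i‖ ^ 2 = q.im / α.im := by
    rw [← hcol, ← sum_norm_sq_vecMul_gramResolvent, star_star]
  have hsum : ∑ i, d i * (R' i i - gramResolvent A α i i)
      = (1 + q)⁻¹ * ∑ i, d i * ((R' *ᵥ star (A p)) i * (A p ᵥ* R') i) := by
    rw [Finset.mul_sum]
    refine Finset.sum_congr rfl fun i _ => ?_
    rw [gramResolvent_updateRow_sub_apply_self A hα p]
    ring
  have him : q.im ≤ ‖1 + q‖ := by simpa using Complex.im_le_norm (1 + q)
  rw [hsum, norm_mul, norm_inv,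
    inv_mul_le_iff₀ (norm_pos_iff.mpr (one_add_rowForm_ne_zero A hα p)), mul_one_div]
  exact (norm_sum_mul_mul_le hd hcol.le hrow.le).trans (by gcongr)

end RowForm

theorem gramResolvent_conjTranspose_updateRow_apply_eq_zero (A : Matrix κ ι ℂ) (hα : 0 < α.im)
    {p i : κ} (hi : i ≠ p) : gramResolvent (A.updateRow p 0)ᴴ α i p = 0 := by
  have h := congrFun₂ (gramResolvent_mul_gram_sub (A.updateRow p 0)ᴴ hα) i p
  rw [conjTranspose_conjTranspose, mul_sub, Matrix.sub_apply, mul_apply, one_apply_ne hi] at h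
  simpa [updateRow_zero_mul_conjTranspose_apply, ne_zero_of_im_pos hα] using h

theorem gramResolvent_conjTranspose_updateRow_sub_apply_mul (A : Matrix κ ι ℂ) (hα : 0 < α.im)
    {p i : κ} (hi : i ≠ p) (j : κ) :
    (gramResolvent (A.updateRow p 0)ᴴ α i j - gramResolvent Aᴴ α i j) * gramResolvent Aᴴ α p p
      = -(gramResolvent Aᴴ α i p * gramResolvent Aᴴ α p j) := by
  set A' := A.updateRow p 0
  set R := gramResolvent Aᴴ α
  set R' := gramResolvent A'ᴴ α
  have hR : (A * Aᴴ - α • (1 : Matrix κ κ ℂ)) * R = 1 := by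
    simpa only [conjTranspose_conjTranspose] using gram_sub_mul_gramResolvent Aᴴ hα
  have hR' : R' * (A' * A'ᴴ - α • (1 : Matrix κ κ ℂ)) = 1 := by
    simpa only [conjTranspose_conjTranspose] using gramResolvent_mul_gram_sub A'ᴴ hα
  have hR'p : R' i p = 0 := gramResolvent_conjTranspose_updateRow_apply_eq_zero A hα hi
  have hsub : R' - R = R' * (A * Aᴴ - A' * A'ᴴ) * R := by
    have : A * Aᴴ - A' * A'ᴴ = (A * Aᴴ - α • (1 : Matrix κ κ ℂ))
        - (A' * A'ᴴ - α • (1 : Matrix κ κ ℂ)) := by abel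
    rw [this, mul_sub, sub_mul, hR', mul_assoc, hR, one_mul, mul_one]
  have hrow : ∀ l ≠ p, (R' * (A * Aᴴ - A' * A'ᴴ)) i l = 0 := by
    intro l hl
    rw [mul_apply]
    refine Finset.sum_eq_zero fun k _ => ?_
    by_cases hk : k = p
    · rw [hk, hR'p, zero_mul]
    · rw [Matrix.sub_apply, updateRow_zero_mul_conjTranspose_apply, if_neg (by simp [hk, hl]),
        sub_self, mul_zero]
  have hentry : ∀ j, R' i j - R i j = (R' * (A * Aᴴ - A' * A'ᴴ)) i p * R p j := by
    intro j
    rw [← Matrix.sub_apply, hsub, mul_apply]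
    exact Finset.sum_eq_single p (fun l _ hl => by rw [hrow l hl, zero_mul]) (by simp)
  have hp := hentry p
  rw [hR'p, zero_sub] at hp
  rw [hentry j]
  linear_combination (-R p j) * hp

theorem norm_sum_erase_mul_gramResolvent_conjTranspose_updateRow_sub_le (A : Matrix κ ι ℂ)
    (hα : 0 < α.im) (p : κ) {d : κ → ℂ} (hd : ∀ i, ‖d i‖ ≤ 1) :
    ‖∑ i ∈ Finset.univ.erase p,
        d i * (gramResolvent (A.updateRow p 0)ᴴ α i i - gramResolvent Aᴴ α i i)‖ ≤ 1 / α.im := by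
  classical
  set R := gramResolvent Aᴴ α
  have hne : R p p ≠ 0 := fun h => by
    have hdiag : α * R p p * (1 + rowForm A α p) = -1 :=
      mul_gramResolvent_conjTranspose_mul_one_add_rowForm A hα p
    simp [h] at hdiag
  let d' : κ → ℂ := fun i => if i = p then 0 else -d i
  have hd' : ∀ i, ‖d' i‖ ≤ 1 := fun i => by
    by_cases hi : i = p
    · simp [d', hi]
    · simpa [d', hi] using hd i
  have hsum : ∑ i ∈ Finset.univ.erase p,
        d i * (gramResolvent (A.updateRow p 0)ᴴ α i i - R i i)
      = (R p p)⁻¹ * ∑ i, d' i * (R i p * R p i) := by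
    rw [← Finset.add_sum_erase (a := p) _ (fun i => d' i * (R i p * R p i)) (Finset.mem_univ p)]
    simp only [d', if_true, zero_mul, zero_add]
    rw [Finset.mul_sum]
    refine Finset.sum_congr rfl fun i hi => ?_
    have hi' := Finset.ne_of_mem_erase hi
    rw [if_neg hi', eq_inv_mul_iff_mul_eq₀ hne]
    linear_combination d i * gramResolvent_conjTranspose_updateRow_sub_apply_mul A hα hi' i
  have hcol : ∑ i, ‖R i p‖ ^ 2 = (R p p).im / α.im :=
    eq_div_of_mul_eq hα.ne' ((mul_comm _ _).trans (im_gramResolvent_apply_self Aᴴ hα p).symm)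
  have hrow : ∑ i, ‖R p i‖ ^ 2 = (R p p).im / α.im :=
    (sum_norm_sq_gramResolvent_row_eq_col Aᴴ α p).trans hcol
  rw [hsum, norm_mul, norm_inv, inv_mul_le_iff₀ (norm_pos_iff.mpr hne), mul_one_div]
  have him := Complex.im_le_norm (R p p)
  exact (norm_sum_mul_mul_le hd' hcol.le hrow.le).trans (by gcongr)

theorem norm_sum_mul_gramResolvent_conjTranspose_updateRow_sub_le (A : Matrix κ ι ℂ)
    (hα : 0 < α.im) (p : κ) {d : κ → ℂ} (hd : ∀ i, ‖d i‖ ≤ 1) :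
    ‖∑ i, d i * (gramResolvent (A.updateRow p 0)ᴴ α i i - gramResolvent Aᴴ α i i)‖
      ≤ 3 / α.im := by
  have hpp : ‖d p * (gramResolvent (A.updateRow p 0)ᴴ α p p - gramResolvent Aᴴ α p p)‖
      ≤ 1 / α.im + 1 / α.im := by
    rw [norm_mul]
    exact (mul_le_of_le_one_left (norm_nonneg _) (hd p)).trans <| norm_sub_le_of_le
      (norm_gramResolvent_apply_le _ hα p p) (norm_gramResolvent_apply_le _ hα p p)
  rw [← Finset.add_sum_erase _ _ (Finset.mem_univ p)]
  calc _ ≤ (1 / α.im + 1 / α.im) + 1 / α.im := norm_add_le_of_le hpp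
        (norm_sum_erase_mul_gramResolvent_conjTranspose_updateRow_sub_le A hα p hd)
    _ = 3 / α.im := by ring

end RowRemoval

section BoundedFunctions

variable {Z F : Type*} [MeasurableSpace Z] {P : Measure Z}

theorem integrable_of_forall_norm_le [IsFiniteMeasure P] [NormedAddCommGroup F]
    [MeasurableSpace F] [OpensMeasurableSpace F] [SecondCountableTopology F] {f : Z → F} {B : ℝ}
    (hf : Measurable f) (hB : ∀ x, ‖f x‖ ≤ B) : Integrable f P :=
  Integrable.of_bound hf.aestronglyMeasurable B (Eventually.of_forall hB)

theorem abs_integral_le_of_forall_abs_le [IsProbabilityMeasure P] {f : Z → ℝ} {B : ℝ}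
    (hB : ∀ x, |f x| ≤ B) : |∫ x, f x ∂P| ≤ B := by
  simpa using norm_integral_le_of_norm_le_const (μ := P) (f := f) (Eventually.of_forall hB)

theorem integrable_exp_mul_of_forall_abs_le [IsFiniteMeasure P] {h : Z → ℝ} {B : ℝ}
    (hm : Measurable h) (hB : ∀ x, |h x| ≤ B) (t : ℝ) :
    Integrable (fun x => Real.exp (t * h x)) P := by
  refine integrable_of_forall_norm_le (B := Real.exp (|t| * B)) (by fun_prop) fun x => ?_
  rw [Real.norm_of_nonneg (Real.exp_pos _).le, Real.exp_le_exp]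
  calc t * h x ≤ |t| * |h x| := (le_abs_self _).trans_eq (abs_mul _ _)
    _ ≤ |t| * B := mul_le_mul_of_nonneg_left (hB x) (abs_nonneg t)

theorem integral_exp_mul_le_of_forall_abs_le [IsProbabilityMeasure P] {h : Z → ℝ} {c : ℝ}
    (hm : Measurable h) (hc : ∀ x, |h x| ≤ c) (h0 : ∫ x, h x ∂P = 0) (t : ℝ) :
    ∫ x, Real.exp (t * h x) ∂P ≤ Real.exp (c ^ 2 * t ^ 2 / 2) := by
  refine ((hasSubgaussianMGF_of_mem_Icc_of_integral_eq_zero (μ := P) (a := -c) (b := c)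
    hm.aemeasurable (Eventually.of_forall fun x => abs_le.mp (hc x)) h0).mgf_le t).trans_eq ?_
  congr 3
  simp only [NNReal.coe_pow, NNReal.coe_div, coe_nnnorm, NNReal.coe_ofNat, sub_neg_eq_add]
  rw [Real.norm_eq_abs, div_pow, sq_abs]
  ring

end BoundedFunctions

section Resampling

theorem integral_integral_of_measurePreserving {X Y Z G : Type*} [MeasurableSpace X]
    [MeasurableSpace Y] [MeasurableSpace Z] [NormedAddCommGroup G] [NormedSpace ℝ G]
    {P : Measure X} {Q : Measure Y} {T : Measure Z} [SFinite P] [SFinite Q] {g : X × Y → Z}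
    (hg : MeasurePreserving g (P.prod Q) T) {F : Z → G} (hF : Integrable F T) :
    ∫ x, ∫ y, F (g (x, y)) ∂Q ∂P = ∫ z, F z ∂T := by
  rw [← hg.map_eq, integral_map hg.measurable.aemeasurable (by rw [hg.map_eq]; exact hF.1)]
  exact (integral_prod _ (hg.integrable_comp_of_integrable hF)).symm

variable {κ : Type*} [DecidableEq κ] {E : κ → Type*} [∀ k, MeasurableSpace (E k)]

theorem measurable_finset_piecewise (S : Finset κ) :
    Measurable fun q : (∀ k, E k) × (∀ k, E k) => S.piecewise q.1 q.2 := by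
  refine measurable_pi_lambda _ fun i => ?_
  by_cases hi : i ∈ S
  · simp only [Finset.piecewise, hi, if_true]; fun_prop
  · simp only [Finset.piecewise, hi, if_false]; fun_prop

theorem measurable_finset_piecewise_left (S : Finset κ) (x : ∀ k, E k) :
    Measurable fun x' : ∀ k, E k => S.piecewise x' x :=
  (measurable_finset_piecewise S).comp measurable_prodMk_right

theorem measurable_finset_piecewise_right (S : Finset κ) (x : ∀ k, E k) :
    Measurable fun x' : ∀ k, E k => S.piecewise x x' :=
  (measurable_finset_piecewise S).comp measurable_prodMk_left

variable [Fintype κ] (μ : ∀ k, Measure (E k)) [∀ k, IsProbabilityMeasure (μ k)]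

theorem measurePreserving_finset_piecewise (S : Finset κ) :
    MeasurePreserving (fun q : (∀ k, E k) × (∀ k, E k) => S.piecewise q.1 q.2)
      ((Measure.pi μ).prod (Measure.pi μ)) (Measure.pi μ) := by
  refine ⟨measurable_finset_piecewise S, (Measure.pi_eq fun s hs => ?_).symm⟩
  have hpre : (fun q : (∀ k, E k) × (∀ k, E k) => S.piecewise q.1 q.2) ⁻¹' Set.univ.pi s
      = (Set.univ.pi fun i => if i ∈ S then s i else Set.univ) ×ˢ
        (Set.univ.pi fun i => if i ∈ S then Set.univ else s i) := by
    ext q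
    simp only [Set.mem_preimage, Set.mem_pi, Set.mem_univ, true_imp_iff, Set.mem_prod,
      Finset.piecewise, ← forall_and]
    refine forall_congr' fun i => ?_
    by_cases hi : i ∈ S <;> simp [hi]
  rw [Measure.map_apply (measurable_finset_piecewise S) (MeasurableSet.univ_pi hs), hpre,
    Measure.prod_prod, Measure.pi_pi, Measure.pi_pi, ← Finset.prod_mul_distrib]
  refine Finset.prod_congr rfl fun i _ => ?_
  by_cases hi : i ∈ S <;> simp [hi]

variable {G : Type*} [NormedAddCommGroup G] [NormedSpace ℝ G]

theorem integral_integral_piecewise (S : Finset κ) {F : (∀ k, E k) → G}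
    (hF : Integrable F (Measure.pi μ)) :
    ∫ x, ∫ x', F (S.piecewise x x') ∂Measure.pi μ ∂Measure.pi μ = ∫ x, F x ∂Measure.pi μ :=
  integral_integral_of_measurePreserving (measurePreserving_finset_piecewise μ S) hF

theorem integral_integral_piecewise_swap (S : Finset κ) {F : (∀ k, E k) → G}
    (hF : Integrable F (Measure.pi μ)) :
    ∫ x, ∫ x', F (S.piecewise x' x) ∂Measure.pi μ ∂Measure.pi μ = ∫ x, F x ∂Measure.pi μ := by
  simpa only [Finset.piecewise_compl] using integral_integral_piecewise μ Sᶜ hF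

theorem measurePreserving_update (k : κ) :
    MeasurePreserving (fun q : (∀ k, E k) × E k => Function.update q.1 k q.2)
      ((Measure.pi μ).prod (μ k)) (Measure.pi μ) := by
  have hm : Measurable fun q : (∀ k, E k) × E k => Function.update q.1 k q.2 := measurable_update'
  have hid := (MeasurePreserving.id (Measure.pi μ)).prod (measurePreserving_eval μ k)
  refine ⟨hm, ?_⟩
  calc Measure.map (fun q => Function.update q.1 k q.2) ((Measure.pi μ).prod (μ k))
      = Measure.map (fun q => ({k}ᶜ : Finset κ).piecewise q.1 q.2)
          ((Measure.pi μ).prod (Measure.pi μ)) := by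
        rw [← hid.map_eq, Measure.map_map hm hid.measurable]
        congr 1
        ext1 q
        simp [Finset.piecewise_compl, Finset.piecewise_singleton]
    _ = Measure.pi μ := (measurePreserving_finset_piecewise μ {k}ᶜ).map_eq

theorem integral_integral_update (k : κ) {F : (∀ k, E k) → G}
    (hF : Integrable F (Measure.pi μ)) :
    ∫ x, ∫ u, F (Function.update x k u) ∂μ k ∂Measure.pi μ = ∫ x, F x ∂Measure.pi μ :=
  integral_integral_of_measurePreserving (measurePreserving_update μ k) hF

end Resampling

section BoundedDifferences

variable {κ β : Type*} {E : κ → Type*}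

theorem norm_sub_le_of_boundedDifferences {F : Type*} [SeminormedAddCommGroup F]
    {f : (∀ k, E k) → F} {c : ℝ} (row : κ → β)
    (hc : ∀ b x x', (∀ i, row i ≠ b → x i = x' i) → ‖f x - f x'‖ ≤ c) (T : Finset β) :
    ∀ x x' : ∀ k, E k, (∀ i, row i ∉ T → x i = x' i) → ‖f x - f x'‖ ≤ T.card * c := by
  classical
  induction T using Finset.induction_on with
  | empty =>
    intro x x' h
    simp [funext fun i => h i (Finset.notMem_empty _)]
  | insert b T hb ih =>
    intro x x' h
    let y : ∀ k, E k := fun i => if row i = b then x' i else x i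
    have hxy : ‖f x - f y‖ ≤ c := hc b x y fun i hi => (if_neg hi).symm
    have hyx' : ‖f y - f x'‖ ≤ T.card * c := ih y x' fun i hi => by
      by_cases hib : row i = b
      · exact if_pos hib
      · exact (if_neg hib).trans (h i (by simp [hib, hi]))
    rw [Finset.card_insert_of_notMem hb, Nat.cast_succ, add_one_mul]
    linarith [norm_sub_le_norm_sub_add_norm_sub (f x) (f y) (f x')]

theorem exists_forall_norm_le_of_boundedDifferences [Finite β] {F : Type*}
    [SeminormedAddCommGroup F] {f : (∀ k, E k) → F} {c : ℝ} (row : κ → β)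
    (hc : ∀ b x x', (∀ i, row i ≠ b → x i = x' i) → ‖f x - f x'‖ ≤ c) :
    ∃ B, ∀ x, ‖f x‖ ≤ B := by
  have := Fintype.ofFinite β
  rcases isEmpty_or_nonempty (∀ k, E k) with _ | ⟨⟨x₀⟩⟩
  · exact ⟨0, isEmptyElim⟩
  · refine ⟨(Finset.univ : Finset β).card * c + ‖f x₀‖, fun x => ?_⟩
    have h := norm_sub_le_of_boundedDifferences row hc Finset.univ x x₀ (by simp)
    linarith [norm_sub_norm_le (f x) (f x₀)]

variable [Fintype κ] [∀ k, MeasurableSpace (E k)] (μ : ∀ k, Measure (E k))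
  {f : (∀ k, E k) → ℝ} {B c : ℝ}

section PartialMean

variable [DecidableEq κ]

/-- The conditional expectation of `f` given the coordinates in `S`, when the coordinates are
independent with laws `μ`. -/
noncomputable def partialMean (f : (∀ k, E k) → ℝ) (S : Finset κ) (x : ∀ k, E k) : ℝ :=
  ∫ x', f (S.piecewise x x') ∂Measure.pi μ

theorem partialMean_empty (f : (∀ k, E k) → ℝ) (x : ∀ k, E k) :
    partialMean μ f ∅ x = ∫ y, f y ∂Measure.pi μ := by
  simp [partialMean]

variable [∀ k, IsProbabilityMeasure (μ k)]

theorem partialMean_univ (f : (∀ k, E k) → ℝ) (x : ∀ k, E k) :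
    partialMean μ f Finset.univ x = f x := by
  simp [partialMean]

theorem measurable_partialMean (hf : Measurable f) (S : Finset κ) :
    Measurable (partialMean μ f S) :=
  ((hf.comp (measurable_finset_piecewise S)).stronglyMeasurable.integral_prod_right'
    (ν := Measure.pi μ)).measurable

theorem abs_partialMean_le (hB : ∀ x, |f x| ≤ B) (S : Finset κ) (x : ∀ k, E k) :
    |partialMean μ f S x| ≤ B :=
  abs_integral_le_of_forall_abs_le fun _ => hB _

theorem abs_partialMean_sub_le (hf : Measurable f) (hB : ∀ x, |f x| ≤ B) {W : Finset κ}
    (hc : ∀ x x', (∀ i ∉ W, x i = x' i) → |f x - f x'| ≤ c) (S : Finset κ)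
    {x x' : ∀ k, E k} (h : ∀ i ∉ W, x i = x' i) :
    |partialMean μ f S x - partialMean μ f S x'| ≤ c := by
  have hint : ∀ x, Integrable (fun y => f (S.piecewise x y)) (Measure.pi μ) := fun x =>
    integrable_of_forall_norm_le (hf.comp (measurable_finset_piecewise_right S x)) fun _ => hB _
  rw [partialMean, partialMean, ← integral_sub (hint x) (hint x')]
  refine abs_integral_le_of_forall_abs_le fun y => hc _ _ fun i hi => ?_
  simp only [Finset.piecewise, h i hi]

theorem integral_partialMean_piecewise (hf : Measurable f) (hB : ∀ x, |f x| ≤ B) {S W : Finset κ}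
    (hSW : Disjoint S W) (x : ∀ k, E k) :
    ∫ x', partialMean μ f (S ∪ W) (W.piecewise x' x) ∂Measure.pi μ = partialMean μ f S x := by
  have hint : Integrable (fun y => f (S.piecewise x y)) (Measure.pi μ) :=
    integrable_of_forall_norm_le (hf.comp (measurable_finset_piecewise_right S x)) fun _ => hB _
  have hpiecewise : ∀ x' x'' : ∀ k, E k,
      (S ∪ W).piecewise (W.piecewise x' x) x'' = S.piecewise x (W.piecewise x' x'') := by
    intro x' x''
    ext i
    by_cases hiS : i ∈ S
    · simp [hiS, Finset.disjoint_left.mp hSW hiS]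
    · by_cases hiW : i ∈ W <;> simp [hiS, hiW]
  rw [partialMean, ← integral_integral_piecewise μ W hint]
  simp only [partialMean, hpiecewise]

theorem integral_exp_partialMean_sub_le (hf : Measurable f) (hB : ∀ x, |f x| ≤ B) {S W : Finset κ}
    (hc : ∀ x x', (∀ i ∉ W, x i = x' i) → |f x - f x'| ≤ c) (hSW : Disjoint S W)
    (x : ∀ k, E k) (t : ℝ) :
    ∫ x', Real.exp (t * (partialMean μ f (S ∪ W) (W.piecewise x' x) - partialMean μ f S x))
      ∂Measure.pi μ ≤ Real.exp (c ^ 2 * t ^ 2 / 2) := by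
  have hmean := integral_partialMean_piecewise μ hf hB hSW x
  set g : (∀ k, E k) → ℝ := fun x' => partialMean μ f (S ∪ W) (W.piecewise x' x)
  have hg : Measurable g :=
    (measurable_partialMean μ hf _).comp (measurable_finset_piecewise_left W x)
  have hint : Integrable g (Measure.pi μ) :=
    integrable_of_forall_norm_le hg fun _ => abs_partialMean_le μ hB _ _
  refine integral_exp_mul_le_of_forall_abs_le (hg.sub_const _) (fun x' => ?_) ?_ t
  · have hdiff : g x' - partialMean μ f S x = ∫ y, (g x' - g y) ∂Measure.pi μ := by
      rw [integral_sub (integrable_const _) hint, hmean]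
      simp
    rw [hdiff]
    refine abs_integral_le_of_forall_abs_le fun y =>
      abs_partialMean_sub_le μ hf hB hc _ fun i hi => ?_
    simp [hi]
  · rw [integral_sub hint (integrable_const _), hmean]
    simp

theorem integral_exp_partialMean_union_le (hf : Measurable f) (hB : ∀ x, |f x| ≤ B)
    {S W : Finset κ} (hc : ∀ x x', (∀ i ∉ W, x i = x' i) → |f x - f x'| ≤ c)
    (hSW : Disjoint S W) (a t : ℝ) :
    ∫ x, Real.exp (t * (partialMean μ f (S ∪ W) x - a)) ∂Measure.pi μ ≤
      (∫ x, Real.exp (t * (partialMean μ f S x - a)) ∂Measure.pi μ)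
        * Real.exp (c ^ 2 * t ^ 2 / 2) := by
  have hint : ∀ V, Integrable (fun x => Real.exp (t * (partialMean μ f V x - a)))
      (Measure.pi μ) := fun V =>
    integrable_exp_mul_of_forall_abs_le (B := B + |a|) ((measurable_partialMean μ hf V).sub_const a)
      (fun x => (abs_sub _ _).trans (by gcongr; exact abs_partialMean_le μ hB V x)) t
  rw [← integral_integral_piecewise_swap μ W (hint _), ← integral_mul_const]
  refine integral_mono_of_nonneg (Eventually.of_forall fun x => integral_nonneg fun _ =>
    (Real.exp_pos _).le) ((hint S).mul_const _) (Eventually.of_forall fun x => ?_)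
  have hsplit : ∀ y, Real.exp (t * (partialMean μ f (S ∪ W) y - a))
      = Real.exp (t * (partialMean μ f S x - a))
        * Real.exp (t * (partialMean μ f (S ∪ W) y - partialMean μ f S x)) := fun y => by
    rw [← Real.exp_add]
    ring_nf
  simp only [hsplit]
  rw [integral_const_mul]
  exact mul_le_mul_of_nonneg_left (integral_exp_partialMean_sub_le μ hf hB hc hSW x t)
    (Real.exp_pos _).le

theorem integral_exp_partialMean_sub_integral_le [DecidableEq β] (hf : Measurable f)
    (hB : ∀ x, |f x| ≤ B) (row : κ → β)
    (hc : ∀ b x x', (∀ i, row i ≠ b → x i = x' i) → |f x - f x'| ≤ c) (t : ℝ) (T : Finset β) :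
    ∫ x, Real.exp (t * (partialMean μ f {i | row i ∈ T} x - ∫ y, f y ∂Measure.pi μ))
        ∂Measure.pi μ ≤ Real.exp (T.card * c ^ 2 * t ^ 2 / 2) := by
  induction T using Finset.induction_on with
  | empty => simp [partialMean_empty]
  | insert b T hb ih =>
    have hunion : ({i | row i ∈ insert b T} : Finset κ)
        = ({i | row i ∈ T} : Finset κ) ∪ ({i | row i = b} : Finset κ) := by
      ext i
      simp [or_comm]
    have hdisj : Disjoint ({i | row i ∈ T} : Finset κ) ({i | row i = b} : Finset κ) :=
      Finset.disjoint_filter.mpr fun i _ hi hib => hb (hib ▸ hi)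
    rw [hunion]
    refine (integral_exp_partialMean_union_le μ hf hB (fun x x' h => hc b x x' fun i hi =>
      h i (by simpa using hi)) hdisj _ t).trans ?_
    refine (mul_le_mul_of_nonneg_right ih (Real.exp_pos _).le).trans_eq ?_
    rw [← Real.exp_add, Finset.card_insert_of_notMem hb]
    push_cast
    ring_nf

end PartialMean

/-- McDiarmid's inequality, for blocks of coordinates. -/
theorem hasSubgaussianMGF_of_boundedDifferences [∀ k, IsProbabilityMeasure (μ k)]
    [Fintype β] (hf : Measurable f) (row : κ → β)
    (hc : ∀ b x x', (∀ i, row i ≠ b → x i = x' i) → |f x - f x'| ≤ c) {V : NNReal}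
    (hV : Fintype.card β * c ^ 2 ≤ V) :
    HasSubgaussianMGF (fun x => f x - ∫ y, f y ∂Measure.pi μ) V (Measure.pi μ) := by
  classical
  obtain ⟨B, hB⟩ := exists_forall_norm_le_of_boundedDifferences (F := ℝ) row hc
  refine ⟨fun t => integrable_exp_mul_of_forall_abs_le (hf.sub_const _) (B := B + B) (fun x =>
    (abs_sub _ _).trans (add_le_add (hB x) (abs_integral_le_of_forall_abs_le hB))) t,
    fun t => ?_⟩
  have h := integral_exp_partialMean_sub_integral_le μ hf hB row hc t Finset.univ
  simp only [Finset.mem_univ, Finset.filter_true, partialMean_univ, Finset.card_univ] at h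
  refine h.trans ?_
  gcongr

end BoundedDifferences

/-- A complex random variable that is bounded by `b`, centred and of variance `v`. -/
structure IsBoundedCentred {E : Type*} [MeasurableSpace E] (μ : Measure E) (φ : E → ℂ)
    (b v : ℝ) : Prop where
  measurable : Measurable φ
  bound : ∀ u, ‖φ u‖ ≤ b
  mean_zero : ∫ u, φ u ∂μ = 0
  variance : ∫ u, ‖φ u‖ ^ 2 ∂μ = v

section SecondMoments

variable {Z : Type*} [MeasurableSpace Z] {P : Measure Z}

theorem integrable_norm_sq_of_memLp_top [IsFiniteMeasure P] {f : Z → ℂ} (hf : MemLp f ⊤ P) :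
    Integrable (fun x => ‖f x‖ ^ 2) P :=
  (hf.mono_exponent le_top).integrable_norm_pow two_ne_zero

theorem memLp_top_mul {f g : Z → ℂ} (hf : MemLp f ⊤ P) (hg : MemLp g ⊤ P) :
    MemLp (fun x => f x * g x) ⊤ P :=
  hg.mul' hf

theorem integral_norm_le_sqrt [IsProbabilityMeasure P] {f : Z → ℂ} {C : ℝ} (hf : MemLp f 2 P)
    (hC : ∫ x, ‖f x‖ ^ 2 ∂P ≤ C) : ∫ x, ‖f x‖ ∂P ≤ √C := by
  have hvar := variance_nonneg (fun x => ‖f x‖) P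
  rw [variance_eq_sub hf.norm] at hvar
  exact Real.le_sqrt_of_sq_le ((sub_nonneg.mp hvar).trans hC)

theorem norm_add_add_sq_le {F : Type*} [SeminormedAddCommGroup F] (p q r : F) :
    ‖p + q + r‖ ^ 2 ≤ 3 * (‖p‖ ^ 2 + ‖q‖ ^ 2 + ‖r‖ ^ 2) := by
  have h := pow_le_pow_left₀ (norm_nonneg _) (norm_add₃_le (a := p) (b := q) (c := r)) 2
  nlinarith [sq_nonneg (‖p‖ - ‖q‖), sq_nonneg (‖q‖ - ‖r‖), sq_nonneg (‖p‖ - ‖r‖)]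

theorem integral_norm_sq_add_add_le {f g h : Z → ℂ} (hf : MemLp f 2 P) (hg : MemLp g 2 P)
    (hh : MemLp h 2 P) :
    ∫ x, ‖f x + g x + h x‖ ^ 2 ∂P ≤
      3 * (∫ x, ‖f x‖ ^ 2 ∂P + ∫ x, ‖g x‖ ^ 2 ∂P + ∫ x, ‖h x‖ ^ 2 ∂P) := by
  have hf2 : Integrable (fun x => ‖f x‖ ^ 2) P := hf.integrable_norm_pow two_ne_zero
  have hg2 : Integrable (fun x => ‖g x‖ ^ 2) P := hg.integrable_norm_pow two_ne_zero
  have hh2 : Integrable (fun x => ‖h x‖ ^ 2) P := hh.integrable_norm_pow two_ne_zero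
  have hfg : Integrable (fun x => ‖f x‖ ^ 2 + ‖g x‖ ^ 2) P := hf2.add hg2
  rw [← integral_add hf2 hg2, ← integral_add hfg hh2, ← integral_const_mul]
  exact integral_mono_of_nonneg (Eventually.of_forall fun _ => sq_nonneg _)
    ((hfg.add hh2).const_mul 3) (Eventually.of_forall fun x => norm_add_add_sq_le _ _ _)

end SecondMoments

section BoundedCentred

variable {κ E : Type*} [MeasurableSpace E] {μ : Measure E} {φ : E → ℂ} {b v : ℝ}

theorem IsBoundedCentred.memLp_top (h : IsBoundedCentred μ φ b v) : MemLp φ ⊤ μ :=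
  memLp_top_of_bound h.measurable.aestronglyMeasurable b (Eventually.of_forall h.bound)

theorem IsBoundedCentred.integral_star (h : IsBoundedCentred μ φ b v) :
    ∫ u, star (φ u) ∂μ = 0 := by
  simpa [h.mean_zero] using integral_conj (μ := μ) (f := φ)

theorem IsBoundedCentred.conj (h : IsBoundedCentred μ φ b v) :
    IsBoundedCentred μ (fun u => star (φ u)) b v where
  measurable := continuous_star.measurable.comp h.measurable
  bound u := (norm_star _).trans_le (h.bound u)
  mean_zero := h.integral_star
  variance := by simp only [norm_star, h.variance]

theorem IsBoundedCentred.variance_nonneg (h : IsBoundedCentred μ φ b v) : 0 ≤ v :=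
  h.variance ▸ integral_nonneg fun _ => sq_nonneg _

variable [IsProbabilityMeasure μ]

theorem IsBoundedCentred.memLp_top_eval [Fintype κ] (h : IsBoundedCentred μ φ b v) (k : κ) :
    MemLp (fun x : κ → E => φ (x k)) ⊤ (Measure.pi fun _ => μ) :=
  h.memLp_top.comp_measurePreserving (measurePreserving_eval _ k)

theorem IsBoundedCentred.integrable (h : IsBoundedCentred μ φ b v) : Integrable φ μ :=
  h.memLp_top.integrable le_top

theorem IsBoundedCentred.integrable_norm_sq (h : IsBoundedCentred μ φ b v) :
    Integrable (fun u => ‖φ u‖ ^ 2) μ :=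
  integrable_norm_sq_of_memLp_top h.memLp_top

theorem IsBoundedCentred.bound_nonneg (h : IsBoundedCentred μ φ b v) : 0 ≤ b := by
  obtain ⟨u⟩ := μ.nonempty_of_neZero
  exact (norm_nonneg _).trans (h.bound u)

theorem IsBoundedCentred.variance_le_sq (h : IsBoundedCentred μ φ b v) : v ≤ b ^ 2 := by
  calc v = ∫ u, ‖φ u‖ ^ 2 ∂μ := h.variance.symm
    _ ≤ ∫ _, b ^ 2 ∂μ := integral_mono h.integrable_norm_sq (integrable_const _) fun u =>
        pow_le_pow_left₀ (norm_nonneg _) (h.bound u) 2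
    _ = b ^ 2 := by simp

theorem IsBoundedCentred.integral_sq_norm_sq_sub_le (h : IsBoundedCentred μ φ b v) :
    ∫ u, (‖φ u‖ ^ 2 - v) ^ 2 ∂μ ≤ b ^ 2 * v := by
  calc ∫ u, (‖φ u‖ ^ 2 - v) ^ 2 ∂μ
      ≤ ∫ u, ((b ^ 2 - 2 * v) * ‖φ u‖ ^ 2 + v ^ 2) ∂μ := by
        refine integral_mono_of_nonneg (Eventually.of_forall fun _ => sq_nonneg _)
          ((h.integrable_norm_sq.const_mul _).add (integrable_const _))
          (Eventually.of_forall fun u => ?_)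
        have hb : ‖φ u‖ ^ 2 ≤ b ^ 2 := pow_le_pow_left₀ (norm_nonneg _) (h.bound u) 2
        change (‖φ u‖ ^ 2 - v) ^ 2 ≤ (b ^ 2 - 2 * v) * ‖φ u‖ ^ 2 + v ^ 2
        nlinarith [mul_le_mul_of_nonneg_right hb (sq_nonneg ‖φ u‖)]
    _ = (b ^ 2 - 2 * v) * v + v ^ 2 := by
        rw [integral_add (h.integrable_norm_sq.const_mul _) (integrable_const _),
          integral_const_mul, h.variance]
        simp
    _ ≤ b ^ 2 * v := by nlinarith

end BoundedCentred

section Orthogonality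

variable {κ : Type*} [Fintype κ] [DecidableEq κ] {E : κ → Type*} [∀ k, MeasurableSpace (E k)]
  (μ : ∀ k, Measure (E k)) [∀ k, IsProbabilityMeasure (μ k)]

theorem integral_norm_add_sq (k : κ) {f g : (∀ k, E k) → ℂ} (hf : MemLp f 2 (Measure.pi μ))
    (hg : MemLp g 2 (Measure.pi μ)) (hfk : ∀ x u, f (Function.update x k u) = f x)
    (hgk : ∀ x, ∫ u, g (Function.update x k u) ∂μ k = 0) :
    ∫ x, ‖f x + g x‖ ^ 2 ∂Measure.pi μ =
      ∫ x, ‖f x‖ ^ 2 ∂Measure.pi μ + ∫ x, ‖g x‖ ^ 2 ∂Measure.pi μ := by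
  have hi : Integrable (fun x => star (f x) * g x) (Measure.pi μ) := hf.star.integrable_mul hg
  have hf2 : Integrable (fun x => ‖f x‖ ^ 2) (Measure.pi μ) := hf.integrable_norm_pow two_ne_zero
  have hg2 : Integrable (fun x => ‖g x‖ ^ 2) (Measure.pi μ) := hg.integrable_norm_pow two_ne_zero
  have horth : ∫ x, (star (f x) * g x).re ∂Measure.pi μ = 0 := by
    have hre := integral_re hi
    simp only [RCLike.re_eq_complex_re] at hre
    rw [hre, ← integral_integral_update μ k hi]
    simp only [hfk, integral_const_mul, hgk, mul_zero, integral_zero, Complex.zero_re]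
  have hexpand : ∀ x, ‖f x + g x‖ ^ 2 = ‖f x‖ ^ 2 + ‖g x‖ ^ 2 + 2 * (star (f x) * g x).re := by
    intro x
    simp only [← Complex.normSq_eq_norm_sq, Complex.normSq_apply, Complex.add_re, Complex.add_im,
      Complex.mul_re, Complex.star_def, Complex.conj_re, Complex.conj_im]
    ring
  simp only [hexpand]
  have hfg : Integrable (fun x => ‖f x‖ ^ 2 + ‖g x‖ ^ 2) (Measure.pi μ) := hf2.add hg2
  have hre : Integrable (fun x => 2 * (star (f x) * g x).re) (Measure.pi μ) := hi.re.const_mul 2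
  rw [integral_add hfg hre, integral_add hf2 hg2, integral_const_mul, horth, mul_zero, add_zero]

end Orthogonality

section CentredForm

variable {κ ν E : Type*} [DecidableEq κ] {e : ν → κ}

theorem update_apply_of_notMem {s : Finset ν} {k : ν} (he : Function.Injective e) (hk : k ∉ s)
    (x : κ → E) (u : E) {j : ν} (hj : j ∈ s) : Function.update x (e k) u (e j) = x (e j) :=
  Function.update_of_ne (fun h => hk (by rwa [← he h])) u x

theorem linearForm_update (he : Function.Injective e) (f : E → ℂ) (c : ν → ℂ) {s : Finset ν}
    {k : ν} (hk : k ∉ s) (x : κ → E) (u : E) :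
    ∑ j ∈ s, c j * f (Function.update x (e k) u (e j)) = ∑ j ∈ s, c j * f (x (e j)) :=
  Finset.sum_congr rfl fun _ hj => by rw [update_apply_of_notMem he hk x u hj]

/-- The quadratic form with coefficients `Q` in the variables `w j`, `j ∈ s`, minus its mean when
the `w j` are independent and centred of variance `v`. -/
noncomputable def centredForm (v : ℝ) (Q : ν → ν → ℂ) (s : Finset ν) (w : ν → ℂ) : ℂ :=
  ∑ i ∈ s, ∑ j ∈ s, w i * Q i j * star (w j) - v * ∑ i ∈ s, Q i i

/-- The increment of `centredForm v Q s w` when the index `k` joins `s`. -/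
noncomputable def centredFormIncrement (v : ℝ) (Q : ν → ν → ℂ) (s : Finset ν) (k : ν)
    (w : ν → ℂ) : ℂ :=
  Q k k * ((‖w k‖ ^ 2 - v : ℝ) : ℂ) + w k * ∑ j ∈ s, Q k j * star (w j)
    + star (w k) * ∑ i ∈ s, Q i k * w i

theorem centredForm_insert [DecidableEq ν] (v : ℝ) (Q : ν → ν → ℂ) {s : Finset ν} {k : ν}
    (hk : k ∉ s) (w : ν → ℂ) :
    centredForm v Q (insert k s) w = centredForm v Q s w + centredFormIncrement v Q s k w := by
  have hnorm : ((‖w k‖ ^ 2 - v : ℝ) : ℂ) = w k * star (w k) - v := by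
    push_cast
    rw [Complex.star_def, Complex.mul_conj']
  have hcol : ∑ i ∈ s, w i * Q i k * star (w k) = star (w k) * ∑ i ∈ s, Q i k * w i := by
    rw [Finset.mul_sum]
    exact Finset.sum_congr rfl fun i _ => by ring
  have hrow : ∑ j ∈ s, w k * Q k j * star (w j) = w k * ∑ j ∈ s, Q k j * star (w j) := by
    rw [Finset.mul_sum]
    exact Finset.sum_congr rfl fun j _ => by ring
  simp only [centredForm, centredFormIncrement, Finset.sum_insert hk, Finset.sum_add_distrib,
    hnorm, hcol, hrow]
  ring

theorem centredForm_update (he : Function.Injective e) (φ : E → ℂ) (v : ℝ)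
    (Q : ν → ν → ℂ) {s : Finset ν} {k : ν} (hk : k ∉ s) (x : κ → E) (u : E) :
    centredForm v Q s (fun j => φ (Function.update x (e k) u (e j))) =
      centredForm v Q s fun j => φ (x (e j)) := by
  simp only [centredForm]
  congr 1
  refine Finset.sum_congr rfl fun i hi => Finset.sum_congr rfl fun j hj => ?_
  rw [update_apply_of_notMem he hk x u hi, update_apply_of_notMem he hk x u hj]

end CentredForm

section FormMoments

variable {κ ν E : Type*} [MeasurableSpace E] {μ : Measure E} [IsProbabilityMeasure μ]
  {φ : E → ℂ} {b v : ℝ} {e : ν → κ}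

theorem IsBoundedCentred.integral_centredFormIncrement_update [DecidableEq κ]
    (h : IsBoundedCentred μ φ b v) (he : Function.Injective e) (Q : ν → ν → ℂ) {s : Finset ν}
    {k : ν} (hk : k ∉ s) (x : κ → E) :
    ∫ u, centredFormIncrement v Q s k (fun j => φ (Function.update x (e k) u (e j))) ∂μ = 0 := by
  simp only [centredFormIncrement, linearForm_update he φ _ hk,
    linearForm_update he (fun u => star (φ u)) _ hk, Function.update_self]
  have hsq : Integrable (fun u => ‖φ u‖ ^ 2 - v) μ :=
    h.integrable_norm_sq.sub (integrable_const v)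
  have hdiag (q : ℂ) : Integrable (fun u => q * ((‖φ u‖ ^ 2 - v : ℝ) : ℂ)) μ :=
    hsq.ofReal.const_mul q
  have hrow (p q : ℂ) : Integrable (fun u => q * ((‖φ u‖ ^ 2 - v : ℝ) : ℂ) + φ u * p) μ :=
    (hdiag q).add (h.integrable.mul_const p)
  rw [integral_add (hrow _ _) (h.conj.integrable.mul_const _),
    integral_add (hdiag _) (h.integrable.mul_const _), integral_mul_const,
    integral_mul_const, h.mean_zero, h.integral_star, integral_const_mul,
    integral_complex_ofReal, integral_sub h.integrable_norm_sq (integrable_const v), h.variance]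
  simp

variable [Fintype κ]

theorem IsBoundedCentred.memLp_top_linearForm (h : IsBoundedCentred μ φ b v) (e : ν → κ)
    (c : ν → ℂ) (s : Finset ν) :
    MemLp (fun x : κ → E => ∑ j ∈ s, c j * φ (x (e j))) ⊤ (Measure.pi fun _ => μ) :=
  memLp_finsetSum s fun j _ => (h.memLp_top_eval (e j)).const_mul (c j)

theorem IsBoundedCentred.integral_norm_sq_linearForm (h : IsBoundedCentred μ φ b v)
    (he : Function.Injective e) (c : ν → ℂ) (s : Finset ν) :
    ∫ x, ‖∑ j ∈ s, c j * φ (x (e j))‖ ^ 2 ∂(Measure.pi fun _ : κ => μ) =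
      v * ∑ j ∈ s, ‖c j‖ ^ 2 := by
  classical
  induction s using Finset.induction_on with
  | empty => simp
  | insert k s hk ih =>
    have hterm : ∫ x, ‖c k * φ (x (e k))‖ ^ 2 ∂(Measure.pi fun _ : κ => μ) = ‖c k‖ ^ 2 * v := by
      simp only [norm_mul, mul_pow]
      rw [integral_const_mul, integral_comp_eval (μ := fun _ : κ => μ) (f := fun u => ‖φ u‖ ^ 2)
        h.integrable_norm_sq.1, h.variance]
    simp only [Finset.sum_insert hk, add_comm (c k * φ _)]
    rw [integral_norm_add_sq (fun _ => μ) (e k)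
      ((h.memLp_top_linearForm e c s).mono_exponent le_top)
      (((h.memLp_top_eval (e k)).const_mul (c k)).mono_exponent le_top)
      (linearForm_update he φ c hk), ih, hterm]
    · ring
    · intro x
      simp only [Function.update_self, integral_const_mul, h.mean_zero, mul_zero]

theorem IsBoundedCentred.memLp_top_norm_sq_sub (h : IsBoundedCentred μ φ b v) (q : ℂ) (k : κ) :
    MemLp (fun x : κ → E => q * ((‖φ (x k)‖ ^ 2 - v : ℝ) : ℂ)) ⊤ (Measure.pi fun _ => μ) := by
  refine MemLp.const_mul ?_ q
  convert (memLp_top_mul (h.memLp_top_eval k) (h.conj.memLp_top_eval k)).sub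
    (memLp_const (v : ℂ)) using 2 with x
  simp [Complex.mul_conj']

theorem IsBoundedCentred.memLp_top_centredFormIncrement (h : IsBoundedCentred μ φ b v)
    (e : ν → κ) (Q : ν → ν → ℂ) (s : Finset ν) (k : ν) :
    MemLp (fun x : κ → E => centredFormIncrement v Q s k fun j => φ (x (e j))) ⊤
      (Measure.pi fun _ => μ) :=
  ((h.memLp_top_norm_sq_sub _ (e k)).add
    (memLp_top_mul (h.memLp_top_eval (e k)) (h.conj.memLp_top_linearForm e _ s))).add
      (memLp_top_mul (h.conj.memLp_top_eval (e k)) (h.memLp_top_linearForm e _ s))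

theorem IsBoundedCentred.memLp_top_centredForm (h : IsBoundedCentred μ φ b v) (e : ν → κ)
    {Q : (κ → E) → ν → ν → ℂ}
    (hQ : ∀ i j, MemLp (fun x => Q x i j) ⊤ (Measure.pi fun _ => μ)) (s : Finset ν) :
    MemLp (fun x => centredForm v (Q x) s fun j => φ (x (e j))) ⊤ (Measure.pi fun _ => μ) :=
  (memLp_finsetSum s fun i _ => memLp_finsetSum s fun j _ =>
    memLp_top_mul (memLp_top_mul (h.memLp_top_eval (e i)) (hQ i j))
      (h.conj.memLp_top_eval (e j))).sub
      ((memLp_finsetSum s fun i _ => hQ i i).const_mul _)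

theorem IsBoundedCentred.integral_norm_sq_eval_mul [DecidableEq κ]
    (h : IsBoundedCentred μ φ b v) (k : κ) {f : (κ → E) → ℂ}
    (hf : MemLp f ⊤ (Measure.pi fun _ => μ)) (hfk : ∀ x u, f (Function.update x k u) = f x) :
    ∫ x, ‖φ (x k) * f x‖ ^ 2 ∂(Measure.pi fun _ => μ) =
      v * ∫ x, ‖f x‖ ^ 2 ∂(Measure.pi fun _ => μ) := by
  rw [← integral_integral_update (fun _ => μ) k
    (integrable_norm_sq_of_memLp_top (memLp_top_mul (h.memLp_top_eval k) hf))]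
  simp only [hfk, Function.update_self, norm_mul, mul_pow, integral_mul_const, h.variance,
    integral_const_mul]

theorem IsBoundedCentred.integral_norm_sq_centredFormIncrement_le
    (h : IsBoundedCentred μ φ b v) (he : Function.Injective e) (Q : ν → ν → ℂ) {s : Finset ν}
    {k : ν} (hk : k ∉ s) :
    ∫ x, ‖centredFormIncrement v Q s k fun j => φ (x (e j))‖ ^ 2 ∂(Measure.pi fun _ : κ => μ) ≤
      3 * (b ^ 2 * v * ‖Q k k‖ ^ 2 +
        v ^ 2 * (∑ j ∈ s, ‖Q k j‖ ^ 2 + ∑ i ∈ s, ‖Q i k‖ ^ 2)) := by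
  classical
  have hrow := h.conj.memLp_top_linearForm e (Q k) s
  have hcol := h.memLp_top_linearForm e (Q · k) s
  refine (integral_norm_sq_add_add_le
    ((h.memLp_top_norm_sq_sub (Q k k) (e k)).mono_exponent le_top)
    ((memLp_top_mul (h.memLp_top_eval (e k)) hrow).mono_exponent le_top)
    ((memLp_top_mul (h.conj.memLp_top_eval (e k)) hcol).mono_exponent le_top)).trans ?_
  have hdiag_le : ∫ x, ‖Q k k * ((‖φ (x (e k))‖ ^ 2 - v : ℝ) : ℂ)‖ ^ 2
      ∂(Measure.pi fun _ : κ => μ) ≤ b ^ 2 * v * ‖Q k k‖ ^ 2 := by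
    simp only [norm_mul, mul_pow, Complex.norm_real, Real.norm_eq_abs, sq_abs]
    rw [integral_const_mul, integral_comp_eval (μ := fun _ : κ => μ) (i := e k)
      (f := fun u => (‖φ u‖ ^ 2 - v) ^ 2)
      (((h.measurable.norm.pow_const 2).sub_const v).pow_const 2).aestronglyMeasurable, mul_comm]
    exact mul_le_mul_of_nonneg_right h.integral_sq_norm_sq_sub_le (sq_nonneg _)
  rw [h.integral_norm_sq_eval_mul (e k) hrow
      (linearForm_update he (fun u => star (φ u)) (Q k) hk),
    h.conj.integral_norm_sq_eval_mul (e k) hcol (linearForm_update he φ (Q · k) hk),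
    h.conj.integral_norm_sq_linearForm he, h.integral_norm_sq_linearForm he]
  linarith

theorem IsBoundedCentred.integral_norm_sq_centredForm_le (h : IsBoundedCentred μ φ b v)
    (he : Function.Injective e) (Q : ν → ν → ℂ) (s : Finset ν) :
    ∫ x, ‖centredForm v Q s fun j => φ (x (e j))‖ ^ 2 ∂(Measure.pi fun _ : κ => μ) ≤
      3 * (b ^ 2 * v + v ^ 2) * ∑ i ∈ s, ∑ j ∈ s, ‖Q i j‖ ^ 2 := by
  classical
  induction s using Finset.induction_on with
  | empty => simp [centredForm]
  | insert k s hk ih =>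
    have hsum : ∑ i ∈ insert k s, ∑ j ∈ insert k s, ‖Q i j‖ ^ 2 = ∑ i ∈ s, ∑ j ∈ s, ‖Q i j‖ ^ 2
        + (‖Q k k‖ ^ 2 + (∑ j ∈ s, ‖Q k j‖ ^ 2 + ∑ i ∈ s, ‖Q i k‖ ^ 2)) := by
      simp only [Finset.sum_insert hk, Finset.sum_add_distrib]
      ring
    simp only [centredForm_insert v Q hk]
    rw [integral_norm_add_sq (fun _ => μ) (e k)
      ((h.memLp_top_centredForm e (fun i j => memLp_const (Q i j)) s).mono_exponent le_top)
      ((h.memLp_top_centredFormIncrement e Q s k).mono_exponent le_top)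
      (centredForm_update he φ v Q hk) (h.integral_centredFormIncrement_update he Q hk), hsum,
      mul_add]
    refine add_le_add ih ((h.integral_norm_sq_centredFormIncrement_le he Q hk).trans ?_)
    have hoff : 0 ≤ ∑ j ∈ s, ‖Q k j‖ ^ 2 + ∑ i ∈ s, ‖Q i k‖ ^ 2 :=
      add_nonneg (Finset.sum_nonneg fun _ _ => sq_nonneg _)
        (Finset.sum_nonneg fun _ _ => sq_nonneg _)
    have hbv : 0 ≤ b ^ 2 * v := mul_nonneg (sq_nonneg b) h.variance_nonneg
    nlinarith [mul_nonneg (sq_nonneg v) (sq_nonneg ‖Q k k‖), mul_nonneg hbv hoff]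

end FormMoments

section RandomCoefficients

theorem integral_norm_le_sqrt_of_integral_piecewise_le {κ : Type*} [Fintype κ] [DecidableEq κ]
    {E : κ → Type*} [∀ k, MeasurableSpace (E k)] (μ : ∀ k, Measure (E k))
    [∀ k, IsProbabilityMeasure (μ k)] (S : Finset κ) {f : (∀ k, E k) → ℂ} {C : ℝ}
    (hf : MemLp f 2 (Measure.pi μ))
    (hC : ∀ x, ∫ x', ‖f (S.piecewise x' x)‖ ^ 2 ∂Measure.pi μ ≤ C) :
    ∫ x, ‖f x‖ ∂Measure.pi μ ≤ √C := by
  have hf2 : Integrable (fun x => ‖f x‖ ^ 2) (Measure.pi μ) := hf.integrable_norm_pow two_ne_zero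
  refine integral_norm_le_sqrt hf ?_
  rw [← integral_integral_piecewise_swap μ S hf2]
  calc _ ≤ ∫ _, C ∂Measure.pi μ :=
        integral_mono_of_nonneg
          (Eventually.of_forall fun _ => integral_nonneg fun _ => sq_nonneg _)
          (integrable_const C) (Eventually.of_forall hC)
    _ = C := by simp

variable {κ ν E : Type*} [Fintype ν] {e : ν → κ}

theorem piecewise_image_apply [DecidableEq κ] (x x' : κ → E) (i : ν) :
    (Finset.univ.image e).piecewise x' x (e i) = x' (e i) :=
  Finset.piecewise_eq_of_mem _ _ _ (Finset.mem_image_of_mem _ (Finset.mem_univ _))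

theorem apply_piecewise_image [DecidableEq κ] {T : Type*} {Q : (κ → E) → T}
    (hQ : ∀ x x', (∀ k, k ∉ Set.range e → x k = x' k) → Q x = Q x') (x x' : κ → E) :
    Q ((Finset.univ.image e).piecewise x' x) = Q x :=
  hQ _ _ fun _ hk => Finset.piecewise_eq_of_notMem _ _ _ (by simpa using hk)

variable [MeasurableSpace E] {μ : Measure E} [IsProbabilityMeasure μ] {φ : E → ℂ} {b v : ℝ}

theorem IsBoundedCentred.integral_norm_centredForm_le [Fintype κ]
    (h : IsBoundedCentred μ φ b v) (he : Function.Injective e) {Q : (κ → E) → ν → ν → ℂ} {C : ℝ}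
    (hm : ∀ i j, MemLp (fun x => Q x i j) ⊤ (Measure.pi fun _ => μ))
    (hQ : ∀ x x', (∀ k, k ∉ Set.range e → x k = x' k) → Q x = Q x')
    (hC : ∀ x, ∑ i, ∑ j, ‖Q x i j‖ ^ 2 ≤ C) :
    ∫ x, ‖centredForm v (Q x) Finset.univ fun j => φ (x (e j))‖ ∂(Measure.pi fun _ : κ => μ) ≤
      √(3 * (b ^ 2 * v + v ^ 2) * C) := by
  classical
  refine integral_norm_le_sqrt_of_integral_piecewise_le _ (Finset.univ.image e)
    ((h.memLp_top_centredForm e hm Finset.univ).mono_exponent le_top) fun x => ?_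
  simp only [apply_piecewise_image hQ, piecewise_image_apply]
  refine (h.integral_norm_sq_centredForm_le he (Q x) Finset.univ).trans ?_
  have hv := h.variance_nonneg
  exact mul_le_mul_of_nonneg_left (hC x) (by positivity)

theorem IsBoundedCentred.integral_norm_linearForm_le [Fintype κ]
    (h : IsBoundedCentred μ φ b v) (he : Function.Injective e) {c : (κ → E) → ν → ℂ} {C : ℝ}
    (hm : ∀ i, MemLp (fun x => c x i) ⊤ (Measure.pi fun _ => μ))
    (hc : ∀ x x', (∀ k, k ∉ Set.range e → x k = x' k) → c x = c x')
    (hC : ∀ x, ∑ i, ‖c x i‖ ^ 2 ≤ C) :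
    ∫ x, ‖∑ i, c x i * φ (x (e i))‖ ∂(Measure.pi fun _ : κ => μ) ≤ √(v * C) := by
  classical
  have hmem : MemLp (fun x => ∑ i, c x i * φ (x (e i))) ⊤ (Measure.pi fun _ => μ) :=
    memLp_finsetSum _ fun i _ => memLp_top_mul (hm i) (h.memLp_top_eval (e i))
  refine integral_norm_le_sqrt_of_integral_piecewise_le _ (Finset.univ.image e)
    (hmem.mono_exponent le_top) fun x => ?_
  simp only [apply_piecewise_image hc, piecewise_image_apply]
  rw [h.integral_norm_sq_linearForm he]
  exact mul_le_mul_of_nonneg_left (hC x) h.variance_nonneg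

end RandomCoefficients

section Subgaussian

variable {Z : Type*} [MeasurableSpace Z] {P : Measure Z} {X : Z → ℝ} {V : NNReal} {s : ℝ}

theorem abs_le_mul_exp_add_exp (hs : 0 < s) (t : ℝ) :
    |t| ≤ s * (Real.exp (s⁻¹ * t) + Real.exp (-s⁻¹ * t)) := by
  have hpos : t ≤ s * Real.exp (s⁻¹ * t) := by
    have h := mul_le_mul_of_nonneg_left (Real.add_one_le_exp (s⁻¹ * t)) hs.le
    rw [mul_add, mul_inv_cancel_left₀ hs.ne'] at h
    linarith
  have hneg : -t ≤ s * Real.exp (-s⁻¹ * t) := by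
    have h := mul_le_mul_of_nonneg_left (Real.add_one_le_exp (-s⁻¹ * t)) hs.le
    rw [mul_add, ← mul_assoc, mul_neg, mul_inv_cancel₀ hs.ne'] at h
    linarith
  rw [mul_add]
  exact abs_le.mpr ⟨by linarith [mul_pos hs (Real.exp_pos (s⁻¹ * t))],
    by linarith [mul_pos hs (Real.exp_pos (-s⁻¹ * t))]⟩

theorem mgf_le_two_of_hasSubgaussianMGF (hX : HasSubgaussianMGF X V P) {t : ℝ}
    (hV : V * t ^ 2 ≤ 1) : mgf X P t ≤ 2 :=
  calc mgf X P t ≤ Real.exp (V * t ^ 2 / 2) := hX.mgf_le t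
    _ ≤ Real.exp (1 / 2) := Real.exp_le_exp.mpr (by linarith)
    _ ≤ 2 := by
      rw [← Real.le_log_iff_exp_le two_pos]
      linarith [Real.log_two_gt_d9]

theorem integral_abs_le_of_hasSubgaussianMGF (hX : HasSubgaussianMGF X V P) (hs : 0 < s)
    (hV : V ≤ s ^ 2) : ∫ x, |X x| ∂P ≤ 4 * s := by
  have hVs : V * s⁻¹ ^ 2 ≤ 1 := by
    rw [inv_pow, ← div_eq_mul_inv]
    exact div_le_one_of_le₀ hV (sq_nonneg s)
  have hpos := hX.integrable_exp_mul s⁻¹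
  have hneg := hX.integrable_exp_mul (-s⁻¹)
  calc ∫ x, |X x| ∂P
      ≤ ∫ x, s * (Real.exp (s⁻¹ * X x) + Real.exp (-s⁻¹ * X x)) ∂P :=
        integral_mono_of_nonneg (Eventually.of_forall fun _ => abs_nonneg _)
          ((hpos.add hneg).const_mul s)
          (Eventually.of_forall fun x => abs_le_mul_exp_add_exp hs (X x))
    _ = s * (mgf X P s⁻¹ + mgf X P (-s⁻¹)) := by
        rw [integral_const_mul, integral_add hpos hneg]
        rfl
    _ ≤ s * (2 + 2) := by
        gcongr
        · exact mgf_le_two_of_hasSubgaussianMGF hX hVs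
        · exact mgf_le_two_of_hasSubgaussianMGF hX (by rwa [neg_sq])
    _ = 4 * s := by ring

end Subgaussian

section ResolventMap

variable {κ ι : Type*} [Fintype κ] [Fintype ι] [DecidableEq ι] {α : ℂ}

theorem measurable_gramResolvent_apply {Z : Type*} [MeasurableSpace Z] {A : Z → Matrix κ ι ℂ}
    (hA : ∀ i j, Measurable fun x => A x i j) (α : ℂ) (i j : ι) :
    Measurable fun x => gramResolvent (A x) α i j := by
  have hgram : Continuous fun M : κ → ι → ℂ => (of M)ᴴ * of M - α • (1 : Matrix ι ι ℂ) := by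
    have hof : Continuous fun M : κ → ι → ℂ => (of M : Matrix κ ι ℂ) := continuous_id
    exact (hof.matrix_conjTranspose.matrix_mul hof).sub continuous_const
  have h : Measurable fun M : κ → ι → ℂ => gramResolvent (of M) α i j := by
    simp only [gramResolvent, inv_def, Ring.inverse_eq_inv', Matrix.smul_apply, smul_eq_mul]
    exact hgram.matrix_det.measurable.inv.mul (hgram.matrix_adjugate.matrix_elem i j).measurable
  exact h.comp (measurable_pi_lambda _ fun i => measurable_pi_lambda _ fun j => hA i j)

theorem memLp_top_gramResolvent_apply {Z : Type*} [MeasurableSpace Z]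
    {P : Measure Z} {A : Z → Matrix κ ι ℂ} (hA : ∀ i j, Measurable fun x => A x i j)
    (hα : 0 < α.im) (i j : ι) : MemLp (fun x => gramResolvent (A x) α i j) ⊤ P :=
  memLp_top_of_bound (measurable_gramResolvent_apply hA α i j).aestronglyMeasurable _
    (Eventually.of_forall fun x => norm_gramResolvent_apply_le (A x) hα i j)

theorem gramResolvent_submatrix {κ' ι' : Type*} [Fintype κ'] [Fintype ι'] [DecidableEq ι']
    (A : Matrix κ ι ℂ) (s : κ' ≃ κ) (t : ι' ≃ ι) :
    gramResolvent (A.submatrix s t) α = (gramResolvent A α).submatrix t t := by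
  rw [gramResolvent, gramResolvent, ← inv_submatrix_equiv, conjTranspose_submatrix,
    submatrix_mul_equiv]
  congr 1
  ext i j
  simp [Matrix.one_apply]

end ResolventMap

section ComplexBoundedDifferences

variable {κ β : Type*} [Fintype κ] [Fintype β] {E : κ → Type*} [∀ k, MeasurableSpace (E k)]
  {μ : ∀ k, Measure (E k)} [∀ k, IsProbabilityMeasure (μ k)] {f : (∀ k, E k) → ℂ} {c : ℝ}

theorem hasSubgaussianMGF_clm_of_boundedDifferences {L : ℂ →L[ℝ] ℝ} (hL : ∀ w, |L w| ≤ ‖w‖)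
    (hf : Measurable f) (row : κ → β)
    (hc : ∀ b x x', (∀ i, row i ≠ b → x i = x' i) → ‖f x - f x'‖ ≤ c) {V : NNReal}
    (hV : Fintype.card β * c ^ 2 ≤ V) :
    HasSubgaussianMGF (fun x => L (f x - ∫ y, f y ∂Measure.pi μ)) V (Measure.pi μ) := by
  obtain ⟨B, hB⟩ := exists_forall_norm_le_of_boundedDifferences row hc
  have h := hasSubgaussianMGF_of_boundedDifferences μ (L.measurable.comp hf) row
    (fun b x x' hx => by
      simpa only [Function.comp_apply, map_sub] using (hL (f x - f x')).trans (hc b x x' hx)) hV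
  simpa only [Function.comp_apply, map_sub,
    L.integral_comp_comm (integrable_of_forall_norm_le hf hB)] using h

theorem hasSubgaussianMGF_re_of_boundedDifferences (hf : Measurable f) (row : κ → β)
    (hc : ∀ b x x', (∀ i, row i ≠ b → x i = x' i) → ‖f x - f x'‖ ≤ c) {V : NNReal}
    (hV : Fintype.card β * c ^ 2 ≤ V) :
    HasSubgaussianMGF (fun x => (f x - ∫ y, f y ∂Measure.pi μ).re) V (Measure.pi μ) :=
  hasSubgaussianMGF_clm_of_boundedDifferences (L := Complex.reCLM) Complex.abs_re_le_norm hf row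
    hc hV

theorem hasSubgaussianMGF_im_of_boundedDifferences (hf : Measurable f) (row : κ → β)
    (hc : ∀ b x x', (∀ i, row i ≠ b → x i = x' i) → ‖f x - f x'‖ ≤ c) {V : NNReal}
    (hV : Fintype.card β * c ^ 2 ≤ V) :
    HasSubgaussianMGF (fun x => (f x - ∫ y, f y ∂Measure.pi μ).im) V (Measure.pi μ) :=
  hasSubgaussianMGF_clm_of_boundedDifferences (L := Complex.imCLM) Complex.abs_im_le_norm hf row
    hc hV

theorem integral_norm_sub_le_of_boundedDifferences (hf : Measurable f) (row : κ → β)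
    (hc : ∀ b x x', (∀ i, row i ≠ b → x i = x' i) → ‖f x - f x'‖ ≤ c) {s : ℝ} (hs : 0 < s)
    (hcs : Fintype.card β * c ^ 2 ≤ s ^ 2) :
    ∫ x, ‖f x - ∫ y, f y ∂Measure.pi μ‖ ∂Measure.pi μ ≤ 8 * s := by
  have hV : Fintype.card β * c ^ 2 ≤ (⟨s ^ 2, sq_nonneg s⟩ : NNReal) := hcs
  have hre := hasSubgaussianMGF_re_of_boundedDifferences (μ := μ) hf row hc hV
  have him := hasSubgaussianMGF_im_of_boundedDifferences (μ := μ) hf row hc hV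
  calc ∫ x, ‖f x - ∫ y, f y ∂Measure.pi μ‖ ∂Measure.pi μ
      ≤ ∫ x, (|(f x - ∫ y, f y ∂Measure.pi μ).re| + |(f x - ∫ y, f y ∂Measure.pi μ).im|)
          ∂Measure.pi μ :=
        integral_mono_of_nonneg (Eventually.of_forall fun _ => norm_nonneg _)
          (hre.integrable.abs.add him.integrable.abs)
          (Eventually.of_forall fun _ => Complex.norm_le_abs_re_add_abs_im _)
    _ = (∫ x, |(f x - ∫ y, f y ∂Measure.pi μ).re| ∂Measure.pi μ)
          + ∫ x, |(f x - ∫ y, f y ∂Measure.pi μ).im| ∂Measure.pi μ :=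
        integral_add hre.integrable.abs him.integrable.abs
    _ ≤ 4 * s + 4 * s := add_le_add (integral_abs_le_of_hasSubgaussianMGF hre hs le_rfl)
        (integral_abs_le_of_hasSubgaussianMGF him hs le_rfl)
    _ = 8 * s := by ring

theorem measure_abs_ge_le_of_hasSubgaussianMGF {Z : Type*} [MeasurableSpace Z] {P : Measure Z}
    [IsFiniteMeasure P] {X : Z → ℝ} {V : NNReal} (hX : HasSubgaussianMGF X V P) {ε : ℝ}
    (hε : 0 ≤ ε) : P.real {x | ε ≤ |X x|} ≤ 2 * Real.exp (-ε ^ 2 / (2 * V)) := by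
  have hsub : {x | ε ≤ |X x|} ⊆ {x | ε ≤ X x} ∪ {x | ε ≤ (-X) x} :=
    fun x (hx : ε ≤ |X x|) => le_abs.mp hx
  calc P.real {x | ε ≤ |X x|} ≤ P.real {x | ε ≤ X x} + P.real {x | ε ≤ (-X) x} :=
        (measureReal_mono hsub).trans (measureReal_union_le _ _)
    _ ≤ Real.exp (-ε ^ 2 / (2 * V)) + Real.exp (-ε ^ 2 / (2 * V)) :=
        add_le_add (hX.measure_ge_le hε) (hX.neg.measure_ge_le hε)
    _ = 2 * Real.exp (-ε ^ 2 / (2 * V)) := by ring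

theorem measure_two_mul_lt_norm_sub_le_of_boundedDifferences (hf : Measurable f) (row : κ → β)
    (hc : ∀ b x x', (∀ i, row i ≠ b → x i = x' i) → ‖f x - f x'‖ ≤ c) {ε : ℝ} (hε : 0 ≤ ε)
    {V : NNReal} (hV : Fintype.card β * c ^ 2 ≤ V) :
    (Measure.pi μ).real {x | 2 * ε < ‖f x - ∫ y, f y ∂Measure.pi μ‖}
      ≤ 4 * Real.exp (-ε ^ 2 / (2 * V)) := by
  have hsub : {x | 2 * ε < ‖f x - ∫ y, f y ∂Measure.pi μ‖} ⊆
      {x | ε ≤ |(f x - ∫ y, f y ∂Measure.pi μ).re|}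
        ∪ {x | ε ≤ |(f x - ∫ y, f y ∂Measure.pi μ).im|} := by
    refine fun x (hx : 2 * ε < _) => or_iff_not_imp_left.mpr fun hre => ?_
    have hre : |(f x - ∫ y, f y ∂Measure.pi μ).re| < ε := not_le.mp hre
    change ε ≤ |(f x - ∫ y, f y ∂Measure.pi μ).im|
    linarith [Complex.norm_le_abs_re_add_abs_im (f x - ∫ y, f y ∂Measure.pi μ)]
  have hre := measure_abs_ge_le_of_hasSubgaussianMGF
    (hasSubgaussianMGF_re_of_boundedDifferences (μ := μ) hf row hc hV) hε
  have him := measure_abs_ge_le_of_hasSubgaussianMGF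
    (hasSubgaussianMGF_im_of_boundedDifferences (μ := μ) hf row hc hV) hε
  linarith [(measureReal_mono (μ := Measure.pi μ) hsub).trans (measureReal_union_le _ _)]

end ComplexBoundedDifferences

/-- The block cyclic matrix with the array of entries `c`, shifted by `z`. -/
def shiftedCyclic {m n : ℕ} (c : Fin m × Fin n × Fin n → ℂ) (z : ℂ) :
    Matrix (Fin m × Fin n) (Fin m × Fin n) ℂ :=
  blockCyclic (fun k => of fun i j => c (k, i, j)) - z • (1 : Matrix _ _ ℂ)

/-- The Stieltjes transform of the block cyclic matrix shifted by `z`, as a function of its array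
of entries. -/
noncomputable def cyclicTransform {m n : ℕ} (c : Fin m × Fin n × Fin n → ℂ) (α z : ℂ) : ℂ :=
  ((m * n : ℕ) : ℂ)⁻¹ * (gramResolvent (shiftedCyclic c z) α).trace

/-- The law of an array of independent variables of law `μ`, indexed by the entries of the blocks.
-/
noncomputable abbrev entryMeasure (m n : ℕ) {E : Type*} [MeasurableSpace E] (μ : Measure E) :
    Measure (Fin m × Fin n × Fin n → E) :=
  Measure.pi fun _ => μ

/-- The expected Stieltjes transform when the entries are independent copies of `φ`. -/
noncomputable def meanTransform (m n : ℕ) {E : Type*} [MeasurableSpace E] (μ : Measure E)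
    (φ : E → ℂ) (α z : ℂ) : ℂ :=
  ∫ x, cyclicTransform (φ ∘ x) α z ∂entryMeasure m n μ

/-- The normalized trace of the diagonal block `a`. -/
noncomputable def blockMean {m n : ℕ} (a : Fin m)
    (R : Matrix (Fin m × Fin n) (Fin m × Fin n) ℂ) : ℂ :=
  (n : ℂ)⁻¹ * ∑ i, R (a, i) (a, i)

/-- The row of the block cyclic matrix to which an entry belongs. -/
def entryRow {m n : ℕ} (k : Fin m × Fin n × Fin n) : Fin m × Fin n := (k.1, k.2.1)

/-- The cyclic rotation of the blocks, for objects of type `ν` within each block. -/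
def blockRotate (m : ℕ) (ν : Type*) : Fin m × ν ≃ Fin m × ν :=
  (finRotate m).prodCongr (Equiv.refl ν)

section CyclicMatrix

variable {m n : ℕ} {E : Type*} {φ : E → ℂ} {z α : ℂ}

theorem shiftedCyclic_apply (c : Fin m × Fin n × Fin n → ℂ) (z : ℂ) (p q : Fin m × Fin n) :
    shiftedCyclic c z p q = (if q.1 = finRotate m p.1 then c (p.1, p.2, q.2) else 0)
      - (if p = q then z else 0) := by
  simp [shiftedCyclic, blockCyclic, Matrix.one_apply]

theorem finRotate_ne_self (hm : 1 < m) (a : Fin m) : finRotate m a ≠ a :=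
  Equiv.Perm.mem_support.mp (support_finRotate_of_le hm ▸ Finset.mem_univ a)

theorem apply_eq_apply_of_apply_finRotate {G : Type*} {h : Fin m → G}
    (hh : ∀ a, h (finRotate m a) = h a) (a b : Fin m) : h a = h b := by
  cases m with
  | zero => exact a.elim0
  | succ k =>
    have h0 : ∀ i : Fin (k + 1), h i = h 0 := fun i => by
      induction i using Fin.induction with
      | zero => rfl
      | succ i ih => rw [← ih, ← hh i.castSucc, finRotate_apply, Fin.coeSucc_eq_succ]
    rw [h0 a, h0 b]

theorem shiftedCyclic_comp_blockRotate_symm (c : Fin m × Fin n × Fin n → ℂ) (z : ℂ) :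
    (shiftedCyclic (c ∘ (blockRotate m _).symm) z).submatrix (blockRotate m _) (blockRotate m _)
      = shiftedCyclic c z := by
  ext ⟨a, i⟩ ⟨a', j⟩
  have h : (blockRotate m _).symm (finRotate m a, i, j) = (a, i, j) :=
    (blockRotate m _).symm_apply_apply (a, i, j)
  rw [submatrix_apply, shiftedCyclic_apply, shiftedCyclic_apply]
  simp only [blockRotate, Equiv.prodCongr_apply, Prod.map_apply, Equiv.coe_refl, id_eq,
    EmbeddingLike.apply_eq_iff_eq, Function.comp_apply, Prod.mk.injEq] at h ⊢
  rw [h]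

theorem updateRow_shiftedCyclic_congr {p : Fin m × Fin n} {x x' : Fin m × Fin n × Fin n → E}
    (h : ∀ k, entryRow k ≠ p → x k = x' k) :
    (shiftedCyclic (φ ∘ x) z).updateRow p 0 = (shiftedCyclic (φ ∘ x') z).updateRow p 0 := by
  ext r s
  by_cases hr : r = p
  · simp [hr]
  · simp only [updateRow_ne hr, shiftedCyclic_apply, Function.comp_apply, h (r.1, r.2, s.2) hr]

theorem norm_sum_mul_sub_le_add {ι : Type*} [Fintype ι] {d u v w : ι → ℂ} {C D : ℝ}
    (hu : ‖∑ i, d i * (w i - u i)‖ ≤ C) (hv : ‖∑ i, d i * (w i - v i)‖ ≤ D) :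
    ‖∑ i, d i * (u i - v i)‖ ≤ C + D := by
  have hsplit : ∑ i, d i * (u i - v i)
      = ∑ i, d i * (w i - v i) - ∑ i, d i * (w i - u i) := by
    rw [← Finset.sum_sub_distrib]
    exact Finset.sum_congr rfl fun i _ => by ring
  rw [hsplit, add_comm C D]
  exact (norm_sub_le _ _).trans (add_le_add hv hu)

theorem norm_sum_mul_gramResolvent_shiftedCyclic_sub_le (hα : 0 < α.im) {p : Fin m × Fin n}
    {x x' : Fin m × Fin n × Fin n → E} (h : ∀ k, entryRow k ≠ p → x k = x' k)
    {d : Fin m × Fin n → ℂ} (hd : ∀ i, ‖d i‖ ≤ 1) :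
    ‖∑ q, d q * (gramResolvent (shiftedCyclic (φ ∘ x) z) α q q
      - gramResolvent (shiftedCyclic (φ ∘ x') z) α q q)‖ ≤ 2 / α.im := by
  have hx := norm_sum_mul_gramResolvent_updateRow_sub_le (shiftedCyclic (φ ∘ x) z) hα p hd
  have hx' := norm_sum_mul_gramResolvent_updateRow_sub_le (shiftedCyclic (φ ∘ x') z) hα p hd
  rw [← updateRow_shiftedCyclic_congr h] at hx'
  exact (norm_sum_mul_sub_le_add hx hx').trans_eq (by ring)

theorem norm_sum_mul_gramResolvent_conjTranspose_shiftedCyclic_sub_le (hα : 0 < α.im)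
    {p : Fin m × Fin n} {x x' : Fin m × Fin n × Fin n → E}
    (h : ∀ k, entryRow k ≠ p → x k = x' k) {d : Fin m × Fin n → ℂ} (hd : ∀ i, ‖d i‖ ≤ 1) :
    ‖∑ q, d q * (gramResolvent (shiftedCyclic (φ ∘ x) z)ᴴ α q q
      - gramResolvent (shiftedCyclic (φ ∘ x') z)ᴴ α q q)‖ ≤ 6 / α.im := by
  have hx := norm_sum_mul_gramResolvent_conjTranspose_updateRow_sub_le (shiftedCyclic (φ ∘ x) z)
    hα p hd
  have hx' := norm_sum_mul_gramResolvent_conjTranspose_updateRow_sub_le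
    (shiftedCyclic (φ ∘ x') z) hα p hd
  rw [← updateRow_shiftedCyclic_congr h] at hx'
  exact (norm_sum_mul_sub_le_add hx hx').trans_eq (by ring)

end CyclicMatrix

section BlockMean

variable {m n : ℕ} (a : Fin m)

theorem sum_blockMean (R : Matrix (Fin m × Fin n) (Fin m × Fin n) ℂ) :
    ∑ a, blockMean a R = (n : ℂ)⁻¹ * R.trace := by
  simp only [blockMean, ← Finset.mul_sum, trace, diag_apply, Fintype.sum_prod_type]

theorem blockMean_sub_eq (R R' : Matrix (Fin m × Fin n) (Fin m × Fin n) ℂ) :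
    blockMean a R - blockMean a R' =
      (n : ℂ)⁻¹ * ∑ p, (if p.1 = a then 1 else 0) * (R p p - R' p p) := by
  rw [blockMean, blockMean, ← mul_sub, ← Finset.sum_sub_distrib, Fintype.sum_prod_type,
    Finset.sum_eq_single a (fun b _ hb => by simp [hb]) (by simp)]
  simp

theorem norm_blockMean_sub_le {R R' : Matrix (Fin m × Fin n) (Fin m × Fin n) ℂ} {C : ℝ}
    (h : ∀ d : Fin m × Fin n → ℂ, (∀ i, ‖d i‖ ≤ 1) → ‖∑ p, d p * (R p p - R' p p)‖ ≤ C) :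
    ‖blockMean a R - blockMean a R'‖ ≤ C / n := by
  rw [blockMean_sub_eq, norm_mul, norm_inv, Complex.norm_natCast, inv_mul_eq_div]
  gcongr
  refine h _ fun p => ?_
  split_ifs <;> simp

theorem blockMean_submatrix_blockRotate (R : Matrix (Fin m × Fin n) (Fin m × Fin n) ℂ) :
    blockMean a (R.submatrix (blockRotate m _) (blockRotate m _))
      = blockMean (finRotate m a) R := by
  simp [blockMean, blockRotate]

theorem memLp_top_blockMean {Z : Type*} [MeasurableSpace Z] {P : Measure Z}
    {R : Z → Matrix (Fin m × Fin n) (Fin m × Fin n) ℂ}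
    (hR : ∀ p q, MemLp (fun x => R x p q) ⊤ P) : MemLp (fun x => blockMean a (R x)) ⊤ P :=
  (memLp_finsetSum _ fun i _ => hR (a, i) (a, i)).const_mul _

theorem measurable_blockMean {Z : Type*} [MeasurableSpace Z]
    {R : Z → Matrix (Fin m × Fin n) (Fin m × Fin n) ℂ}
    (hR : ∀ p q, Measurable fun x => R x p q) : Measurable fun x => blockMean a (R x) :=
  (Finset.measurable_sum _ fun i _ => hR (a, i) (a, i)).const_mul _

end BlockMean

section MeanTransform

variable {m n : ℕ} {E : Type*} [MeasurableSpace E] {φ : E → ℂ} {z α : ℂ}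

theorem measurable_shiftedCyclic (hφ : Measurable φ) (z : ℂ) (p q : Fin m × Fin n) :
    Measurable fun x : Fin m × Fin n × Fin n → E => shiftedCyclic (φ ∘ x) z p q := by
  simp only [shiftedCyclic_apply, Function.comp_apply]
  refine Measurable.sub_const ?_ _
  split_ifs
  · exact hφ.comp (measurable_pi_apply _)
  · exact measurable_const

theorem measurable_conjTranspose_shiftedCyclic (hφ : Measurable φ) (z : ℂ)
    (p q : Fin m × Fin n) :
    Measurable fun x : Fin m × Fin n × Fin n → E => (shiftedCyclic (φ ∘ x) z)ᴴ p q :=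
  continuous_star.measurable.comp (measurable_shiftedCyclic hφ z q p)

theorem measurable_cyclicTransform (hφ : Measurable φ) (α z : ℂ) :
    Measurable fun x : Fin m × Fin n × Fin n → E => cyclicTransform (φ ∘ x) α z :=
  (Finset.measurable_sum _ fun p _ => measurable_gramResolvent_apply
    (measurable_shiftedCyclic hφ z) α p p).const_mul _

theorem norm_cyclicTransform_le (c : Fin m × Fin n × Fin n → ℂ) (z : ℂ) (hα : 0 < α.im) :
    ‖cyclicTransform c α z‖ ≤ 1 / α.im := by
  rw [cyclicTransform, norm_mul, norm_inv, Complex.norm_natCast]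
  have htrace : ‖(gramResolvent (shiftedCyclic c z) α).trace‖ ≤ (m * n : ℕ) * (1 / α.im) :=
    (norm_sum_le_of_le _ fun p _ => norm_gramResolvent_apply_le _ hα p p).trans_eq (by simp)
  exact inv_mul_le_of_le_mul₀ (Nat.cast_nonneg _) (one_div_pos.mpr hα).le htrace

variable {μ : Measure E} [IsProbabilityMeasure μ]

theorem integrable_cyclicTransform (hφ : Measurable φ) (hα : 0 < α.im) (z : ℂ) :
    Integrable (fun x => cyclicTransform (φ ∘ x) α z) (entryMeasure m n μ) :=
  integrable_of_forall_norm_le (measurable_cyclicTransform hφ α z) fun _ =>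
    norm_cyclicTransform_le _ z hα

theorem measurePreserving_comp_symm {κ : Type*} [Fintype κ] (e : κ ≃ κ) :
    MeasurePreserving (fun x : κ → E => x ∘ e.symm) (Measure.pi fun _ => μ)
      (Measure.pi fun _ => μ) := by
  convert measurePreserving_piCongrLeft (fun _ : κ => μ) e using 1
  ext x k
  obtain ⟨k, rfl⟩ := e.surjective k
  rw [Function.comp_apply, Equiv.symm_apply_apply]
  exact (Equiv.piCongrLeft_apply_apply (fun _ => E) e x k).symm

theorem integral_blockMean_finRotate {A : (Fin m × Fin n × Fin n → E) →
    Matrix (Fin m × Fin n) (Fin m × Fin n) ℂ} (hA : ∀ p q, Measurable fun x => A x p q)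
    (hrot : ∀ x, (A (x ∘ (blockRotate m _).symm)).submatrix (blockRotate m _) (blockRotate m _)
      = A x) (a : Fin m) :
    ∫ x, blockMean (finRotate m a) (gramResolvent (A x) α) ∂entryMeasure m n μ
      = ∫ x, blockMean a (gramResolvent (A x) α) ∂entryMeasure m n μ := by
  have h : MeasurePreserving _ (entryMeasure m n μ) (entryMeasure m n μ) :=
    measurePreserving_comp_symm (blockRotate m (Fin n × Fin n))
  conv_lhs => rw [← h.map_eq]
  rw [integral_map h.measurable.aemeasurable (measurable_blockMean _
    (measurable_gramResolvent_apply hA α)).aestronglyMeasurable]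
  refine integral_congr_ae (Eventually.of_forall fun x => ?_)
  beta_reduce
  rw [← blockMean_submatrix_blockRotate, ← gramResolvent_submatrix _ (blockRotate m _), hrot]

theorem integral_blockMean_gramResolvent {A : (Fin m × Fin n × Fin n → E) →
    Matrix (Fin m × Fin n) (Fin m × Fin n) ℂ} (hA : ∀ p q, Measurable fun x => A x p q)
    (hrot : ∀ x, (A (x ∘ (blockRotate m _).symm)).submatrix (blockRotate m _) (blockRotate m _)
      = A x) (hα : 0 < α.im) (a : Fin m) :
    ∫ x, blockMean a (gramResolvent (A x) α) ∂entryMeasure m n μ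
      = ∫ x, ((m * n : ℕ) : ℂ)⁻¹ * (gramResolvent (A x) α).trace ∂entryMeasure m n μ := by
  have hm : (m : ℂ) ≠ 0 := Nat.cast_ne_zero.mpr a.pos.ne'
  have htrace : ∀ x, ((m * n : ℕ) : ℂ)⁻¹ * (gramResolvent (A x) α).trace
      = (m : ℂ)⁻¹ * ∑ c, blockMean c (gramResolvent (A x) α) := fun x => by
    rw [sum_blockMean, Nat.cast_mul, mul_inv, mul_assoc]
  have hconst : ∀ c, ∫ x, blockMean c (gramResolvent (A x) α) ∂entryMeasure m n μ
      = ∫ x, blockMean a (gramResolvent (A x) α) ∂entryMeasure m n μ := fun c =>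
    apply_eq_apply_of_apply_finRotate
      (h := fun c => ∫ x, blockMean c (gramResolvent (A x) α) ∂entryMeasure m n μ)
      (integral_blockMean_finRotate hA hrot) c a
  simp only [htrace]
  rw [integral_const_mul, integral_finsetSum _ fun c _ =>
    (memLp_top_blockMean c (memLp_top_gramResolvent_apply hA hα)).integrable le_top]
  simp [hconst, hm]

theorem integral_blockMean_shiftedCyclic (hφ : Measurable φ) (hα : 0 < α.im) (a : Fin m) :
    ∫ x, blockMean a (gramResolvent (shiftedCyclic (φ ∘ x) z) α) ∂entryMeasure m n μ
      = meanTransform m n μ φ α z :=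
  integral_blockMean_gramResolvent (measurable_shiftedCyclic hφ z)
    (fun x => shiftedCyclic_comp_blockRotate_symm (φ ∘ x) z) hα a

theorem integral_blockMean_conjTranspose_shiftedCyclic (hφ : Measurable φ) (hα : 0 < α.im)
    (a : Fin m) :
    ∫ x, blockMean a (gramResolvent (shiftedCyclic (φ ∘ x) z)ᴴ α) ∂entryMeasure m n μ
      = meanTransform m n μ φ α z := by
  rw [integral_blockMean_gramResolvent (measurable_conjTranspose_shiftedCyclic hφ z) (fun x => by
    rw [← conjTranspose_submatrix]
    exact congrArg conjTranspose (shiftedCyclic_comp_blockRotate_symm (φ ∘ x) z)) hα a]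
  simp only [meanTransform, cyclicTransform, trace_gramResolvent_conjTranspose _ hα]

theorem integral_norm_blockMean_sub_integral_le {A : (Fin m × Fin n × Fin n → E) →
    Matrix (Fin m × Fin n) (Fin m × Fin n) ℂ} (hn : 0 < n)
    (hA : ∀ p q, Measurable fun x => A x p q) {C : ℝ} (hC : 0 < C)
    (hdiff : ∀ p x x', (∀ k, entryRow k ≠ p → x k = x' k) →
      ∀ d : Fin m × Fin n → ℂ, (∀ i, ‖d i‖ ≤ 1) →
      ‖∑ q, d q * (gramResolvent (A x) α q q - gramResolvent (A x') α q q)‖ ≤ C) (a : Fin m) :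
    ∫ x, ‖blockMean a (gramResolvent (A x) α)
        - ∫ y, blockMean a (gramResolvent (A y) α) ∂entryMeasure m n μ‖ ∂entryMeasure m n μ
      ≤ 8 * (C * √(m / n)) := by
  have hm : (0 : ℝ) < m := Nat.cast_pos.mpr a.pos
  have hn : (0 : ℝ) < n := Nat.cast_pos.mpr hn
  refine integral_norm_sub_le_of_boundedDifferences
    (measurable_blockMean a (measurable_gramResolvent_apply hA α)) entryRow
    (fun p x x' h => norm_blockMean_sub_le a (hdiff p x x' h))
    (mul_pos hC (Real.sqrt_pos.mpr (div_pos hm hn))) (le_of_eq ?_)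
  rw [mul_pow, Real.sq_sqrt (div_pos hm hn).le]
  simp only [Fintype.card_prod, Fintype.card_fin, Nat.cast_mul]
  field_simp

end MeanTransform

/-- The vector with coordinates `w` in the block `c` and `0` in the other blocks. -/
def blockVec {m n : ℕ} (c : Fin m) (w : Fin n → ℂ) : Fin m × Fin n → ℂ :=
  fun q => if q.1 = c then w q.2 else 0

section BlockVec

variable {m n : ℕ}

theorem blockVec_dotProduct (c : Fin m) (w : Fin n → ℂ) (f : Fin m × Fin n → ℂ) :
    blockVec c w ⬝ᵥ f = ∑ j, w j * f (c, j) := by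
  simp only [dotProduct, blockVec]
  rw [Fintype.sum_prod_type, Finset.sum_eq_single c (fun b _ hb => by simp [hb]) (by simp)]
  simp

theorem star_blockVec (c : Fin m) (w : Fin n → ℂ) :
    star (blockVec c w) = blockVec c fun j => star (w j) := by
  ext q
  simp only [blockVec, Pi.star_apply, apply_ite star, star_zero]

theorem mulVec_blockVec_apply (R : Matrix (Fin m × Fin n) (Fin m × Fin n) ℂ) (c : Fin m)
    (w : Fin n → ℂ) (q : Fin m × Fin n) :
    (R *ᵥ blockVec c w) q = ∑ j, R q (c, j) * w j := by
  rw [mulVec, dotProduct_comm, blockVec_dotProduct]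
  exact Finset.sum_congr rfl fun j _ => mul_comm _ _

theorem blockVec_vecMul_apply (R : Matrix (Fin m × Fin n) (Fin m × Fin n) ℂ) (c : Fin m)
    (w : Fin n → ℂ) (q : Fin m × Fin n) :
    (blockVec c w ᵥ* R) q = ∑ j, R (c, j) q * w j := by
  rw [vecMul, blockVec_dotProduct]
  exact Finset.sum_congr rfl fun j _ => mul_comm _ _

theorem blockVec_dotProduct_mulVec_star (R : Matrix (Fin m × Fin n) (Fin m × Fin n) ℂ)
    (c : Fin m) (w : Fin n → ℂ) :
    blockVec c w ⬝ᵥ (R *ᵥ star (blockVec c w)) =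
      centredForm (n : ℝ)⁻¹ (fun j k => R (c, j) (c, k)) Finset.univ w + blockMean c R := by
  simp only [star_blockVec, blockVec_dotProduct, mulVec_blockVec_apply, centredForm, blockMean,
    Finset.mul_sum, mul_assoc, Complex.ofReal_inv, Complex.ofReal_natCast, sub_add_cancel]

theorem sub_single_dotProduct_mulVec_star {ι : Type*} [Fintype ι] [DecidableEq ι]
    (R : Matrix ι ι ℂ) (y : ι → ℂ) (p : ι) (z : ℂ) :
    (y - Pi.single p z) ⬝ᵥ (R *ᵥ star (y - Pi.single p z)) =
      y ⬝ᵥ (R *ᵥ star y) - z * (R *ᵥ star y) p - star z * (y ᵥ* R) p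
        + (‖z‖ : ℂ) ^ 2 * R p p := by
  rw [star_sub, ← Pi.single_star, mulVec_sub, dotProduct_sub, sub_dotProduct, sub_dotProduct,
    single_dotProduct, single_dotProduct, dotProduct_mulVec y R (Pi.single p _), dotProduct_single,
    mulVec_single, ← Complex.mul_conj']
  simp
  ring

theorem shiftedCyclic_eq_blockVec_sub_single (c : Fin m × Fin n × Fin n → ℂ) (z : ℂ)
    (p : Fin m × Fin n) :
    shiftedCyclic c z p
      = blockVec (finRotate m p.1) (fun j => c (p.1, p.2, j)) - Pi.single p z := by
  ext q
  rw [shiftedCyclic_apply, Pi.sub_apply, Pi.single_apply, blockVec]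
  simp only [eq_comm]

theorem conjTranspose_updateRow_shiftedCyclic_eq_blockVec (hm : 1 < m)
    (c : Fin m × Fin n × Fin n → ℂ) (z : ℂ) (p : Fin m × Fin n) :
    ((shiftedCyclic c z).updateRow p 0)ᴴ p = blockVec ((finRotate m).symm p.1)
      fun j => star (c ((finRotate m).symm p.1, j, p.2)) := by
  ext q
  rw [conjTranspose_apply, blockVec]
  by_cases hq : q = p
  · have hne : p.1 ≠ (finRotate m).symm p.1 := fun h =>
      finRotate_ne_self hm p.1 (Equiv.eq_symm_apply _ |>.mp h)
    rw [hq, updateRow_self, Pi.zero_apply, star_zero, if_neg hne]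
  · rw [updateRow_ne hq, shiftedCyclic_apply, if_neg hq, sub_zero, apply_ite star, star_zero]
    by_cases hblock : q.1 = (finRotate m).symm p.1
    · rw [if_pos ((Equiv.eq_symm_apply _).mp hblock).symm, if_pos hblock, hblock]
    · rw [if_neg fun h => hblock ((Equiv.eq_symm_apply _).mpr h.symm), if_neg hblock]

theorem updateRow_conjTranspose_updateRow_shiftedCyclic_congr {E : Type*} {φ : E → ℂ} {z : ℂ}
    {p : Fin m × Fin n} {x x' : Fin m × Fin n × Fin n → E}
    (h : ∀ k, (finRotate m k.1, k.2.2) ≠ p → x k = x' k) :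
    ((shiftedCyclic (φ ∘ x) z).updateRow p 0)ᴴ.updateRow p 0
      = ((shiftedCyclic (φ ∘ x') z).updateRow p 0)ᴴ.updateRow p 0 := by
  ext r s
  by_cases hr : r = p
  · simp [hr]
  by_cases hs : s = p
  · simp [updateRow_ne hr, hs]
  simp only [updateRow_ne hr, conjTranspose_apply, updateRow_ne hs, shiftedCyclic_apply,
    Function.comp_apply]
  by_cases hrs : r.1 = finRotate m s.1
  · rw [h (s.1, s.2, r.2) fun h' => hr (by rw [← h', ← hrs])]
  · rw [if_neg hrs, if_neg hrs]

end BlockVec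

section L1Norm

variable {Z : Type*} [MeasurableSpace Z] {P : Measure Z} {F G : Z → ℂ} {C D : ℝ}

theorem integral_norm_add_le_add [IsFiniteMeasure P] (hF : MemLp F ⊤ P) (hG : MemLp G ⊤ P)
    (hC : ∫ x, ‖F x‖ ∂P ≤ C) (hD : ∫ x, ‖G x‖ ∂P ≤ D) : ∫ x, ‖F x + G x‖ ∂P ≤ C + D := by
  have hFi := (hF.integrable le_top).norm
  have hGi := (hG.integrable le_top).norm
  calc ∫ x, ‖F x + G x‖ ∂P ≤ ∫ x, (‖F x‖ + ‖G x‖) ∂P :=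
        integral_mono ((hF.add hG).integrable le_top).norm (hFi.add hGi) fun x => norm_add_le _ _
    _ = ∫ x, ‖F x‖ ∂P + ∫ x, ‖G x‖ ∂P := integral_add hFi hGi
    _ ≤ C + D := add_le_add hC hD

theorem integral_norm_const_mul_le (c : ℂ) (hC : ∫ x, ‖F x‖ ∂P ≤ C) :
    ∫ x, ‖c * F x‖ ∂P ≤ ‖c‖ * C := by
  simp only [norm_mul, integral_const_mul]
  exact mul_le_mul_of_nonneg_left hC (norm_nonneg c)

theorem memLp_top_dotProduct_mulVec {ι : Type*} [Fintype ι] {R : Z → Matrix ι ι ℂ}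
    {u w : Z → ι → ℂ} (hu : ∀ i, MemLp (fun x => u x i) ⊤ P)
    (hR : ∀ i j, MemLp (fun x => R x i j) ⊤ P) (hw : ∀ i, MemLp (fun x => w x i) ⊤ P) :
    MemLp (fun x => u x ⬝ᵥ (R x *ᵥ w x)) ⊤ P :=
  memLp_finsetSum _ fun i _ => memLp_top_mul (hu i) <|
    memLp_finsetSum _ fun j _ => memLp_top_mul (hR i j) (hw j)

theorem memLp_top_const_mul_mulVec {ι : Type*} [Fintype ι] {R : Z → Matrix ι ι ℂ}
    {w : Z → ι → ℂ} (c : ℂ) {p : ι} (hR : ∀ j, MemLp (fun x => R x p j) ⊤ P)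
    (hw : ∀ i, MemLp (fun x => w x i) ⊤ P) : MemLp (fun x => c * (R x *ᵥ w x) p) ⊤ P :=
  (memLp_finsetSum _ fun j _ => memLp_top_mul (hR j) (hw j)).const_mul c

end L1Norm

section BlockForms

variable {m n : ℕ} {α : ℂ}

theorem sum_block_le_sum {f : Fin m × Fin n → ℝ} (hf : ∀ q, 0 ≤ f q) (c : Fin m) :
    ∑ k, f (c, k) ≤ ∑ q, f q := by
  rw [Fintype.sum_prod_type]
  exact Finset.single_le_sum (f := fun d => ∑ k, f (d, k))
    (fun d _ => Finset.sum_nonneg fun k _ => hf (d, k)) (Finset.mem_univ c)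

theorem sum_norm_sq_gramResolvent_block_row_le (A : Matrix (Fin m × Fin n) (Fin m × Fin n) ℂ)
    (hα : 0 < α.im) (c : Fin m) (q : Fin m × Fin n) :
    ∑ k, ‖gramResolvent A α q (c, k)‖ ^ 2 ≤ (1 / α.im) ^ 2 :=
  (sum_block_le_sum (fun r => sq_nonneg ‖gramResolvent A α q r‖) c).trans
    (sum_norm_sq_gramResolvent_row_le A hα q)

theorem sum_norm_sq_gramResolvent_block_col_le (A : Matrix (Fin m × Fin n) (Fin m × Fin n) ℂ)
    (hα : 0 < α.im) (c : Fin m) (q : Fin m × Fin n) :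
    ∑ k, ‖gramResolvent A α (c, k) q‖ ^ 2 ≤ (1 / α.im) ^ 2 :=
  (sum_block_le_sum (fun r => sq_nonneg ‖gramResolvent A α r q‖) c).trans
    (sum_norm_sq_gramResolvent_col_le A hα q)

variable {κ E : Type*} [Fintype κ] [MeasurableSpace E] {μ : Measure E} [IsProbabilityMeasure μ]
  {φ : E → ℂ} {b : ℝ} {e : Fin n → κ} {A : (κ → E) → Matrix (Fin m × Fin n) (Fin m × Fin n) ℂ}

theorem IsBoundedCentred.inv_le_bound (h : IsBoundedCentred μ φ b (n : ℝ)⁻¹) :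
    (n : ℝ)⁻¹ ≤ b := by
  refine le_of_sq_le_sq ?_ h.bound_nonneg
  exact (pow_le_of_le_one (inv_nonneg.mpr n.cast_nonneg) (Nat.cast_inv_le_one n) two_ne_zero).trans
    h.variance_le_sq

theorem IsBoundedCentred.memLp_top_blockVec (h : IsBoundedCentred μ φ b (n : ℝ)⁻¹) (e : Fin n → κ)
    (c : Fin m) (q : Fin m × Fin n) :
    MemLp (fun x => blockVec c (fun j => φ (x (e j))) q) ⊤ (Measure.pi fun _ => μ) := by
  simp only [blockVec]
  split_ifs
  · exact h.memLp_top_eval (e q.2)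
  · exact memLp_const 0

theorem IsBoundedCentred.integral_norm_blockVec_form_sub_blockMean_le
    (h : IsBoundedCentred μ φ b (n : ℝ)⁻¹) (he : Function.Injective e)
    (hA : ∀ p q, Measurable fun x => A x p q)
    (hAe : ∀ x x', (∀ k, k ∉ Set.range e → x k = x' k) → A x = A x') (hα : 0 < α.im)
    (c : Fin m) :
    ∫ x, ‖blockVec c (fun j => φ (x (e j))) ⬝ᵥ
        (gramResolvent (A x) α *ᵥ star (blockVec c fun j => φ (x (e j))))
        - blockMean c (gramResolvent (A x) α)‖ ∂(Measure.pi fun _ => μ) ≤ 3 * (b / α.im) := by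
  simp only [blockVec_dotProduct_mulVec_star, add_sub_cancel_right]
  refine (h.integral_norm_centredForm_le he (C := n * (1 / α.im) ^ 2)
    (fun j k => memLp_top_gramResolvent_apply hA hα (c, j) (c, k))
    (fun x x' hx => by simp only [hAe x x' hx]) fun x => ?_).trans ?_
  · exact (Finset.sum_le_sum fun j _ => sum_norm_sq_gramResolvent_block_row_le (A x) hα c
      (c, j)).trans_eq (by simp)
  · refine Real.sqrt_le_iff.mpr ⟨by have := h.bound_nonneg; positivity, ?_⟩
    have hv := h.variance_le_sq
    have hnv : (n : ℝ)⁻¹ * n ≤ 1 := inv_mul_le_one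
    calc 3 * (b ^ 2 * (n : ℝ)⁻¹ + (n : ℝ)⁻¹ ^ 2) * (n * (1 / α.im) ^ 2)
        = 3 * (b ^ 2 + (n : ℝ)⁻¹) * ((n : ℝ)⁻¹ * n) * (1 / α.im) ^ 2 := by ring
      _ ≤ 3 * (b ^ 2 + b ^ 2) * 1 * (1 / α.im) ^ 2 := by gcongr
      _ ≤ (3 * (b / α.im)) ^ 2 := by
        rw [show (3 * (b / α.im)) ^ 2 = 9 * b ^ 2 * (1 / α.im) ^ 2 by ring]
        exact mul_le_mul_of_nonneg_right (by linarith [sq_nonneg b]) (sq_nonneg _)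

theorem IsBoundedCentred.integral_norm_sum_mul_le (h : IsBoundedCentred μ φ b (n : ℝ)⁻¹)
    (he : Function.Injective e) {c : (κ → E) → Fin n → ℂ}
    (hm : ∀ i, MemLp (fun x => c x i) ⊤ (Measure.pi fun _ => μ))
    (hc : ∀ x x', (∀ k, k ∉ Set.range e → x k = x' k) → c x = c x') (hα : 0 < α.im)
    (hC : ∀ x, ∑ i, ‖c x i‖ ^ 2 ≤ (1 / α.im) ^ 2) :
    ∫ x, ‖∑ i, c x i * φ (x (e i))‖ ∂(Measure.pi fun _ => μ) ≤ b / α.im := by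
  refine (h.integral_norm_linearForm_le he hm hc hC).trans (Real.sqrt_le_iff.mpr
    ⟨div_nonneg h.bound_nonneg hα.le, ?_⟩)
  rw [← mul_one_div b, mul_pow]
  exact mul_le_mul_of_nonneg_right h.variance_le_sq (sq_nonneg _)

theorem IsBoundedCentred.integral_norm_mulVec_blockVec_le
    (h : IsBoundedCentred μ φ b (n : ℝ)⁻¹) (he : Function.Injective e)
    (hA : ∀ p q, Measurable fun x => A x p q)
    (hAe : ∀ x x', (∀ k, k ∉ Set.range e → x k = x' k) → A x = A x') (hα : 0 < α.im)
    (c : Fin m) (q : Fin m × Fin n) :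
    ∫ x, ‖(gramResolvent (A x) α *ᵥ blockVec c fun j => φ (x (e j))) q‖
      ∂(Measure.pi fun _ => μ) ≤ b / α.im := by
  simp only [mulVec_blockVec_apply]
  exact h.integral_norm_sum_mul_le he (fun j => memLp_top_gramResolvent_apply hA hα q (c, j))
    (fun x x' hx => by simp only [hAe x x' hx]) hα fun x =>
      sum_norm_sq_gramResolvent_block_row_le (A x) hα c q

theorem IsBoundedCentred.integral_norm_blockVec_vecMul_le
    (h : IsBoundedCentred μ φ b (n : ℝ)⁻¹) (he : Function.Injective e)
    (hA : ∀ p q, Measurable fun x => A x p q)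
    (hAe : ∀ x x', (∀ k, k ∉ Set.range e → x k = x' k) → A x = A x') (hα : 0 < α.im)
    (c : Fin m) (q : Fin m × Fin n) :
    ∫ x, ‖((blockVec c fun j => φ (x (e j))) ᵥ* gramResolvent (A x) α) q‖
      ∂(Measure.pi fun _ => μ) ≤ b / α.im := by
  simp only [blockVec_vecMul_apply]
  exact h.integral_norm_sum_mul_le he (fun j => memLp_top_gramResolvent_apply hA hα (c, j) q)
    (fun x x' hx => by simp only [hAe x x' hx]) hα fun x =>
      sum_norm_sq_gramResolvent_block_col_le (A x) hα c q

end BlockForms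

section RowForms

variable {m n : ℕ} {E : Type*} [MeasurableSpace E] {μ : Measure E} [IsProbabilityMeasure μ]
  {φ : E → ℂ} {b : ℝ} {z α : ℂ}

theorem measurable_updateRow_zero {ι κ Z : Type*} [DecidableEq κ] [MeasurableSpace Z]
    {A : Z → Matrix κ ι ℂ} (hA : ∀ i j, Measurable fun x => A x i j) (p i : κ) (j : ι) :
    Measurable fun x => (A x).updateRow p 0 i j := by
  simp only [updateRow_apply]
  split_ifs
  · exact measurable_const
  · exact hA i j

theorem norm_sum_mul_gramResolvent_updateRow_conjTranspose_sub_le {ι : Type*} [Fintype ι]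
    [DecidableEq ι] (A : Matrix ι ι ℂ) (hα : 0 < α.im) (p : ι) {d : ι → ℂ}
    (hd : ∀ i, ‖d i‖ ≤ 1) :
    ‖∑ i, d i * (gramResolvent ((A.updateRow p 0)ᴴ.updateRow p 0) α i i
      - gramResolvent Aᴴ α i i)‖ ≤ 4 / α.im := by
  have hrow := norm_sum_mul_gramResolvent_updateRow_sub_le (A.updateRow p 0)ᴴ hα p hd
  have hcol := norm_sum_mul_gramResolvent_conjTranspose_updateRow_sub_le A hα p hd
  refine le_of_eq_of_le (congrArg norm ?_) ((norm_add_le_of_le hrow hcol).trans_eq (by ring))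
  rw [← Finset.sum_add_distrib]
  exact Finset.sum_congr rfl fun i _ => by ring

theorem IsBoundedCentred.integral_norm_blockMean_sub_le (h : IsBoundedCentred μ φ b (n : ℝ)⁻¹)
    {A A' : (Fin m × Fin n × Fin n → E) → Matrix (Fin m × Fin n) (Fin m × Fin n) ℂ} (hn : 0 < n)
    (hA : ∀ p q, Measurable fun x => A x p q) (hA' : ∀ p q, Measurable fun x => A' x p q)
    (hα : 0 < α.im) {C D : ℝ} (hC : 0 < C)
    (hdiff : ∀ p x x', (∀ k, entryRow k ≠ p → x k = x' k) →
      ∀ d : Fin m × Fin n → ℂ, (∀ i, ‖d i‖ ≤ 1) →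
      ‖∑ q, d q * (gramResolvent (A x) α q q - gramResolvent (A x') α q q)‖ ≤ C)
    (hclose : ∀ x, ∀ d : Fin m × Fin n → ℂ, (∀ i, ‖d i‖ ≤ 1) →
      ‖∑ q, d q * (gramResolvent (A' x) α q q - gramResolvent (A x) α q q)‖ ≤ D) (a : Fin m) :
    ∫ x, ‖blockMean a (gramResolvent (A' x) α)
        - ∫ y, blockMean a (gramResolvent (A y) α) ∂entryMeasure m n μ‖ ∂entryMeasure m n μ
      ≤ (D + 8 * m * C) * b := by
  have hmean := memLp_top_blockMean (P := entryMeasure m n μ) a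
    (memLp_top_gramResolvent_apply hA hα)
  have hmean' := memLp_top_blockMean (P := entryMeasure m n μ) a
    (memLp_top_gramResolvent_apply hA' hα)
  have hD : 0 ≤ D := (norm_nonneg _).trans
    (hclose (fun _ => μ.nonempty_of_neZero.some) (fun _ => 0) fun _ => by simp)
  have hsqrt : √(m / n) ≤ m * b := by
    have hm : (1 : ℝ) ≤ m := Nat.one_le_cast.mpr a.pos
    refine Real.sqrt_le_iff.mpr ⟨mul_nonneg m.cast_nonneg h.bound_nonneg, ?_⟩
    rw [div_eq_mul_inv, mul_pow]
    exact mul_le_mul (le_self_pow₀ hm two_ne_zero) h.variance_le_sq (by positivity) (by positivity)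
  have hpert : ∫ x, ‖blockMean a (gramResolvent (A' x) α) - blockMean a (gramResolvent (A x) α)‖
      ∂entryMeasure m n μ ≤ D * b := by
    refine (integral_mono ((hmean'.sub hmean).integrable le_top).norm (integrable_const (D / n))
      fun x => norm_blockMean_sub_le a (hclose x)).trans ?_
    rw [integral_const, probReal_univ, one_smul, div_eq_mul_inv]
    exact mul_le_mul_of_nonneg_left h.inv_le_bound hD
  have hfluct := integral_norm_blockMean_sub_integral_le (μ := μ) hn hA hC hdiff a
  have hsum := integral_norm_add_le_add (hmean'.sub hmean) (hmean.sub (memLp_const _)) hpert hfluct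
  simp only [Pi.sub_apply, sub_add_sub_cancel] at hsum
  refine hsum.trans ?_
  nlinarith [mul_le_mul_of_nonneg_left hsqrt hC.le]

theorem IsBoundedCentred.memLp_top_shiftedCyclic (h : IsBoundedCentred μ φ b (n : ℝ)⁻¹) (z : ℂ)
    (p q : Fin m × Fin n) :
    MemLp (fun x => shiftedCyclic (φ ∘ x) z p q) ⊤ (entryMeasure m n μ) := by
  simp only [shiftedCyclic_eq_blockVec_sub_single]
  exact (h.memLp_top_blockVec _ _ q).sub (memLp_const _)

theorem IsBoundedCentred.integral_norm_blockVec_form_sub_le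
    (h : IsBoundedCentred μ φ b (n : ℝ)⁻¹) {e : Fin n → Fin m × Fin n × Fin n}
    (he : Function.Injective e)
    {A A' : (Fin m × Fin n × Fin n → E) → Matrix (Fin m × Fin n) (Fin m × Fin n) ℂ} (hn : 0 < n)
    (hA : ∀ p q, Measurable fun x => A x p q) (hA' : ∀ p q, Measurable fun x => A' x p q)
    (hA'e : ∀ x x', (∀ k, k ∉ Set.range e → x k = x' k) → A' x = A' x') (hα : 0 < α.im)
    {C D : ℝ} (hC : 0 < C)
    (hdiff : ∀ p x x', (∀ k, entryRow k ≠ p → x k = x' k) →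
      ∀ d : Fin m × Fin n → ℂ, (∀ i, ‖d i‖ ≤ 1) →
      ‖∑ q, d q * (gramResolvent (A x) α q q - gramResolvent (A x') α q q)‖ ≤ C / α.im)
    (hclose : ∀ x, ∀ d : Fin m × Fin n → ℂ, (∀ i, ‖d i‖ ≤ 1) →
      ‖∑ q, d q * (gramResolvent (A' x) α q q - gramResolvent (A x) α q q)‖ ≤ D / α.im)
    (c : Fin m) :
    ∫ x, ‖blockVec c (fun j => φ (x (e j))) ⬝ᵥ
        (gramResolvent (A' x) α *ᵥ star (blockVec c fun j => φ (x (e j))))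
        - ∫ y, blockMean c (gramResolvent (A y) α) ∂entryMeasure m n μ‖ ∂entryMeasure m n μ
      ≤ (3 + D + 8 * m * C) * (b / α.im) := by
  have hR (q r) : MemLp (fun x => gramResolvent (A' x) α q r) ⊤ (entryMeasure m n μ) :=
    memLp_top_gramResolvent_apply hA' hα q r
  have hy := fun q => h.memLp_top_blockVec e c q
  have hmean := memLp_top_blockMean c hR
  have hsum := integral_norm_add_le_add
    ((memLp_top_dotProduct_mulVec hy hR fun q => (hy q).star).sub hmean)
    (hmean.sub (memLp_const _))
    (h.integral_norm_blockVec_form_sub_blockMean_le he hA' hA'e hα c)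
    (h.integral_norm_blockMean_sub_le hn hA hA' hα (div_pos hC hα) hdiff hclose c)
  simp only [Pi.sub_apply, sub_add_sub_cancel] at hsum
  exact hsum.trans_eq (by ring)

theorem IsBoundedCentred.integral_norm_sub_single_form_sub_le
    (h : IsBoundedCentred μ φ b (n : ℝ)⁻¹) {e : Fin n → Fin m × Fin n × Fin n}
    (he : Function.Injective e)
    {A : (Fin m × Fin n × Fin n → E) → Matrix (Fin m × Fin n) (Fin m × Fin n) ℂ}
    (hA : ∀ p q, Measurable fun x => A x p q)
    (hAe : ∀ x x', (∀ k, k ∉ Set.range e → x k = x' k) → A x = A x') (hα : 0 < α.im)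
    {c : Fin m} {g : ℂ} {C : ℝ}
    (hC : ∫ x, ‖blockVec c (fun j => φ (x (e j))) ⬝ᵥ
        (gramResolvent (A x) α *ᵥ star (blockVec c fun j => φ (x (e j)))) - g‖
        ∂entryMeasure m n μ ≤ C) (p : Fin m × Fin n) (z : ℂ) :
    ∫ x, ‖(blockVec c (fun j => φ (x (e j))) - Pi.single p z) ⬝ᵥ (gramResolvent (A x) α *ᵥ
          star (blockVec c (fun j => φ (x (e j))) - Pi.single p z))
        - (g + (‖z‖ : ℂ) ^ 2 * gramResolvent (A x) α p p)‖ ∂entryMeasure m n μ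
      ≤ C + 2 * ‖z‖ * (b / α.im) := by
  have hR (q r) : MemLp (fun x => gramResolvent (A x) α q r) ⊤ (entryMeasure m n μ) :=
    memLp_top_gramResolvent_apply hA hα q r
  have hy := fun q => h.memLp_top_blockVec e c q
  have hystar (q) : MemLp (fun x => star (blockVec c fun j => φ (x (e j))) q) ⊤
      (entryMeasure m n μ) := (hy q).star
  have hform := (memLp_top_dotProduct_mulVec hy hR hystar).sub (memLp_const g)
  have hrow := memLp_top_const_mul_mulVec (-z) (hR p) hystar
  have hcol := memLp_top_const_mul_mulVec (-star z) (R := fun x => (gramResolvent (A x) α)ᵀ)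
    (fun q => hR q p) hy
  have hrow_le := integral_norm_const_mul_le (-z)
    (h.conj.integral_norm_mulVec_blockVec_le he hA hAe hα c p)
  have hcol_le := integral_norm_const_mul_le (-star z)
    (h.integral_norm_blockVec_vecMul_le he hA hAe hα c p)
  simp only [← star_blockVec] at hrow_le
  simp only [← mulVec_transpose] at hcol_le
  have hsum := integral_norm_add_le_add (hform.add hrow) hcol
    (integral_norm_add_le_add hform hrow hC hrow_le) hcol_le
  rw [norm_neg, norm_neg, norm_star] at hsum
  refine Eq.trans_le ?_ (hsum.trans_eq (by ring))
  refine integral_congr_ae (Eventually.of_forall fun x => congrArg norm ?_)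
  simp only [Pi.add_apply, Pi.sub_apply, sub_single_dotProduct_mulVec_star, mulVec_transpose]
  ring

theorem memLp_top_rowForm {P : Measure (Fin m × Fin n × Fin n → E)}
    {A : (Fin m × Fin n × Fin n → E) →
    Matrix (Fin m × Fin n) (Fin m × Fin n) ℂ} (hA : ∀ p q, Measurable fun x => A x p q)
    (hα : 0 < α.im) {p : Fin m × Fin n}
    (hp : ∀ q, MemLp (fun x => A x p q) ⊤ P) :
    MemLp (fun x => rowForm (A x) α p) ⊤ P :=
  memLp_top_dotProduct_mulVec hp
    (memLp_top_gramResolvent_apply (measurable_updateRow_zero hA p) hα) fun q => (hp q).star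

theorem IsBoundedCentred.integral_norm_rowForm_sub_le (h : IsBoundedCentred μ φ b (n : ℝ)⁻¹)
    (hn : 0 < n) (hα : 0 < α.im) (p : Fin m × Fin n) :
    ∫ x, ‖rowForm (shiftedCyclic (φ ∘ x) z) α p - (meanTransform m n μ φ α z + (‖z‖ : ℂ) ^ 2 *
        gramResolvent ((shiftedCyclic (φ ∘ x) z).updateRow p 0) α p p)‖ ∂entryMeasure m n μ
      ≤ (4 + 16 * m + 2 * ‖z‖) * (b / α.im) := by
  let e : Fin n → Fin m × Fin n × Fin n := fun j => (p.1, p.2, j)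
  have he : Function.Injective e := fun j k hjk => by simpa [e] using hjk
  have hS := measurable_shiftedCyclic (m := m) (n := n) h.measurable z
  have hA := measurable_updateRow_zero hS p
  have hAe : ∀ x x' : Fin m × Fin n × Fin n → E, (∀ k, k ∉ Set.range e → x k = x' k) →
      (shiftedCyclic (φ ∘ x) z).updateRow p 0 = (shiftedCyclic (φ ∘ x') z).updateRow p 0 :=
    fun x x' hx => updateRow_shiftedCyclic_congr fun k hk => hx k fun ⟨j, hj⟩ => hk (hj ▸ rfl)
  have hform := h.integral_norm_blockVec_form_sub_le he hn hS hA hAe hα two_pos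
    (fun p x x' hx d hd => norm_sum_mul_gramResolvent_shiftedCyclic_sub_le hα hx hd)
    (fun x d hd => norm_sum_mul_gramResolvent_updateRow_sub_le _ hα p hd) (finRotate m p.1)
  rw [integral_blockMean_shiftedCyclic h.measurable hα] at hform
  have hrow := h.integral_norm_sub_single_form_sub_le he hA hAe hα hform p z
  refine Eq.trans_le ?_ (hrow.trans_eq (by ring))
  simp only [rowForm, shiftedCyclic_eq_blockVec_sub_single, Function.comp_apply, e]

theorem IsBoundedCentred.integral_norm_rowForm_conjTranspose_sub_le
    (h : IsBoundedCentred μ φ b (n : ℝ)⁻¹) (hm : 1 < m) (hn : 0 < n) (hα : 0 < α.im)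
    (p : Fin m × Fin n) :
    ∫ x, ‖rowForm ((shiftedCyclic (φ ∘ x) z).updateRow p 0)ᴴ α p - meanTransform m n μ φ α z‖
      ∂entryMeasure m n μ ≤ (7 + 48 * m) * (b / α.im) := by
  let e : Fin n → Fin m × Fin n × Fin n := fun j => ((finRotate m).symm p.1, j, p.2)
  have he : Function.Injective e := fun j k hjk => by simpa [e] using hjk
  have hS := measurable_shiftedCyclic (m := m) (n := n) h.measurable z
  have hA : ∀ q r, Measurable fun x : Fin m × Fin n × Fin n → E =>
      ((shiftedCyclic (φ ∘ x) z).updateRow p 0)ᴴ.updateRow p 0 q r :=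
    measurable_updateRow_zero (fun q r => continuous_star.measurable.comp
      (measurable_updateRow_zero hS p r q)) p
  have hform := h.conj.integral_norm_blockVec_form_sub_le he hn
    (measurable_conjTranspose_shiftedCyclic h.measurable z) hA
    (fun x x' hx => updateRow_conjTranspose_updateRow_shiftedCyclic_congr fun k hk =>
      hx k fun ⟨j, hj⟩ => hk (hj ▸ Prod.ext ((finRotate m).apply_symm_apply p.1) rfl))
    hα (C := 6) (D := 4) (by norm_num)
    (fun p x x' hx d hd => norm_sum_mul_gramResolvent_conjTranspose_shiftedCyclic_sub_le hα hx hd)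
    (fun x d hd => norm_sum_mul_gramResolvent_updateRow_conjTranspose_sub_le _ hα p hd)
    ((finRotate m).symm p.1)
  rw [integral_blockMean_conjTranspose_shiftedCyclic h.measurable hα] at hform
  refine Eq.trans_le ?_ (hform.trans_eq (by ring))
  simp only [rowForm, conjTranspose_updateRow_shiftedCyclic_eq_blockVec hm, Function.comp_apply, e]

end RowForms

/-- The cubic polynomial in `g` that the limiting Stieltjes transform annihilates, so that its
value at a Stieltjes transform measures the distance to the limit. -/
noncomputable def cubicDefect (α z g : ℂ) : ℂ :=
  g ^ 3 + 2 * g ^ 2 + (α + 1 - (‖z‖ : ℂ) ^ 2) / α * g + 1 / α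

section SelfConsistent

theorem cubicDefect_eq {α z g w : ℂ} (hα : α ≠ 0) (hw : α * w * (1 + g) = -1) :
    cubicDefect α z g = (1 + g) * (α⁻¹ + g * (1 + (g + (‖z‖ : ℂ) ^ 2 * w))) := by
  rw [cubicDefect]
  field_simp
  linear_combination (-(‖z‖ : ℂ) ^ 2 * g) * hw

theorem im_le_norm_mul_one_add {α g : ℂ} (hg : 0 ≤ (α * g).im) : α.im ≤ ‖α * (1 + g)‖ := by
  refine le_trans ?_ (Complex.im_le_norm _)
  rw [mul_add, mul_one, Complex.add_im]
  exact le_add_of_nonneg_right hg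

theorem norm_rowForm_sub_add_mul_le {ι : Type*} [Fintype ι] [DecidableEq ι] (A : Matrix ι ι ℂ)
    {α g w : ℂ} (hα : 0 < α.im) (p : ι) (hw : α * w * (1 + g) = -1) (hwα : ‖w‖ ≤ 1 / α.im)
    (s : ℂ) :
    ‖rowForm A α p - (g + s * w)‖
      ≤ ‖rowForm A α p - (g + s * gramResolvent (A.updateRow p 0) α p p)‖
        + ‖s‖ * (‖α‖ * (1 / α.im) ^ 2) * ‖rowForm (A.updateRow p 0)ᴴ α p - g‖ := by
  have hσ := mul_gramResolvent_conjTranspose_mul_one_add_rowForm (A.updateRow p 0)ᴴ hα p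
  rw [conjTranspose_conjTranspose] at hσ
  have hv := norm_gramResolvent_apply_le (A.updateRow p 0) hα p p
  set v := gramResolvent (A.updateRow p 0) α p p
  set σ := rowForm (A.updateRow p 0)ᴴ α p
  have hdiff : v - w = α * (v * w) * (σ - g) := by linear_combination (-w) * hσ + v * hw
  have hnorm : ‖s * (v - w)‖ ≤ ‖s‖ * (‖α‖ * (1 / α.im) ^ 2) * ‖σ - g‖ := by
    rw [hdiff, norm_mul, norm_mul, norm_mul, norm_mul, ← mul_assoc, sq]
    gcongr
  calc ‖rowForm A α p - (g + s * w)‖ = ‖rowForm A α p - (g + s * v) + s * (v - w)‖ := by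
        congr 1
        ring
    _ ≤ _ := norm_add_le_of_le le_rfl hnorm

variable {m n : ℕ} {E : Type*} [MeasurableSpace E] {μ : Measure E} [IsProbabilityMeasure μ]
  {φ : E → ℂ} {b : ℝ} {z α : ℂ}

theorem norm_meanTransform_le (z : ℂ) (hα : 0 < α.im) :
    ‖meanTransform m n μ φ α z‖ ≤ 1 / α.im :=
  (norm_integral_le_of_norm_le_const (Eventually.of_forall fun x =>
    norm_cyclicTransform_le (φ ∘ x) z hα)).trans_eq (by simp)

theorem im_mul_cyclicTransform_nonneg (c : Fin m × Fin n × Fin n → ℂ) (z : ℂ) (hα : 0 < α.im) :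
    0 ≤ (α * cyclicTransform c α z).im := by
  have hsum : α * cyclicTransform c α z
      = (((m * n : ℕ) : ℝ)⁻¹ : ℝ) * ∑ p, α * gramResolvent (shiftedCyclic c z) α p p := by
    rw [cyclicTransform, ← Finset.mul_sum, mul_left_comm, trace]
    push_cast
    rfl
  rw [hsum, Complex.im_ofReal_mul, Complex.im_sum]
  exact mul_nonneg (inv_nonneg.mpr (Nat.cast_nonneg _))
    (Finset.sum_nonneg fun p _ => im_mul_gramResolvent_apply_self_nonneg _ hα p)

theorem im_mul_meanTransform_nonneg (hφ : Measurable φ) (hα : 0 < α.im) :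
    0 ≤ (α * meanTransform m n μ φ α z).im := by
  have him := integral_im
    ((integrable_cyclicTransform (m := m) (n := n) (μ := μ) hφ hα z).const_mul α)
  rw [integral_const_mul] at him
  exact (integral_nonneg fun x => im_mul_cyclicTransform_nonneg (φ ∘ x) z hα).trans_eq him

theorem IsBoundedCentred.memLp_top_rowForm_shiftedCyclic (h : IsBoundedCentred μ φ b (n : ℝ)⁻¹)
    (z : ℂ) (hα : 0 < α.im) (p : Fin m × Fin n) :
    MemLp (fun x => rowForm (shiftedCyclic (φ ∘ x) z) α p) ⊤ (entryMeasure m n μ) :=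
  memLp_top_rowForm (measurable_shiftedCyclic h.measurable z) hα (h.memLp_top_shiftedCyclic z p)

theorem IsBoundedCentred.memLp_top_rowForm_conjTranspose (h : IsBoundedCentred μ φ b (n : ℝ)⁻¹)
    (z : ℂ) (hα : 0 < α.im) (p : Fin m × Fin n) :
    MemLp (fun x => rowForm ((shiftedCyclic (φ ∘ x) z).updateRow p 0)ᴴ α p) ⊤
      (entryMeasure m n μ) := by
  have hS := measurable_shiftedCyclic (m := m) (n := n) h.measurable z
  refine memLp_top_rowForm (fun q r => continuous_star.measurable.comp
    (measurable_updateRow_zero hS p r q)) hα fun q => ?_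
  simp only [updateRow_apply]
  split_ifs
  · exact memLp_const _
  · exact (h.memLp_top_shiftedCyclic z q p).star

theorem IsBoundedCentred.integral_norm_rowForm_sub_add_mul_le
    (h : IsBoundedCentred μ φ b (n : ℝ)⁻¹) (hm : 1 < m) (hn : 0 < n) (hα : 0 < α.im) {w : ℂ}
    (hw : α * w * (1 + meanTransform m n μ φ α z) = -1) (hwα : ‖w‖ ≤ 1 / α.im)
    (p : Fin m × Fin n) :
    ∫ x, ‖rowForm (shiftedCyclic (φ ∘ x) z) α p
        - (meanTransform m n μ φ α z + (‖z‖ : ℂ) ^ 2 * w)‖ ∂entryMeasure m n μ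
      ≤ (1 + ‖z‖ ^ 2 * (‖α‖ * (1 / α.im) ^ 2)) * ((7 + 48 * m + 2 * ‖z‖) * (b / α.im)) := by
  set g := meanTransform m n μ φ α z
  have hS := measurable_shiftedCyclic (m := m) (n := n) h.measurable z
  have hrow := h.memLp_top_rowForm_shiftedCyclic (m := m) z hα p
  have hv := memLp_top_gramResolvent_apply (P := entryMeasure m n μ)
    (measurable_updateRow_zero hS p) hα p p
  have hlhs := ((hrow.sub (memLp_const (g + (‖z‖ : ℂ) ^ 2 * w))).integrable le_top).norm
  have hmain := ((hrow.sub ((memLp_const g).add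
    (hv.const_mul ((‖z‖ : ℂ) ^ 2)))).integrable le_top).norm
  have hpert := (((h.memLp_top_rowForm_conjTranspose (m := m) z hα p).sub
    (memLp_const g)).integrable le_top).norm
  have hb : 0 ≤ b / α.im := div_nonneg h.bound_nonneg hα.le
  have hle := integral_mono hlhs (hmain.add (hpert.const_mul
    (‖(‖z‖ : ℂ) ^ 2‖ * (‖α‖ * (1 / α.im) ^ 2))))
    fun x => norm_rowForm_sub_add_mul_le (shiftedCyclic (φ ∘ x) z) hα p hw hwα _
  refine hle.trans ?_
  simp only [Pi.add_apply]
  rw [integral_add hmain (hpert.const_mul _), integral_const_mul, norm_pow, Complex.norm_real,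
    norm_norm, add_mul, one_mul]
  refine add_le_add ((h.integral_norm_rowForm_sub_le hn hα p).trans ?_)
    (mul_le_mul_of_nonneg_left
      ((h.integral_norm_rowForm_conjTranspose_sub_le hm hn hα p).trans ?_) (by positivity))
  · gcongr ?_ * _
    linarith [(Nat.cast_nonneg m : (0 : ℝ) ≤ m)]
  · gcongr ?_ * _
    exact le_add_of_nonneg_right (by positivity)

theorem IsBoundedCentred.norm_inv_add_integral_gramResolvent_mul_le
    (h : IsBoundedCentred μ φ b (n : ℝ)⁻¹) (hα : 0 < α.im) (p : Fin m × Fin n) (κ : ℂ) :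
    ‖α⁻¹ + (∫ x, gramResolvent (shiftedCyclic (φ ∘ x) z)ᴴ α p p ∂entryMeasure m n μ) * (1 + κ)‖
      ≤ 1 / α.im *
        ∫ x, ‖rowForm (shiftedCyclic (φ ∘ x) z) α p - κ‖ ∂entryMeasure m n μ := by
  have hint := (memLp_top_gramResolvent_apply (P := entryMeasure m n μ)
    (measurable_conjTranspose_shiftedCyclic h.measurable z) hα p p).integrable le_top
  have herr := (((h.memLp_top_rowForm_shiftedCyclic (m := m) z hα p).sub
    (memLp_const κ)).integrable le_top).norm
  have heq (x : Fin m × Fin n × Fin n → E) :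
      α⁻¹ + gramResolvent (shiftedCyclic (φ ∘ x) z)ᴴ α p p * (1 + κ)
        = -(gramResolvent (shiftedCyclic (φ ∘ x) z)ᴴ α p p
          * (rowForm (shiftedCyclic (φ ∘ x) z) α p - κ)) := by
    have hα₀ := ne_zero_of_im_pos hα
    have hrow := mul_gramResolvent_conjTranspose_mul_one_add_rowForm
      (shiftedCyclic (φ ∘ x) z) hα p
    field_simp
    linear_combination hrow
  have hmean : α⁻¹ + (∫ x, gramResolvent (shiftedCyclic (φ ∘ x) z)ᴴ α p p ∂entryMeasure m n μ)
      * (1 + κ) = ∫ x, (α⁻¹ + gramResolvent (shiftedCyclic (φ ∘ x) z)ᴴ α p p * (1 + κ))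
        ∂entryMeasure m n μ := by
    rw [integral_add (integrable_const _) (hint.mul_const _), integral_mul_const]
    simp
  rw [hmean, ← integral_const_mul]
  refine norm_integral_le_of_norm_le (herr.const_mul _) (Eventually.of_forall fun x => ?_)
  rw [heq, norm_neg, norm_mul]
  exact mul_le_mul_of_nonneg_right (norm_gramResolvent_apply_le _ hα p p) (norm_nonneg _)

theorem IsBoundedCentred.norm_inv_add_meanTransform_mul_le (h : IsBoundedCentred μ φ b (n : ℝ)⁻¹)
    (hm : 0 < m) (hn : 0 < n) (hα : 0 < α.im) {κ : ℂ} {C : ℝ}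
    (hC : ∀ p : Fin m × Fin n,
      ∫ x, ‖rowForm (shiftedCyclic (φ ∘ x) z) α p - κ‖ ∂entryMeasure m n μ ≤ C) :
    ‖α⁻¹ + meanTransform m n μ φ α z * (1 + κ)‖ ≤ 1 / α.im * C := by
  have hint (p) := (memLp_top_gramResolvent_apply (P := entryMeasure m n μ)
    (measurable_conjTranspose_shiftedCyclic h.measurable z) hα p p).integrable le_top
  have hn₀ : (n : ℂ) ≠ 0 := Nat.cast_ne_zero.mpr hn.ne'
  have haverage : α⁻¹ + meanTransform m n μ φ α z * (1 + κ) = (n : ℂ)⁻¹ * ∑ i : Fin n, (α⁻¹ +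
      (∫ x, gramResolvent (shiftedCyclic (φ ∘ x) z)ᴴ α (⟨0, hm⟩, i) (⟨0, hm⟩, i)
        ∂entryMeasure m n μ) * (1 + κ)) := by
    rw [← integral_blockMean_conjTranspose_shiftedCyclic h.measurable hα ⟨0, hm⟩]
    simp only [blockMean]
    rw [integral_const_mul, integral_finsetSum _ fun i _ => hint (_, i), Finset.sum_add_distrib,
      ← Finset.sum_mul]
    simp only [Finset.sum_const, Finset.card_univ, Fintype.card_fin, nsmul_eq_mul]
    field_simp
  rw [haverage, norm_mul, norm_inv, Complex.norm_natCast, inv_mul_le_iff₀ (Nat.cast_pos.mpr hn)]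
  refine (norm_sum_le_of_le _ fun i _ =>
    (h.norm_inv_add_integral_gramResolvent_mul_le hα (⟨0, hm⟩, i) κ).trans
      (mul_le_mul_of_nonneg_left (hC _) (one_div_pos.mpr hα).le)).trans_eq ?_
  simp

theorem IsBoundedCentred.norm_cubicDefect_meanTransform_le
    (h : IsBoundedCentred μ φ b (n : ℝ)⁻¹) (hm : 1 < m) (hn : 0 < n) (hα : 0 < α.im) :
    ‖cubicDefect α z (meanTransform m n μ φ α z)‖ ≤ (1 + 1 / α.im) * (1 / α.im *
      ((1 + ‖z‖ ^ 2 * (‖α‖ * (1 / α.im) ^ 2)) * ((7 + 48 * m + 2 * ‖z‖) * (b / α.im)))) := by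
  have hα₀ := ne_zero_of_im_pos hα
  have hden := im_le_norm_mul_one_add
    (im_mul_meanTransform_nonneg (m := m) (n := n) (μ := μ) (z := z) h.measurable hα)
  have hg := norm_meanTransform_le (m := m) (n := n) (μ := μ) (φ := φ) z hα
  set g := meanTransform m n μ φ α z
  have hg₁ : α * (1 + g) ≠ 0 := norm_pos_iff.mp (hα.trans_le hden)
  set w := -1 / (α * (1 + g)) with hw_def
  have hw : α * w * (1 + g) = -1 := by rw [mul_right_comm, hw_def, mul_div_cancel₀ _ hg₁]
  have hwα : ‖w‖ ≤ 1 / α.im := by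
    rw [hw_def, norm_div, norm_neg, norm_one]
    exact one_div_le_one_div_of_le hα hden
  have hmean := h.norm_inv_add_meanTransform_mul_le (zero_lt_one.trans hm) hn hα
    (h.integral_norm_rowForm_sub_add_mul_le hm hn hα hw hwα)
  rw [cubicDefect_eq hα₀ hw, norm_mul]
  refine mul_le_mul (norm_add_le_of_le norm_one.le hg) hmean (norm_nonneg _) ?_
  exact (add_pos one_pos (one_div_pos.mpr hα)).le

theorem norm_mul_inv_im_sq_le {N T : ℝ} (hα : 0 < α.im) (hT : 1 ≤ T) (hαT : 1 / α.im ≤ T)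
    (hN : |α.re| ≤ N) : ‖α‖ * (1 / α.im) ^ 2 ≤ (N + 1) * T ^ 2 := by
  have hnorm : ‖α‖ ≤ |α.re| + α.im :=
    (Complex.norm_le_abs_re_add_abs_im α).trans_eq (by rw [abs_of_pos hα])
  have hN₀ : 0 ≤ N := (abs_nonneg _).trans hN
  calc ‖α‖ * (1 / α.im) ^ 2 ≤ (|α.re| + α.im) * (1 / α.im) ^ 2 := by gcongr
    _ = |α.re| * (1 / α.im) ^ 2 + 1 / α.im := by field_simp
    _ ≤ N * T ^ 2 + T ^ 2 := by
        gcongr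
        exact hαT.trans (le_self_pow₀ hT two_ne_zero)
    _ = (N + 1) * T ^ 2 := by ring

theorem IsBoundedCentred.norm_cubicDefect_meanTransform_le_pow
    (h : IsBoundedCentred μ φ b (n : ℝ)⁻¹) (hm : 1 < m) (hn : 0 < n) (hα : 0 < α.im)
    {M N T : ℝ} (hT : 1 ≤ T) (hαT : 1 / α.im ≤ T) (hM : ‖z‖ ≤ M) (hN : |α.re| ≤ N) :
    ‖cubicDefect α z (meanTransform m n μ φ α z)‖
      ≤ 2 * (1 + M ^ 2 * (N + 1)) * (7 + 48 * m + 2 * M) * (T ^ 5 * b) := by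
  have hb := h.bound_nonneg
  have hM₀ : 0 ≤ M := (norm_nonneg z).trans hM
  have hN₀ : 0 ≤ N := (abs_nonneg _).trans hN
  have hfactor : 1 + ‖z‖ ^ 2 * (‖α‖ * (1 / α.im) ^ 2) ≤ (1 + M ^ 2 * (N + 1)) * T ^ 2 := by
    rw [add_mul, one_mul, mul_assoc]
    exact add_le_add (one_le_pow₀ hT)
      (mul_le_mul (pow_le_pow_left₀ (norm_nonneg z) hM 2) (norm_mul_inv_im_sq_le hα hT hαT hN)
        (by positivity) (by positivity))
  refine (h.norm_cubicDefect_meanTransform_le hm hn hα).trans ?_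
  rw [div_eq_mul_one_div b α.im]
  calc (1 + 1 / α.im) * (1 / α.im * ((1 + ‖z‖ ^ 2 * (‖α‖ * (1 / α.im) ^ 2)) *
        ((7 + 48 * m + 2 * ‖z‖) * (b * (1 / α.im)))))
      ≤ (T + T) * (T * ((1 + M ^ 2 * (N + 1)) * T ^ 2 * ((7 + 48 * m + 2 * M) * (b * T)))) := by
        gcongr
    _ = 2 * (1 + M ^ 2 * (N + 1)) * (7 + 48 * m + 2 * M) * (T ^ 5 * b) := by ring

end SelfConsistent

section Perturbation

theorem norm_cubicDefect_sub_le {α z : ℂ} (hα : 0 < α.im) {a g : ℂ} {M T : ℝ} (hT : 1 ≤ T)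
    (hαT : 1 / α.im ≤ T) (ha : ‖a‖ ≤ T) (hg : ‖g‖ ≤ T) (hM : ‖z‖ ≤ M) :
    ‖cubicDefect α z a - cubicDefect α z g‖ ≤ ‖a - g‖ * ((9 + M ^ 2) * T ^ 2) := by
  have hα₀ := ne_zero_of_im_pos hα
  have hT₀ : 0 ≤ T := zero_le_one.trans hT
  have hfactor : cubicDefect α z a - cubicDefect α z g
      = (a - g) * (a ^ 2 + a * g + g ^ 2 + 2 * (a + g) + 1 + (1 - (‖z‖ : ℂ) ^ 2) / α) := by
    rw [cubicDefect, cubicDefect]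
    field_simp
    ring
  have hquad : ‖a ^ 2 + a * g + g ^ 2‖ ≤ T ^ 2 + T * T + T ^ 2 := by
    refine norm_add₃_le.trans ?_
    rw [norm_pow, norm_mul, norm_pow]
    gcongr
  have hlin : ‖2 * (a + g)‖ ≤ 2 * (T + T) := by
    rw [norm_mul, Complex.norm_ofNat]
    exact mul_le_mul_of_nonneg_left (norm_add_le_of_le ha hg) two_pos.le
  have hconst : ‖(1 - (‖z‖ : ℂ) ^ 2) / α‖ ≤ (1 + M ^ 2) * T := by
    have hnum : ‖1 - (‖z‖ : ℂ) ^ 2‖ ≤ 1 + M ^ 2 := by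
      refine norm_sub_le_of_le norm_one.le ?_
      rw [norm_pow, Complex.norm_real, norm_norm]
      gcongr
    rw [div_eq_mul_one_div, norm_mul, norm_div, norm_one]
    exact mul_le_mul hnum ((one_div_le_one_div_of_le hα (Complex.im_le_norm α)).trans hαT)
      (by positivity) (by positivity)
  rw [hfactor, norm_mul]
  refine mul_le_mul_of_nonneg_left ?_ (norm_nonneg _)
  refine (norm_add_le_of_le (norm_add_le_of_le (norm_add_le_of_le hquad hlin) norm_one.le)
    hconst).trans ?_
  nlinarith [le_self_pow₀ hT two_ne_zero, mul_nonneg (sq_nonneg M) hT₀,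
    mul_le_mul_of_nonneg_left (le_self_pow₀ hT two_ne_zero) (sq_nonneg M)]

theorem norm_one_apply_le {ι : Type*} [DecidableEq ι] (i j : ι) :
    ‖(1 : Matrix ι ι ℂ) i j‖ ≤ 1 := by
  rw [one_apply]
  split_ifs <;> simp

theorem norm_trace_mul_mul_le {ι : Type*} [Fintype ι] {A B C : Matrix ι ι ℂ} {a b c : ℝ}
    (hA : ∀ i j, ‖A i j‖ ≤ a) (hB : ∀ i j, ‖B i j‖ ≤ b) (hC : ∀ i j, ‖C i j‖ ≤ c) :
    ‖(A * B * C).trace‖ ≤ (Fintype.card ι : ℝ) ^ 3 * (a * b * c) := by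
  have hterm (i j k : ι) : ‖A i k * B k j * C j i‖ ≤ a * b * c := by
    have ha : 0 ≤ a := (norm_nonneg _).trans (hA i i)
    have hb : 0 ≤ b := (norm_nonneg _).trans (hB i i)
    rw [norm_mul, norm_mul]
    exact mul_le_mul (mul_le_mul (hA i k) (hB k j) (norm_nonneg _) ha) (hC j i) (norm_nonneg _)
      (mul_nonneg ha hb)
  simp only [trace, diag_apply, mul_apply, Finset.sum_mul]
  refine (norm_sum_le_of_le _ fun i _ => norm_sum_le_of_le _ fun j _ => norm_sum_le_of_le _
    fun k _ => hterm i j k).trans_eq ?_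
  simp only [Finset.sum_const, Finset.card_univ, nsmul_eq_mul]
  ring

variable {ι κ : Type*} [Fintype ι] [DecidableEq ι] [Fintype κ]

theorem gramResolvent_sub_gramResolvent (A A' : Matrix κ ι ℂ) {α α' : ℂ} (hα : 0 < α.im)
    (hα' : 0 < α'.im) :
    gramResolvent A α - gramResolvent A' α' = gramResolvent A α *
      ((A'ᴴ * A' - Aᴴ * A) - (α' - α) • (1 : Matrix ι ι ℂ)) * gramResolvent A' α' := by
  have hsplit : (A'ᴴ * A' - Aᴴ * A) - (α' - α) • (1 : Matrix ι ι ℂ)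
      = (A'ᴴ * A' - α' • (1 : Matrix ι ι ℂ)) - (Aᴴ * A - α • (1 : Matrix ι ι ℂ)) := by
    rw [sub_smul]
    abel
  rw [hsplit, mul_sub, sub_mul, gramResolvent_mul_gram_sub A hα, mul_assoc,
    gram_sub_mul_gramResolvent A' hα', mul_one, one_mul]

theorem norm_gram_sub_smul_one_sub_le {Y : Matrix ι ι ℂ} {B M : ℝ} (hY : ∀ i j, ‖Y i j‖ ≤ B)
    {z z' : ℂ} (hz : ‖z‖ ≤ M) (hz' : ‖z'‖ ≤ M) (i j : ι) :
    ‖((Y - z' • (1 : Matrix ι ι ℂ))ᴴ * (Y - z' • (1 : Matrix ι ι ℂ))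
      - (Y - z • (1 : Matrix ι ι ℂ))ᴴ * (Y - z • (1 : Matrix ι ι ℂ))) i j‖
      ≤ 2 * (B + M) * ‖z' - z‖ := by
  have hexpand : (Y - z' • (1 : Matrix ι ι ℂ))ᴴ * (Y - z' • (1 : Matrix ι ι ℂ))
      - (Y - z • (1 : Matrix ι ι ℂ))ᴴ * (Y - z • (1 : Matrix ι ι ℂ))
      = (star (z' - z) * z' + star z * (z' - z)) • (1 : Matrix ι ι ℂ) - (z' - z) • Yᴴ
        - star (z' - z) • Y := by
    simp only [conjTranspose_sub, conjTranspose_smul, conjTranspose_one, mul_sub, sub_mul,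
      mul_smul_comm, smul_mul_assoc, mul_one, one_mul, star_sub, smul_sub, smul_smul]
    module
  have hone : ‖(star (z' - z) * z' + star z * (z' - z)) * (1 : Matrix ι ι ℂ) i j‖
      ≤ ‖z' - z‖ * M + M * ‖z' - z‖ := by
    rw [norm_mul]
    refine (mul_le_of_le_one_right (norm_nonneg _) (norm_one_apply_le i j)).trans ?_
    refine norm_add_le_of_le ?_ ?_ <;> rw [norm_mul, norm_star] <;> gcongr
  have hconj : ‖(z' - z) * star (Y j i)‖ ≤ ‖z' - z‖ * B := by
    rw [norm_mul, norm_star]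
    exact mul_le_mul_of_nonneg_left (hY j i) (norm_nonneg _)
  have hself : ‖star (z' - z) * Y i j‖ ≤ ‖z' - z‖ * B := by
    rw [norm_mul, norm_star]
    exact mul_le_mul_of_nonneg_left (hY i j) (norm_nonneg _)
  rw [hexpand]
  exact (norm_sub_le_of_le (norm_sub_le_of_le hone hconj) hself).trans_eq (by ring)

theorem norm_trace_gramResolvent_sub_smul_one_sub_le {Y : Matrix ι ι ℂ} {B M T : ℝ}
    (hY : ∀ i j, ‖Y i j‖ ≤ B) {α α' z z' : ℂ} (hz : ‖z‖ ≤ M) (hz' : ‖z'‖ ≤ M) (hα : 0 < α.im)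
    (hα' : 0 < α'.im) (hT : 1 / α.im ≤ T) (hT' : 1 / α'.im ≤ T) :
    ‖(gramResolvent (Y - z • (1 : Matrix ι ι ℂ)) α).trace
      - (gramResolvent (Y - z' • (1 : Matrix ι ι ℂ)) α').trace‖
      ≤ (Fintype.card ι : ℝ) ^ 3 * (T * (2 * (B + M) * ‖z' - z‖ + ‖α' - α‖) * T) := by
  rw [← trace_sub, gramResolvent_sub_gramResolvent _ _ hα hα']
  refine norm_trace_mul_mul_le (fun i j => (norm_gramResolvent_apply_le _ hα i j).trans hT)
    (fun i j => norm_sub_le_of_le (norm_gram_sub_smul_one_sub_le hY hz hz' i j) ?_)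
    (fun i j => (norm_gramResolvent_apply_le _ hα' i j).trans hT')
  rw [Matrix.smul_apply, smul_eq_mul, norm_mul]
  exact mul_le_of_le_one_right (norm_nonneg _) (norm_one_apply_le i j)

end Perturbation

section Transform

variable {m n : ℕ} {E : Type*} {φ : E → ℂ} {α α' z z' : ℂ}

theorem shiftedStieltjes_blockCyclic (X : Fin m → Matrix (Fin n) (Fin n) ℂ) (z : ℂ)
    (hα : 0 < α.im) :
    shiftedStieltjes (blockCyclic X) α z = cyclicTransform (fun k => X k.1 k.2.1 k.2.2) α z := by
  rw [shiftedStieltjes_eq_trace _ _ hα, cyclicTransform, Fintype.card_prod, Fintype.card_fin,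
    Fintype.card_fin]
  rfl

theorem norm_cyclicTransform_sub_le {c : Fin m × Fin n × Fin n → ℂ} {B M T : ℝ}
    (hc : ∀ k, ‖c k‖ ≤ B) (hz : ‖z‖ ≤ M) (hz' : ‖z'‖ ≤ M) (hα : 0 < α.im) (hα' : 0 < α'.im)
    (hT : 1 / α.im ≤ T) (hT' : 1 / α'.im ≤ T) :
    ‖cyclicTransform c α z - cyclicTransform c α' z'‖
      ≤ (m * n : ℝ) ^ 2 * (T ^ 2 * (2 * (B + M) * ‖z' - z‖ + ‖α' - α‖)) := by
  have hY (p q) : ‖blockCyclic (fun k => of fun i j => c (k, i, j)) p q‖ ≤ B := by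
    simp only [blockCyclic, of_apply]
    split_ifs
    · exact hc _
    · exact norm_zero.trans_le ((norm_nonneg _).trans (hc (p.1, p.2, p.2)))
  have htrace := norm_trace_gramResolvent_sub_smul_one_sub_le hY hz hz' hα hα' hT hT'
  simp only [Fintype.card_prod, Fintype.card_fin, Nat.cast_mul] at htrace
  rw [cyclicTransform, cyclicTransform, ← mul_sub, norm_mul, norm_inv, Complex.norm_natCast,
    Nat.cast_mul]
  rcases (by positivity : (0 : ℝ) ≤ m * n).eq_or_lt with hzero | hpos
  · simp [← hzero]
  · exact (inv_mul_le_iff₀ hpos).mpr (htrace.trans_eq (by ring))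

theorem norm_cyclicTransform_sub_le_of_entryRow (hα : 0 < α.im) {p : Fin m × Fin n}
    {x x' : Fin m × Fin n × Fin n → E} (h : ∀ k, entryRow k ≠ p → x k = x' k) :
    ‖cyclicTransform (φ ∘ x) α z - cyclicTransform (φ ∘ x') α z‖
      ≤ 2 / α.im / (m * n : ℕ) := by
  have hsum := norm_sum_mul_gramResolvent_shiftedCyclic_sub_le (φ := φ) (z := z) hα h
    (d := fun _ => 1) (by simp)
  rw [cyclicTransform, cyclicTransform, ← mul_sub, norm_mul, norm_inv, Complex.norm_natCast,
    inv_mul_eq_div, trace, trace, ← Finset.sum_sub_distrib]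
  gcongr
  simpa only [one_mul, diag_apply] using hsum

variable [MeasurableSpace E] {μ : Measure E} [IsProbabilityMeasure μ]

theorem measure_two_mul_lt_norm_cyclicTransform_sub_le (hm : 0 < m) (hn : 0 < n)
    (hφ : Measurable φ) {y ε : ℝ} (hy : 0 < y) (hyα : y ≤ α.im) (hε : 0 ≤ ε) :
    (entryMeasure m n μ).real
        {x | 2 * ε < ‖cyclicTransform (φ ∘ x) α z - meanTransform m n μ φ α z‖}
      ≤ 4 * Real.exp (-(ε ^ 2 * n * y ^ 2) / 8) := by
  have hα := hy.trans_le hyα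
  have : (0 : ℝ) < n := Nat.cast_pos.mpr hn
  have hm' : (1 : ℝ) ≤ m := Nat.one_le_cast.mpr hm
  let V : NNReal := ⟨4 / (n * y ^ 2), by positivity⟩
  have hV : Fintype.card (Fin m × Fin n) * (2 / α.im / (m * n : ℕ)) ^ 2 ≤ (V : ℝ) := by
    change _ ≤ 4 / (n * y ^ 2)
    calc Fintype.card (Fin m × Fin n) * (2 / α.im / (m * n : ℕ)) ^ 2
        = 4 / (m * (n * α.im ^ 2)) := by
          rw [Fintype.card_prod, Fintype.card_fin, Fintype.card_fin]
          push_cast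
          field_simp
          norm_num
      _ ≤ 4 / (1 * (n * y ^ 2)) := by gcongr
      _ = 4 / (n * y ^ 2) := by rw [one_mul]
  refine (measure_two_mul_lt_norm_sub_le_of_boundedDifferences
    (measurable_cyclicTransform hφ α z) entryRow
    (fun p x x' h => norm_cyclicTransform_sub_le_of_entryRow hα h) hε hV).trans_eq ?_
  congr 2
  change -ε ^ 2 / (2 * (4 / (n * y ^ 2))) = _
  field_simp
  ring

end Transform

/-- The grid point with coordinates `k` in units of the mesh `n⁻⁴`. -/
noncomputable def gridPoint (n : ℕ) (k : ℤ × ℤ) : ℂ := ⟨k.1 / (n : ℝ) ^ 4, k.2 / (n : ℝ) ^ 4⟩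

/-- The square grid of mesh `n⁻⁴` and side `2 n²`, given by the coordinates of its points. -/
noncomputable def grid (n : ℕ) : Finset (ℤ × ℤ) :=
  Finset.Icc (-(n : ℤ) ^ 6) ((n : ℤ) ^ 6) ×ˢ Finset.Icc (-(n : ℤ) ^ 6) ((n : ℤ) ^ 6)

section Grid

theorem card_grid (n : ℕ) : ((grid n).card : ℝ) = (2 * (n : ℝ) ^ 6 + 1) ^ 2 := by
  have hside : ((Finset.Icc (-(n : ℤ) ^ 6) ((n : ℤ) ^ 6)).card : ℤ) = 2 * (n : ℤ) ^ 6 + 1 := by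
    have hn : 0 ≤ (n : ℤ) ^ 6 := by positivity
    rw [Int.card_Icc, Int.toNat_of_nonneg (by linarith)]
    ring
  have hside' : ((Finset.Icc (-(n : ℤ) ^ 6) ((n : ℤ) ^ 6)).card : ℝ) = 2 * (n : ℝ) ^ 6 + 1 :=
    mod_cast hside
  rw [grid, Finset.card_product, Nat.cast_mul, hside', sq]

variable {n : ℕ}

theorem abs_ceil_mul_div_sub_le {c : ℝ} (hc : 0 < c) (t : ℝ) :
    |(⌈t * c⌉ : ℝ) / c - t| ≤ 1 / c := by
  rw [div_sub' hc.ne', abs_div, abs_of_pos hc]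
  gcongr
  rw [abs_le]
  constructor <;> linarith [Int.le_ceil (t * c), Int.ceil_lt_add_one (t * c)]

theorem ceil_mul_mem_Icc (hn : 0 < n) {t : ℝ} (ht : |t| + 1 ≤ (n : ℝ) ^ 2) :
    ⌈t * (n : ℝ) ^ 4⌉ ∈ Finset.Icc (-(n : ℤ) ^ 6) ((n : ℤ) ^ 6) := by
  have hn' : (0 : ℝ) < (n : ℝ) ^ 4 := by positivity
  have hn₁ : (1 : ℝ) ≤ (n : ℝ) ^ 4 := one_le_pow₀ (Nat.one_le_cast.mpr hn)
  have hdiv : |(⌈t * (n : ℝ) ^ 4⌉ : ℝ) / (n : ℝ) ^ 4| ≤ (n : ℝ) ^ 2 := by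
    linarith [abs_sub_abs_le_abs_sub ((⌈t * (n : ℝ) ^ 4⌉ : ℝ) / (n : ℝ) ^ 4) t,
      abs_ceil_mul_div_sub_le hn' t, div_le_one_of_le₀ hn₁ hn'.le]
  rw [abs_div, abs_of_pos hn', div_le_iff₀ hn', ← pow_add] at hdiv
  exact Finset.mem_Icc.mpr (abs_le.mp (mod_cast hdiv))

theorem exists_mem_grid (hn : 0 < n) {w : ℂ} (hre : |w.re| + 1 ≤ (n : ℝ) ^ 2)
    (him : |w.im| + 1 ≤ (n : ℝ) ^ 2) :
    ∃ k ∈ grid n, ‖gridPoint n k - w‖ ≤ 2 / (n : ℝ) ^ 4 ∧ w.im ≤ (gridPoint n k).im := by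
  have hn' : (0 : ℝ) < (n : ℝ) ^ 4 := by positivity
  refine ⟨(⌈w.re * (n : ℝ) ^ 4⌉, ⌈w.im * (n : ℝ) ^ 4⌉),
    Finset.mk_mem_product (ceil_mul_mem_Icc hn hre) (ceil_mul_mem_Icc hn him), ?_,
    (le_div_iff₀ hn').mpr (Int.le_ceil _)⟩
  refine (Complex.norm_le_abs_re_add_abs_im _).trans ((add_le_add
    (abs_ceil_mul_div_sub_le hn' w.re) (abs_ceil_mul_div_sub_le hn' w.im)).trans_eq ?_)
  ring

end Grid

/-- The event that the Stieltjes transform deviates from its mean by more than `3 * ε` at some point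
of the domain under consideration. -/
def deviationSet (m n : ℕ) {E : Type*} [MeasurableSpace E] (μ : Measure E) (φ : E → ℂ)
    (M N y ε : ℝ) : Set (Fin m × Fin n × Fin n → E) :=
  {x | ∃ α z : ℂ, ‖z‖ ≤ M ∧ |α.re| ≤ N ∧ y ≤ α.im ∧
    3 * ε < ‖cyclicTransform (φ ∘ x) α z - meanTransform m n μ φ α z‖}

/-- The bound on the probability of the deviation event obtained from a union bound over all pairs
of grid points. -/
noncomputable def deviationBound (n : ℕ) (y ε : ℝ) : ℝ :=
  (2 * (n : ℝ) ^ 6 + 1) ^ 4 * (4 * Real.exp (-(ε ^ 2 * n * y ^ 2) / 8))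

section Deviation

variable {m n : ℕ} {E : Type*} [MeasurableSpace E] {μ : Measure E} [IsProbabilityMeasure μ]
  {φ : E → ℂ} {α α' z z' : ℂ} {B M N y ε : ℝ}

theorem norm_cyclicTransform_sub_meanTransform_le (x : Fin m × Fin n × Fin n → E) (z : ℂ)
    (hα : 0 < α.im) :
    ‖cyclicTransform (φ ∘ x) α z - meanTransform m n μ φ α z‖ ≤ 2 / α.im :=
  (norm_sub_le_of_le (norm_cyclicTransform_le _ z hα) (norm_meanTransform_le z hα)).trans_eq
    (by ring)

theorem norm_cyclicTransform_sub_meanTransform_sub_le (hφ : Measurable φ) (hB : ∀ u, ‖φ u‖ ≤ B)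
    (hz : ‖z‖ ≤ M) (hz' : ‖z'‖ ≤ M) (hα : 0 < α.im) (hα' : 0 < α'.im) {T : ℝ}
    (hT : 1 / α.im ≤ T) (hT' : 1 / α'.im ≤ T) (x : Fin m × Fin n × Fin n → E) :
    ‖(cyclicTransform (φ ∘ x) α z - meanTransform m n μ φ α z)
        - (cyclicTransform (φ ∘ x) α' z' - meanTransform m n μ φ α' z')‖
      ≤ 2 * ((m * n : ℝ) ^ 2 * (T ^ 2 * (2 * (B + M) * ‖z' - z‖ + ‖α' - α‖))) := by
  have hlip (x : Fin m × Fin n × Fin n → E) := norm_cyclicTransform_sub_le (c := φ ∘ x)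
    (fun k => hB (x k)) hz hz' hα hα' hT hT'
  have hmean : ‖meanTransform m n μ φ α z - meanTransform m n μ φ α' z'‖
      ≤ (m * n : ℝ) ^ 2 * (T ^ 2 * (2 * (B + M) * ‖z' - z‖ + ‖α' - α‖)) := by
    rw [meanTransform, meanTransform, ← integral_sub (integrable_cyclicTransform hφ hα z)
      (integrable_cyclicTransform hφ hα' z')]
    exact (norm_integral_le_of_norm_le_const (Eventually.of_forall hlip)).trans_eq (by simp)
  rw [sub_sub_sub_comm]
  exact (norm_sub_le_of_le (hlip x) hmean).trans_eq (two_mul _).symm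

theorem norm_cyclicTransform_sub_meanTransform_sub_le_of_grid (hφ : Measurable φ)
    (hB : ∀ u, ‖φ u‖ ≤ B) (hn : 0 < n) (hy : 0 < y) (hyn : 1 / y ^ 2 ≤ n) (hz : ‖z‖ ≤ M)
    (hα : y ≤ α.im) (hα' : y ≤ α'.im) (hzz' : ‖z' - z‖ ≤ 2 / (n : ℝ) ^ 4)
    (hαα' : ‖α' - α‖ ≤ 2 / (n : ℝ) ^ 4) (x : Fin m × Fin n × Fin n → E) :
    ‖(cyclicTransform (φ ∘ x) α z - meanTransform m n μ φ α z)
        - (cyclicTransform (φ ∘ x) α' z' - meanTransform m n μ φ α' z')‖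
      ≤ (m : ℝ) ^ 2 * (8 * (B + M + 2) + 4) / n := by
  have hB₀ : 0 ≤ B := (norm_nonneg _).trans (hB μ.nonempty_of_neZero.some)
  have hM : 0 ≤ M := (norm_nonneg z).trans hz
  have : (0 : ℝ) < n := Nat.cast_pos.mpr hn
  have hmesh : 2 / (n : ℝ) ^ 4 ≤ 2 :=
    div_le_self two_pos.le (one_le_pow₀ (Nat.one_le_cast.mpr hn))
  have hz' : ‖z'‖ ≤ M + 2 := by linarith [norm_sub_norm_le z' z]
  refine (norm_cyclicTransform_sub_meanTransform_sub_le hφ hB (hz.trans (by linarith)) hz'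
    (hy.trans_le hα) (hy.trans_le hα') (one_div_le_one_div_of_le hy hα)
    (one_div_le_one_div_of_le hy hα') x).trans ?_
  calc 2 * ((m * n : ℝ) ^ 2 * ((1 / y) ^ 2 * (2 * (B + (M + 2)) * ‖z' - z‖ + ‖α' - α‖)))
      ≤ 2 * ((m * n : ℝ) ^ 2 *
          (n * (2 * (B + (M + 2)) * (2 / (n : ℝ) ^ 4) + 2 / (n : ℝ) ^ 4))) := by
        rw [_root_.one_div_pow]
        gcongr
    _ = (m : ℝ) ^ 2 * (8 * (B + M + 2) + 4) / n := by
        field_simp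
        ring

theorem deviationSet_subset (hφ : Measurable φ) (hB : ∀ u, ‖φ u‖ ≤ B) (hn : 2 ≤ n)
    (hN : N + 1 ≤ n) (hM : M + 1 ≤ n) (hy : 0 < y) (hyn : 1 / y ^ 2 ≤ n) (hε : 1 / (n : ℝ) ≤ ε)
    (hBε : (m : ℝ) ^ 2 * (8 * (B + M + 2) + 4) / n ≤ ε) :
    deviationSet m n μ φ M N y ε ⊆
      ⋃ k ∈ (grid n ×ˢ grid n).filter (fun k => y ≤ (gridPoint n k.1).im),
        {x | 2 * ε < ‖cyclicTransform (φ ∘ x) (gridPoint n k.1) (gridPoint n k.2)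
          - meanTransform m n μ φ (gridPoint n k.1) (gridPoint n k.2)‖} := by
  rintro x ⟨α, z, hz, hre, him, hx⟩
  have hn₀ : 0 < n := two_pos.trans_le hn
  have hn' : (0 : ℝ) < n := Nat.cast_pos.mpr hn₀
  have hα : 0 < α.im := hy.trans_le him
  have hsq : (n : ℝ) + 1 ≤ (n : ℝ) ^ 2 := by
    nlinarith [(Nat.ofNat_le_cast.mpr hn : (2 : ℝ) ≤ n)]
  have himn : α.im ≤ n := by
    by_contra! hbig
    have hsmall := norm_cyclicTransform_sub_meanTransform_le (μ := μ) (φ := φ) x z hα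
    have hdiv : 2 / α.im ≤ 2 / n := div_le_div_of_nonneg_left two_pos.le hn' hbig.le
    rw [div_eq_mul_one_div 2 (n : ℝ)] at hdiv
    linarith [one_div_pos.mpr hn']
  obtain ⟨k, hk, hkα, hkim⟩ := exists_mem_grid hn₀ (w := α) (by linarith)
    (by rw [abs_of_pos hα]; linarith)
  obtain ⟨l, hl, hlz, -⟩ := exists_mem_grid hn₀ (w := z)
    (by linarith [Complex.abs_re_le_norm z]) (by linarith [Complex.abs_im_le_norm z])
  have hlip := (norm_cyclicTransform_sub_meanTransform_sub_le_of_grid (μ := μ) hφ hB hn₀ hy hyn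
    hz him (him.trans hkim) hlz hkα x).trans hBε
  refine Set.mem_biUnion (x := (k, l)) (Finset.mem_filter.mpr
    ⟨Finset.mk_mem_product hk hl, him.trans hkim⟩) ?_
  change 2 * ε < _
  linarith [norm_sub_norm_le (cyclicTransform (φ ∘ x) α z - meanTransform m n μ φ α z)
    (cyclicTransform (φ ∘ x) (gridPoint n k) (gridPoint n l)
      - meanTransform m n μ φ (gridPoint n k) (gridPoint n l))]

theorem measure_deviationSet_le (hm : 0 < m) (hφ : Measurable φ) (hB : ∀ u, ‖φ u‖ ≤ B)
    (hn : 2 ≤ n) (hN : N + 1 ≤ n) (hM : M + 1 ≤ n) (hy : 0 < y) (hyn : 1 / y ^ 2 ≤ n)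
    (hε : 1 / (n : ℝ) ≤ ε) (hBε : (m : ℝ) ^ 2 * (8 * (B + M + 2) + 4) / n ≤ ε) :
    entryMeasure m n μ (deviationSet m n μ φ M N y ε) ≤
      ENNReal.ofReal (deviationBound n y ε) := by
  have hε₀ : 0 ≤ ε := (one_div_nonneg.mpr n.cast_nonneg).trans hε
  rw [← ofReal_measureReal]
  refine ENNReal.ofReal_le_ofReal ?_
  refine (measureReal_mono (deviationSet_subset hφ hB hn hN hM hy hyn hε hBε)
    (measure_ne_top _ _)).trans ((measureReal_biUnion_finset_le _ _).trans ?_)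
  calc _ ≤ ∑ _ ∈ (grid n ×ˢ grid n).filter (fun k => y ≤ (gridPoint n k.1).im),
        4 * Real.exp (-(ε ^ 2 * n * y ^ 2) / 8) :=
        Finset.sum_le_sum fun k hk => measure_two_mul_lt_norm_cyclicTransform_sub_le hm
          (two_pos.trans_le hn) hφ hy (Finset.mem_filter.mp hk).2 hε₀
    _ ≤ ∑ _ ∈ grid n ×ˢ grid n, 4 * Real.exp (-(ε ^ 2 * n * y ^ 2) / 8) :=
        Finset.sum_le_sum_of_subset_of_nonneg (Finset.filter_subset _ _)
          fun _ _ _ => by positivity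
    _ = _ := by
        rw [Finset.sum_const, nsmul_eq_mul, Finset.card_product, Nat.cast_mul, card_grid,
          deviationBound]
        ring

end Deviation

/-- The function agreeing with the identity on the closed disc of radius `b` and vanishing outside;
it turns the almost sure bound on the entries into a sure one. -/
noncomputable def truncate (b : ℝ) (u : ℂ) : ℂ := if ‖u‖ ≤ b then u else 0

theorem measurable_truncate (b : ℝ) : Measurable (truncate b) :=
  Measurable.ite (measurableSet_le measurable_norm measurable_const) measurable_id measurable_const

theorem norm_truncate_le {b : ℝ} (hb : 0 ≤ b) (u : ℂ) : ‖truncate b u‖ ≤ b := by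
  rw [truncate]
  split_ifs with hu
  · exact hu
  · rwa [norm_zero]

theorem norm_div_sqrt_natCast (w : ℂ) (n : ℕ) : ‖w / (√(n : ℝ) : ℂ)‖ = ‖w‖ / √n := by
  rw [norm_div, Complex.norm_of_nonneg (Real.sqrt_nonneg _)]

/-- The array of all entries of the random matrices. -/
def entryArray {Ω : Type*} {m n : ℕ} (X : Fin m → Ω → Matrix (Fin n) (Fin n) ℂ) (ω : Ω) :
    Fin m × Fin n × Fin n → ℂ := fun k => X k.1 ω k.2.1 k.2.2

namespace IsBoundedEnsemble

variable {Ω : Type*} [MeasurableSpace Ω] {P : Measure Ω} {m n : ℕ}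
  {X : Fin m → Ω → Matrix (Fin n) (Fin n) ℂ} {ξ : Ω → ℂ} {b : ℝ}

theorem aemeasurable_normalized (h : IsBoundedEnsemble P X ξ b) (hm : 0 < m) (hn : 0 < n) :
    AEMeasurable (fun ω => ξ ω / (√(n : ℝ) : ℂ)) P :=
  (h.identDistrib ⟨0, hm⟩ ⟨0, hn⟩ ⟨0, hn⟩).aemeasurable_snd

theorem truncate_normalized_ae_eq (h : IsBoundedEnsemble P X ξ b) :
    ∀ᵐ ω ∂P, truncate (b / √n) (ξ ω / (√(n : ℝ) : ℂ)) = ξ ω / (√(n : ℝ) : ℂ) := by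
  filter_upwards [h.bounded] with ω hω
  rw [truncate, if_pos]
  rw [norm_div_sqrt_natCast]
  gcongr

theorem aemeasurable_entryArray (h : IsBoundedEnsemble P X ξ b) :
    AEMeasurable (entryArray X) P :=
  aemeasurable_pi_lambda _ fun k => (h.identDistrib k.1 k.2.1 k.2.2).aemeasurable_fst

theorem truncate_entryArray_ae_eq (h : IsBoundedEnsemble P X ξ b) :
    ∀ᵐ ω ∂P, truncate (b / √n) ∘ entryArray X ω = entryArray X ω := by
  have hentry (k : Fin m × Fin n × Fin n) :
      ∀ᵐ ω ∂P, truncate (b / √n) (entryArray X ω k) = entryArray X ω k :=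
    (h.identDistrib k.1 k.2.1 k.2.2).symm.ae_snd (p := fun u => truncate (b / √n) u = u)
      (measurableSet_eq_fun (measurable_truncate _) measurable_id) h.truncate_normalized_ae_eq
  filter_upwards [ae_all_iff.mpr hentry] with ω hω
  exact funext hω

theorem map_entryArray (h : IsBoundedEnsemble P X ξ b) :
    P.map (entryArray X) = entryMeasure m n (P.map fun ω => ξ ω / (√(n : ℝ) : ℂ)) :=
  (h.indep.map_fun_eq_pi_map fun k : Fin m × Fin n × Fin n =>
    (h.identDistrib k.1 k.2.1 k.2.2).aemeasurable_fst).trans <| congrArg Measure.pi <|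
      funext fun k : Fin m × Fin n × Fin n => (h.identDistrib k.1 k.2.1 k.2.2).map_eq

variable [IsProbabilityMeasure P]

theorem bound_nonneg (h : IsBoundedEnsemble P X ξ b) : 0 ≤ b := by
  obtain ⟨ω, hω⟩ := h.bounded.exists
  exact (norm_nonneg _).trans hω

theorem isBoundedCentred (h : IsBoundedEnsemble P X ξ b) (hm : 0 < m) (hn : 0 < n) :
    IsBoundedCentred (P.map fun ω => ξ ω / (√(n : ℝ) : ℂ)) (truncate (b / √n)) (b / √n)
      (n : ℝ)⁻¹ where
  measurable := measurable_truncate _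
  bound := norm_truncate_le (div_nonneg h.bound_nonneg (Real.sqrt_nonneg _))
  mean_zero := by
    rw [integral_map (h.aemeasurable_normalized hm hn)
      (measurable_truncate _).aestronglyMeasurable,
      integral_congr_ae h.truncate_normalized_ae_eq, integral_div, h.mean_zero, zero_div]
  variance := by
    have hsq : ∀ᵐ ω ∂P, ‖truncate (b / √n) (ξ ω / (√(n : ℝ) : ℂ))‖ ^ 2
        = (n : ℝ)⁻¹ * ‖ξ ω‖ ^ 2 := by
      filter_upwards [h.truncate_normalized_ae_eq] with ω hω
      rw [hω, norm_div_sqrt_natCast, div_pow, Real.sq_sqrt n.cast_nonneg, div_eq_inv_mul]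
    rw [integral_map (h.aemeasurable_normalized hm hn)
      ((measurable_truncate _).norm.pow_const 2).aestronglyMeasurable, integral_congr_ae hsq,
      integral_const_mul, h.variance_one, mul_one]

end IsBoundedEnsemble

section Rates

variable {η δ K : ℝ} {n : ℕ}

theorem cutoff_pos (hn : 0 < n) : 0 < cutoff η δ n :=
  Real.rpow_pos_of_pos (Nat.cast_pos.mpr hn) _

theorem cutoff_le_one (hn : 0 < n) (hηδ : 0 ≤ η * δ) : cutoff η δ n ≤ 1 :=
  Real.rpow_le_one_of_one_le_of_nonpos (Nat.one_le_cast.mpr hn) (neg_nonpos.mpr hηδ)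

theorem errorRate_eq (η δ : ℝ) (n : ℕ) :
    errorRate η δ n = (n : ℝ) ^ (-(1 / 4) : ℝ) * (cutoff η δ n)⁻¹ ^ 5 * (n : ℝ) ^ δ := by
  rw [errorRate, inv_pow, _root_.zpow_neg]
  rfl

theorem cutoff_sq_eq (η δ : ℝ) (n : ℕ) : cutoff η δ n ^ 2 = (n : ℝ) ^ (-(2 * (δ * η))) := by
  rw [cutoff, ← Real.rpow_mul_natCast n.cast_nonneg]
  congr 1
  push_cast
  ring

theorem one_div_cutoff_sq_le (hn : 0 < n) (hδη : δ * η ≤ 1 / 32) :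
    1 / cutoff η δ n ^ 2 ≤ n := by
  rw [cutoff_sq_eq, Real.rpow_neg n.cast_nonneg, one_div, inv_inv]
  exact Real.rpow_le_self_of_one_le (Nat.one_le_cast.mpr hn) (by linarith)

theorem rpow_le_rpow_neg_quarter_sq_mul_cutoff_sq (hn : 0 < n) (hδη : δ * η ≤ 1 / 32) :
    (n : ℝ) ^ (7 / 16 : ℝ) ≤ ((n : ℝ) ^ (-(1 / 4) : ℝ)) ^ 2 * n * cutoff η δ n ^ 2 := by
  have hn' : (0 : ℝ) < n := Nat.cast_pos.mpr hn
  rw [cutoff_sq_eq, ← Real.rpow_mul_natCast hn'.le, ← Real.rpow_add_one hn'.ne',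
    ← Real.rpow_add hn']
  refine Real.rpow_le_rpow_of_exponent_le (Nat.one_le_cast.mpr hn) ?_
  push_cast
  linarith

theorem one_div_sqrt_le_rpow_neg_quarter (hn : 0 < n) : 1 / √n ≤ (n : ℝ) ^ (-(1 / 4) : ℝ) := by
  rw [Real.sqrt_eq_rpow, one_div, ← Real.rpow_neg n.cast_nonneg]
  exact Real.rpow_le_rpow_of_exponent_le (Nat.one_le_cast.mpr hn) (by norm_num)

theorem mul_rpow_div_sqrt_le (hn : 0 < n) (hδ : δ ≤ 1 / 32) : K * (n : ℝ) ^ δ / √n ≤ |K| := by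
  have hpow : (n : ℝ) ^ δ ≤ √n := by
    rw [Real.sqrt_eq_rpow]
    exact Real.rpow_le_rpow_of_exponent_le (Nat.one_le_cast.mpr hn) (by linarith)
  rw [div_le_iff₀ (Real.sqrt_pos.mpr (Nat.cast_pos.mpr hn))]
  gcongr
  exact le_abs_self K

theorem eventually_div_le_rpow_neg_quarter (a : ℝ) :
    ∀ᶠ n : ℕ in atTop, a / n ≤ (n : ℝ) ^ (-(1 / 4) : ℝ) := by
  have hgrowth : Tendsto (fun n : ℕ => (n : ℝ) ^ (3 / 4 : ℝ)) atTop atTop :=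
    (tendsto_rpow_atTop (by norm_num)).comp tendsto_natCast_atTop_atTop
  filter_upwards [hgrowth.eventually_ge_atTop a, eventually_gt_atTop 0] with n ha hn
  have hn' : (0 : ℝ) < n := Nat.cast_pos.mpr hn
  rw [div_le_iff₀ hn', ← Real.rpow_add_one hn'.ne']
  exact ha.trans_eq (by norm_num)

theorem summable_pow_mul_exp_neg_mul_rpow (k : ℕ) {a c : ℝ} (ha : 0 < a) (hc : 0 < c) :
    Summable fun n : ℕ => (n : ℝ) ^ k * Real.exp (-c * (n : ℝ) ^ a) := by
  have hexp : (fun n : ℕ => Real.exp (-c * (n : ℝ) ^ a)) =O[atTop]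
      fun n : ℕ => ((n : ℝ) ^ (k + 2))⁻¹ := by
    refine ((isLittleO_exp_neg_mul_rpow_atTop hc (-((k + 2 : ℕ) / a))).comp_tendsto
      ((tendsto_rpow_atTop ha).comp tendsto_natCast_atTop_atTop)).isBigO.congr_right fun n => ?_
    change ((n : ℝ) ^ a) ^ _ = _
    rw [← Real.rpow_mul n.cast_nonneg, mul_neg, mul_div_cancel₀ _ ha.ne',
      Real.rpow_neg n.cast_nonneg, Real.rpow_natCast]
  refine summable_of_isBigO_nat (Real.summable_nat_pow_inv.mpr one_lt_two)
    (((Asymptotics.isBigO_refl (fun n : ℕ => (n : ℝ) ^ k) atTop).mul hexp).trans_eventuallyEq ?_)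
  filter_upwards [eventually_gt_atTop 0] with n hn
  field_simp
  rw [pow_add]

theorem summable_deviationBound (hδη : δ * η ≤ 1 / 32) :
    Summable fun n : ℕ => deviationBound n (cutoff η δ n) ((n : ℝ) ^ (-(1 / 4) : ℝ)) := by
  refine summable_of_isBigO_nat (summable_pow_mul_exp_neg_mul_rpow 24 (a := 7 / 16) (c := 1 / 8)
    (by norm_num) (by norm_num)) (.of_bound (3 ^ 4 * 4) ?_)
  filter_upwards [eventually_gt_atTop 0] with n hn
  have hone : (1 : ℝ) ≤ (n : ℝ) ^ 6 := one_le_pow₀ (Nat.one_le_cast.mpr hn)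
  have hrate := rpow_le_rpow_neg_quarter_sq_mul_cutoff_sq (η := η) hn hδη
  rw [deviationBound, Real.norm_of_nonneg (by positivity), Real.norm_of_nonneg (by positivity)]
  calc _ ≤ (3 * (n : ℝ) ^ 6) ^ 4 * (4 * Real.exp (-(1 / 8) * (n : ℝ) ^ (7 / 16 : ℝ))) := by
        gcongr <;> linarith
    _ = _ := by ring

end Rates

/-- The constant in the error bound for the cubic equation: the first summand comes from the cubic
equation for the mean, the second from the fluctuations around the mean. -/
noncomputable def defectConstant (m : ℕ) (M N K : ℝ) : ℝ :=
  2 * (1 + M ^ 2 * (N + 1)) * (7 + 48 * m + 2 * M) * K + 3 * (9 + M ^ 2)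

section Defect

variable {m n : ℕ} {E : Type*} [MeasurableSpace E] {μ : Measure E} [IsProbabilityMeasure μ]
  {φ : E → ℂ} {x : Fin m × Fin n × Fin n → E} {M N y ε K η δ : ℝ} {α z : ℂ}

theorem norm_cubicDefect_cyclicTransform_le_of_notMem_deviationSet {b T : ℝ} (hm : 1 < m)
    (hn : 0 < n) (h : IsBoundedCentred μ φ b (n : ℝ)⁻¹) (hx : x ∉ deviationSet m n μ φ M N y ε)
    (hM : ‖z‖ ≤ M) (hN : |α.re| ≤ N) (hα : 0 < α.im) (hyα : y ≤ α.im) (hT : 1 ≤ T)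
    (hαT : 1 / α.im ≤ T) :
    ‖cubicDefect α z (cyclicTransform (φ ∘ x) α z)‖ ≤
      2 * (1 + M ^ 2 * (N + 1)) * (7 + 48 * m + 2 * M) * (T ^ 5 * b)
        + 3 * ε * ((9 + M ^ 2) * T ^ 2) := by
  have hdev : ‖cyclicTransform (φ ∘ x) α z - meanTransform m n μ φ α z‖ ≤ 3 * ε := by
    by_contra! hlarge
    exact hx ⟨α, z, hM, hN, hyα, hlarge⟩
  refine (norm_le_norm_add_norm_sub' _ (cubicDefect α z (meanTransform m n μ φ α z))).trans
    (add_le_add (h.norm_cubicDefect_meanTransform_le_pow hm hn hα hT hαT hM hN) ?_)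
  refine (norm_cubicDefect_sub_le hα hT hαT ((norm_cyclicTransform_le (φ ∘ x) z hα).trans hαT)
    ((norm_meanTransform_le z hα).trans hαT) hM).trans ?_
  gcongr

theorem norm_cubicDefect_cyclicTransform_le_errorRate (hm : 1 < m) (hn : 0 < n) (hη : 0 < η)
    (hδ : 0 < δ) (h : IsBoundedCentred μ φ (K * (n : ℝ) ^ δ / √n) (n : ℝ)⁻¹)
    (hx : x ∉ deviationSet m n μ φ M N (cutoff η δ n) ((n : ℝ) ^ (-(1 / 4) : ℝ)))
    (hM : ‖z‖ ≤ M) (hN : |α.re| ≤ N) (hα : cutoff η δ n ≤ α.im) :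
    ‖cubicDefect α z (cyclicTransform (φ ∘ x) α z)‖ ≤ defectConstant m M N K * errorRate η δ n := by
  have hy : 0 < cutoff η δ n := cutoff_pos hn
  have hM₀ : 0 ≤ M := (norm_nonneg z).trans hM
  have hN₀ : 0 ≤ N := (abs_nonneg α.re).trans hN
  have : (0 : ℝ) < n := Nat.cast_pos.mpr hn
  have hK : 0 ≤ K := by
    refine nonneg_of_mul_nonneg_left (b := (n : ℝ) ^ δ / √n) ?_ (by positivity)
    rw [← mul_div_assoc]
    exact h.bound_nonneg
  have hT : 1 ≤ (cutoff η δ n)⁻¹ := (one_le_inv₀ hy).mpr (cutoff_le_one hn (by positivity))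
  have hαT : 1 / α.im ≤ (cutoff η δ n)⁻¹ := by simpa only [one_div] using inv_anti₀ hy hα
  refine (norm_cubicDefect_cyclicTransform_le_of_notMem_deviationSet hm hn h hx hM hN
    (hy.trans_le hα) hα hT hαT).trans ?_
  rw [errorRate_eq, defectConstant, add_mul _ (3 * (9 + M ^ 2))]
  generalize (cutoff η δ n)⁻¹ = T at hT
  have hpow : T ^ 2 ≤ T ^ 5 * (n : ℝ) ^ δ :=
    (pow_le_pow_right₀ hT (by norm_num)).trans (le_mul_of_one_le_right (by positivity)
      (Real.one_le_rpow (Nat.one_le_cast.mpr hn) hδ.le))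
  refine add_le_add ?_ ?_
  · calc _ = 2 * (1 + M ^ 2 * (N + 1)) * (7 + 48 * m + 2 * M) * K *
          (1 / √n * T ^ 5 * (n : ℝ) ^ δ) := by ring
      _ ≤ _ := by
        gcongr
        exact one_div_sqrt_le_rpow_neg_quarter hn
  · calc _ ≤ 3 * (n : ℝ) ^ (-(1 / 4) : ℝ) * ((9 + M ^ 2) * (T ^ 5 * (n : ℝ) ^ δ)) := by gcongr
      _ = _ := by ring

end Defect

/-- The event that the cubic equation fails by more than `c` at some point of the domain under
consideration. -/
def defectSet {Ω : Type*} {m n : ℕ} (X : Fin m → Ω → Matrix (Fin n) (Fin n) ℂ) (M N y c : ℝ) :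
    Set Ω :=
  {ω | ∃ α z : ℂ, ‖z‖ ≤ M ∧ |α.re| ≤ N ∧ y ≤ α.im ∧
    c < ‖cubicDefect α z (shiftedStieltjes (blockCyclic fun k => X k ω) α z)‖}

section DefectSet

variable {Ω : Type*} [MeasurableSpace Ω] {P : Measure Ω} [IsProbabilityMeasure P] {m : ℕ}
  {M N K η δ : ℝ}

theorem IsBoundedEnsemble.measure_defectSet_le {n : ℕ} {X : Fin m → Ω → Matrix (Fin n) (Fin n) ℂ}
    {ξ : Ω → ℂ} (h : IsBoundedEnsemble P X ξ (K * (n : ℝ) ^ δ)) (hm : 1 < m) (hn : 0 < n)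
    (hη : 0 < η) (hδ : 0 < δ) :
    P (defectSet X M N (cutoff η δ n) (defectConstant m M N K * errorRate η δ n)) ≤
      entryMeasure m n (P.map fun ω => ξ ω / (√(n : ℝ) : ℂ))
        (deviationSet m n (P.map fun ω => ξ ω / (√(n : ℝ) : ℂ)) (truncate (K * (n : ℝ) ^ δ / √n))
          M N (cutoff η δ n) ((n : ℝ) ^ (-(1 / 4) : ℝ))) := by
  have hm₀ : 0 < m := one_pos.trans hm
  have : IsProbabilityMeasure (P.map fun ω => ξ ω / (√(n : ℝ) : ℂ)) :=
    Measure.isProbabilityMeasure_map (h.aemeasurable_normalized hm₀ hn)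
  rw [← h.map_entryArray]
  refine (measure_mono_ae ?_).trans (Measure.le_map_apply h.aemeasurable_entryArray _)
  filter_upwards [h.truncate_entryArray_ae_eq] with ω hω
  rintro ⟨α, z, hz, hre, him, hdefect⟩
  by_contra hdev
  have hsmall := norm_cubicDefect_cyclicTransform_le_errorRate hm hn hη hδ
    (h.isBoundedCentred hm₀ hn) hdev hz hre him
  rw [hω] at hsmall
  rw [shiftedStieltjes_blockCyclic _ _ ((cutoff_pos hn).trans_le him)] at hdefect
  exact hdefect.not_ge hsmall

theorem eventually_measure_defectSet_le {X : (n : ℕ) → Fin m → Ω → Matrix (Fin n) (Fin n) ℂ}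
    {ξ : ℕ → Ω → ℂ} (hX : ∀ᶠ n in atTop, IsBoundedEnsemble P (X n) (ξ n) (K * (n : ℝ) ^ δ))
    (hm : 1 < m) (hη : 0 < η) (hδ : 0 < δ) (hδη : δ * η ≤ 1 / 32) (hδ' : δ ≤ 1 / 32) :
    ∀ᶠ n in atTop,
      P (defectSet (X n) M N (cutoff η δ n) (defectConstant m M N K * errorRate η δ n)) ≤
        ENNReal.ofReal (deviationBound n (cutoff η δ n) ((n : ℝ) ^ (-(1 / 4) : ℝ))) := by
  have hlarge (c : ℝ) : ∀ᶠ n : ℕ in atTop, c ≤ n :=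
    tendsto_natCast_atTop_atTop.eventually_ge_atTop c
  filter_upwards [hX, eventually_ge_atTop 2, hlarge (N + 1), hlarge (M + 1),
    eventually_div_le_rpow_neg_quarter 1,
    eventually_div_le_rpow_neg_quarter ((m : ℝ) ^ 2 * (8 * (|K| + M + 2) + 4))]
    with n h hn hN hM hε hKε
  have hm₀ : 0 < m := one_pos.trans hm
  have hn₀ : 0 < n := two_pos.trans_le hn
  have : IsProbabilityMeasure (P.map fun ω => ξ n ω / (√(n : ℝ) : ℂ)) :=
    Measure.isProbabilityMeasure_map (h.aemeasurable_normalized hm₀ hn₀)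
  have hcentred := h.isBoundedCentred hm₀ hn₀
  exact (h.measure_defectSet_le hm hn₀ hη hδ).trans <| measure_deviationSet_le hm₀
    hcentred.measurable (fun u => (hcentred.bound u).trans (mul_rpow_div_sqrt_le hn₀ hδ')) hn hN hM
    (cutoff_pos hn₀) (one_div_cutoff_sq_le hn₀ hδη) hε hKε

end DefectSet

theorem ae_eventually_notMem_of_summable {Ω : Type*} [MeasurableSpace Ω] {P : Measure Ω}
    {s : ℕ → Set Ω} {p : ℕ → ℝ} (hp : Summable p)
    (h : ∀ᶠ n in atTop, P (s n) ≤ ENNReal.ofReal (p n)) :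
    ∀ᵐ ω ∂P, ∀ᶠ n in atTop, ω ∉ s n := by
  obtain ⟨n₀, hn₀⟩ := eventually_atTop.mp h
  have hsum : ∑' n, P (s (n + n₀)) ≠ ∞ :=
    ne_top_of_le_ne_top ((summable_nat_add_iff n₀).mpr hp).tsum_ofReal_ne_top
      (ENNReal.tsum_le_tsum fun n => hn₀ _ (n₀.le_add_left n))
  filter_upwards [ae_eventually_notMem hsum] with ω hω
  rwa [← map_add_atTop_eq_nat n₀, eventually_map]

theorem mainTheorem3 (m : ℕ) (hm : 1 < m) (M N K : ℝ) :
    ∃ C : ℝ, ∀ η δ : ℝ, 0 < η → 0 < δ → δ * η ≤ 1 / 32 → δ ≤ 1 / 32 →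
      ∀ (Ω : Type*) [MeasurableSpace Ω] (P : Measure Ω) [IsProbabilityMeasure P]
        (X : (n : ℕ) → Fin m → Ω → Matrix (Fin n) (Fin n) ℂ) (ξ : ℕ → Ω → ℂ),
        (∀ᶠ n : ℕ in atTop, IsBoundedEnsemble P (X n) (ξ n) (K * (n : ℝ) ^ δ)) →
        ∀ᵐ ω ∂P, ∀ᶠ n : ℕ in atTop, ∀ α z : ℂ,
          ‖z‖ ≤ M → |α.re| ≤ N → cutoff η δ n ≤ α.im →
          let Δ : ℂ := shiftedStieltjes (blockCyclic fun k => X n k ω) α z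
          ‖Δ ^ 3 + 2 * Δ ^ 2 + (α + 1 - (‖z‖ : ℂ) ^ 2) / α * Δ + 1 / α‖
            ≤ C * errorRate η δ n := by
  refine ⟨defectConstant m M N K, fun η δ hη hδ hδη hδ' Ω _ P _ X ξ hens => ?_⟩
  have hae := ae_eventually_notMem_of_summable (summable_deviationBound hδη)
    (eventually_measure_defectSet_le (M := M) (N := N) hens hm hη hδ hδη hδ')
  filter_upwards [hae] with ω hω
  filter_upwards [hω] with n hn α z hz hre him
  exact not_lt.mp fun hdefect => hn ⟨α, z, hz, hre, him, hdefect⟩
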